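/- Let $0<q<1$ and $q=e^{\pi i\tau}$ with $\tau\in i\mathbb R$, and let $\theta(z)=\sum_{k\in\mathbb Z}q^{k^2}e^{2\pi i kz}$. Let $P\in\mathbb C[z,z^{-1}]$ be a Laurent polynomial that takes real values on $S^1=\{|z|=1\}$, has $n>0$ nonzero roots counted with multiplicities, and all of whose nonzero roots satisfy $q<|z|<q^{-1}$. Let $\mathcal A$ be the $\mathbb C$-algebra generated by $u,v,Z,Z^{-1}$ with relations $ZuZ^{-1}=q^2u$, $ZvZ^{-1}=q^{-2}v$, $uv=P(q^{-1}Z)$, $vu=P(qZ)$. Let $c\in\mathbb R$, $t=e^{2\pi i c}$; let $g_t$ be the automorphism of $\mathcal A$ with $g_t(u)=tu$, $g_t(v)=t^{-1}v$, $g_t(Z)=Z$, and let $\rho$ be the antilinear automorphism with $\rho(u)=e^{-\pi i c}v$, $\rho(v)=e^{\pi i c}u$, $\rho(Z)=Z^{-1}$ (so $\rho^2=g_t$). A positive $g_t$-twisted trace is a linear map $T:\mathcal A\to\mathbb C$ with $T(ab)=T(bg_t(a))$ for all $a,b$ such that the form $(a,b)\mapsto T(a\rho(b))$ is positive definite. Let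 $C=C_{P,t}$ be the cone of these traces. Two cones are called isomorphic if there is a bijection between them that preserves addition of elements and multiplication by positive real numbers; the dimension of a cone is the dimension of its real linear span. Let $\alpha_1,\dots,\alpha_n\in\mathbb C$, $0\le\operatorname{Re}\alpha_j<1$, be such that $e^{2\pi i\alpha_1},\dots,e^{2\pi i\alpha_n}$ are the nonzero roots of $P$ with multiplicities, and let $\beta_j=\alpha_j+\frac12$. The function $P(e^{2\pi i x})/\prod_{j:\beta_j\in\mathbb R}\cos(\pi(x-\beta_j))$, with its removable singularities removed, is real, continuous and without zeros on $\mathbb R$; let $m_0=0$ if it is positive and $m_0=1$ if it is negative. **Theorem.** 1. The cone $C$ has dimension $n$. 2. $C$ is isomorphic to the cone of nonzero entire functions $f$ such that $$f(x+1)=f(x),\qquad f(x+\tau)=e^{-\pi i(2nx+n\tau-2\sum\beta_j-2c)}f(x)\qquad(x\in\mathbb C)$$ and such that $$f(x),\qquad e^{\pi i(nx-\sum\beta_j-m_0-c)}f\left(x+\tfrac{\tau}{2}\right)$$ are nonnegative for all $x\in\mathbb R$. There is an isomorphism under which $f$ corresponds to the trace $T$ given by the function $w(z)=f(z)/(\theta(z-\beta_1)\cdots\theta(z-\beta_n))$,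 that is, $T(R(Z))=\int_0^1R(e^{2\pi i x})w(x)\,dx$ for every Laurent polynomial $R$, and $T(a)=0$ whenever $ZaZ^{-1}=q^{2i}a$ with $i\in\mathbb Z\setminus\{0\}$. 3. When traces are identified with functions $w$ in this way, $C$ consists, as a set, exactly of the functions $$\lambda\,\frac{\theta(z-a_1)\cdots\theta(z-a_n)}{\theta(z-\beta_1)\cdots\theta(z-\beta_n)},$$ where $\lambda>0$, $\sum a_i-\sum\beta_i-c-m_0\in2\mathbb Z$, and the $a_i\in\mathbb C$ are divided into pairs $(a_i,a_j)$, $i\ne j$, with $a_i=\overline{a_j}$. 4. In particular, for the same $q$, if $Q$ is another Laurent polynomial that is real on $S^1$, has all its nonzero roots in $q<|z|<q^{-1}$, and has the same number $n$ of nonzero roots counted with multiplicities, and if $|s|=1$, $s=e^{2\pi i d}$ with $d\in\mathbb R$, then the cones $C_{P,t}$ and $C_{Q,s}$ (the latter formed with $d$ in place of $c$) are isomorphic. -/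

import Mathlib

open scoped ComplexOrder LaurentPolynomial

noncomputable section

namespace QWeyl

/-! ### Laurent polynomials -/

/-- The value of the Laurent polynomial `R` at an invertible element `x` with inverse `y` of a
(not necessarily commutative) `ℂ`-algebra: the monomial `z ^ k` becomes `x ^ k` for `k ≥ 0` and
`y ^ (-k)` for `k ≤ 0`. -/
def laurentEval {B : Type*} [Ring B] [Algebra ℂ B] (x y : B) (R : ℂ[T;T⁻¹]) : B :=
  R.coeff.sum fun k a => a • (x ^ k.toNat * y ^ (-k).toNat)

/-- The value `R(z)` at a nonzero complex number `z`. -/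
def evalAt (R : ℂ[T;T⁻¹]) (z : ℂ) : ℂ := laurentEval z z⁻¹ R

/-- `P` takes real values on the unit circle. -/
def RealOnCircle (P : ℂ[T;T⁻¹]) : Prop := ∀ z : ℂ, ‖z‖ = 1 → (evalAt P z).im = 0

/-- The multiset of nonzero roots of a Laurent polynomial, counted with multiplicities: multiply
by a large power of `z` to get a polynomial and take its nonzero roots. -/
def nonzeroRoots (P : ℂ[T;T⁻¹]) : Multiset ℂ :=
  (LaurentPolynomial.trunc
    (LaurentPolynomial.T (P.coeff.support.sup Int.natAbs : ℕ) * P)).roots.filter (· ≠ 0)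

/-- All nonzero roots of `P` lie in the open annulus `q < |z| < q⁻¹`. -/
def RootsInAnnulus (q : ℝ) (P : ℂ[T;T⁻¹]) : Prop := ∀ z ∈ nonzeroRoots P, q < ‖z‖ ∧ ‖z‖ < q⁻¹

/-! ### The generalized `q`-Weyl algebra -/

/-- The four generators; `Zi` stands for `Z⁻¹`. -/
inductive Gen
  | u | v | Z | Zi

/-- A generator, in the free algebra. -/
abbrev gen (g : Gen) : FreeAlgebra ℂ Gen := FreeAlgebra.ι ℂ g

/-- The defining relations. -/
inductive Rel (q : ℂ) (P : ℂ[T;T⁻¹]) : FreeAlgebra ℂ Gen → FreeAlgebra ℂ Gen → Prop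
  | Z_Zi : Rel q P (gen .Z * gen .Zi) 1
  | Zi_Z : Rel q P (gen .Zi * gen .Z) 1
  | Z_u : Rel q P (gen .Z * gen .u * gen .Zi) (q ^ 2 • gen .u)
  | Z_v : Rel q P (gen .Z * gen .v * gen .Zi) ((q ^ 2)⁻¹ • gen .v)
  | u_v : Rel q P (gen .u * gen .v) (laurentEval (q⁻¹ • gen .Z) (q • gen .Zi) P)
  | v_u : Rel q P (gen .v * gen .u) (laurentEval (q • gen .Z) (q⁻¹ • gen .Zi) P)

/-- The algebra generated by `u, v, Z, Z⁻¹` with relations `Z u Z⁻¹ = q² u`, `Z v Z⁻¹ = q⁻² v`,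
`u v = P(q⁻¹ Z)`, `v u = P(q Z)`. -/
abbrev Alg (q : ℂ) (P : ℂ[T;T⁻¹]) : Type := RingQuot (Rel q P)

/-- A generator, in the algebra. -/
def el (q : ℂ) (P : ℂ[T;T⁻¹]) (g : Gen) : Alg q P := RingQuot.mkAlgHom ℂ (Rel q P) (gen g)

/-- `R(Z)`, for a Laurent polynomial `R`. -/
def ofLaurent (q : ℂ) (P R : ℂ[T;T⁻¹]) : Alg q P := laurentEval (el q P .Z) (el q P .Zi) R

/-- `g` is the automorphism `g_t`: `u ↦ t u`, `v ↦ t⁻¹ v`, `Z ↦ Z` (there is exactly one for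
`t ≠ 0`, since `u, v, Z, Z⁻¹` generate the algebra). -/
structure IsTwist (q : ℂ) (P : ℂ[T;T⁻¹]) (t : ℂ) (g : Alg q P ≃ₐ[ℂ] Alg q P) : Prop where
  map_u : g (el q P .u) = t • el q P .u
  map_v : g (el q P .v) = t⁻¹ • el q P .v
  map_Z : g (el q P .Z) = el q P .Z

/-- `ρ` is the antilinear automorphism `u ↦ e^{-πic} v`, `v ↦ e^{πic} u`, `Z ↦ Z⁻¹`
(for real `q ≠ 0` and `P` real on the unit circle there is exactly one). -/
structure IsConjugation (q : ℂ) (P : ℂ[T;T⁻¹]) (c : ℝ) (ρ : Alg q P ≃+* Alg q P) : Prop where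
  map_smul : ∀ (a : ℂ) (x : Alg q P), ρ (a • x) = (starRingEnd ℂ) a • ρ x
  map_u : ρ (el q P .u) = Complex.exp (-(Real.pi * Complex.I * c)) • el q P .v
  map_v : ρ (el q P .v) = Complex.exp (Real.pi * Complex.I * c) • el q P .u
  map_Z : ρ (el q P .Z) = el q P .Zi

/-- `T` is a `g_t`-twisted trace: `T(ab) = T(b g_t(a))`. -/
def IsTwistedTrace (q : ℂ) (P : ℂ[T;T⁻¹]) (t : ℂ) (T : Alg q P →ₗ[ℂ] ℂ) : Prop :=
  ∃ g : Alg q P ≃ₐ[ℂ] Alg q P, IsTwist q P t g ∧ ∀ a b, T (a * b) = T (b * g a)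

/-- The sesquilinear form `(a, b) = T(a ρ(b))` is positive definite. -/
def IsPositive (q : ℂ) (P : ℂ[T;T⁻¹]) (c : ℝ) (T : Alg q P →ₗ[ℂ] ℂ) : Prop :=
  ∃ ρ : Alg q P ≃+* Alg q P, IsConjugation q P c ρ ∧ ∀ a, a ≠ 0 → 0 < T (a * ρ a)

/-- The cone of positive `g_t`-twisted traces, `t = e^{2πic}`. -/
def positiveTraces (q : ℂ) (P : ℂ[T;T⁻¹]) (c : ℝ) : Set (Alg q P →ₗ[ℂ] ℂ) :=
  {T | IsTwistedTrace q P (Complex.exp (2 * Real.pi * Complex.I * c)) T ∧ IsPositive q P c T}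

/-- `T` is given by the function `w`: it vanishes on the components
`{a | Z a Z⁻¹ = q^{2i} a}`, `i ≠ 0`, and `T(R(Z)) = ∫₀¹ R(e^{2πix}) w(x) dx`. -/
def IsGivenBy {q : ℂ} {P : ℂ[T;T⁻¹]} (T : Alg q P →ₗ[ℂ] ℂ) (w : ℂ → ℂ) : Prop :=
  (∀ i : ℤ, i ≠ 0 → ∀ a : Alg q P,
    el q P .Z * a * el q P .Zi = q ^ (2 * i) • a → T a = 0) ∧
  ∀ R : ℂ[T;T⁻¹], T (ofLaurent q P R) =
    ∫ x in (0 : ℝ)..1, evalAt R (Complex.exp (2 * Real.pi * Complex.I * x)) * w x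

/-! ### Cones -/

/-- A bijection between two subsets of real vector spaces that preserves addition of elements and
multiplication by positive real numbers. -/
def IsConeIso {V W : Type*} [AddCommGroup V] [Module ℝ V] [AddCommGroup W] [Module ℝ W]
    {C : Set V} {D : Set W} (e : C ≃ D) : Prop :=
  (∀ x y z : C, (z : V) = x + y → (e z : W) = e x + e y) ∧
  ∀ (r : ℝ), 0 < r → ∀ x y : C, (y : V) = r • (x : V) → (e y : W) = r • (e x : W)

/-! ### Theta functions and the sign attached to `P` -/

/-- `θ(z - a₁) ⋯ θ(z - aₙ)`, where `θ(z) = θ(z; τ) = ∑ₖ e^{πiτk² + 2πikz}`. -/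
def thetaProd (τ : ℂ) {n : ℕ} (a : Fin n → ℂ) (z : ℂ) : ℂ := ∏ j, jacobiTheta₂ (z - a j) τ

open Classical in
/-- The product of `cos(π(x - βⱼ))` over the `j` with `βⱼ` real. -/
def cosProd {n : ℕ} (β : Fin n → ℂ) (x : ℝ) : ℝ :=
  ∏ j with (β j).im = 0, Real.cos (Real.pi * (x - (β j).re))

open Classical in
/-- `0` if `P(e^{2πix}) / ∏_{βⱼ real} cos(π(x - βⱼ))` is positive on the real line (away from the
common zeros of numerator and denominator), and `1` otherwise. -/
def signParam (P : ℂ[T;T⁻¹]) {n : ℕ} (β : Fin n → ℂ) : ℕ :=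
  if ∀ x : ℝ, evalAt P (Complex.exp (2 * Real.pi * Complex.I * x)) ≠ 0 →
      0 < (evalAt P (Complex.exp (2 * Real.pi * Complex.I * x))).re / cosProd β x
  then 0 else 1

/-- The cone of nonzero entire functions `f` with `f(x+1) = f(x)`,
`f(x+τ) = e^{-πi(2nx + nτ - 2s - 2c)} f(x)`, such that `f(x)` and
`e^{πi(nx - s - m - c)} f(x + τ/2)` are nonnegative for real `x`. -/
def thetaCone (τ : ℂ) (n : ℕ) (s : ℂ) (c : ℝ) (m : ℕ) : Set (ℂ → ℂ) :=
  {f | f ≠ 0 ∧ Differentiable ℂ f ∧ (∀ x, f (x + 1) = f x) ∧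
    (∀ x, f (x + τ) =
      Complex.exp (-(Real.pi * Complex.I * (2 * n * x + n * τ - 2 * s - 2 * c))) * f x) ∧
    ∀ x : ℝ, 0 ≤ f x ∧
      0 ≤ Complex.exp (Real.pi * Complex.I * (n * x - s - m - c)) * f (x + τ / 2)}

/-- The set of functions `λ θ(z-a₁)⋯θ(z-aₙ) / (θ(z-β₁)⋯θ(z-βₙ))` with `λ > 0`,
`∑ aᵢ - ∑ βᵢ - c - m ∈ 2ℤ` and the `aᵢ` divided into pairs of conjugate numbers. -/
def thetaQuotients (τ : ℂ) {n : ℕ} (β : Fin n → ℂ) (c : ℝ) (m : ℕ) : Set (ℂ → ℂ) :=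
  {w | ∃ (r : ℝ) (a : Fin n → ℂ) (σ : Equiv.Perm (Fin n)), 0 < r ∧
    (∃ k : ℤ, ∑ i, a i - ∑ i, β i - c - m = 2 * k) ∧
    (∀ i, σ (σ i) = i ∧ σ i ≠ i ∧ a (σ i) = (starRingEnd ℂ) (a i)) ∧
    w = fun z => r * (thetaProd τ a z / thetaProd τ β z)}

end QWeyl

end

/-! A twisted trace lives in degree zero: `g_t` fixes Z, so T(ZaZ⁻¹) = T(a), while conjugation by Z
multiplies degree i by q^{2i} ≠ 1. Hence T is a functional L on Laurent polynomials, L(R) = T(R(Z)).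
Pairing u with R(Z)v shows that the trace property amounts to `IsTwFun`: L((PM)(q⁻¹z)) = t
L((PM)(qz)) for all M.

Solutions come from w = f/∏θ(z-β_j), where f is a theta function of degree n whose multipliers make
w 1-periodic with w(z+τ) = t w(z). By the Jacobi triple product (`theta_product`), in the closed
strip |Im z| ≤ Im τ/2 the zeros of ∏θ(z+τ/2-β_j) are exactly those of P(e^{2πiz}), so P(e^{2πiz})
w(z+τ/2) extends there to a holomorphic V. Both sides of the trace condition equal the integral of
M(e^{2πiz}) V(z) along the real line, reached from the two edges of the strip (`isTwFun_intFun`).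

There are no other solutions. A functional that kills the ideal (P) is determined by n consecutive
moments. The functional R ↦ L(R(q⁻¹z)) - t L(R(qz)) is of this kind, and its l-th moment is q^{-l} -
tq^l times that of L, a factor that is nonzero for l ≠ 0 because |t| = 1. So L is determined by its
moments 0, ..., n-1 (`IsTwFun.eq_zero`). Since n independent theta functions can be written down,
theta functions and solutions both have dimension n, and they correspond (`exists_eq_intFun`).

For positivity, different degrees are orthogonal, and ρ² = g_t gives T(xb ρ(xb)) = T(bρ(x)
ρ(bρ(x))), which relates degrees i+1 and i-1; only degrees 0 and 1 matter
(`isPositive_traceOf_iff`). There the form is ∫|R|²w and e^{-πic}∫|R|²V. By density of Laurent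
polynomials it is positive definite exactly when w and e^{-πic}V are nonnegative and not identically
zero on ℝ. The signs of ∏θ(x-β_j) and of the constant in P turn this into the two conditions on f
(`intFun_positive_iff`).

The cone of such f is understood directly. A real zero, or a zero on ℝ+τ/2, is double, and other
zeros come in conjugate pairs, so factors θ(z-a)θ(z-ā) split off until a positive constant remains
(`exists_theta_factorization`). A strictly positive element shows that the cone spans all theta
functions that are real on ℝ, a real form of an n-dimensional space (`span_posTheta`,
`rank_realTheta`). Finally, a real translation of f moves the characteristic to any real value, so
up to isomorphism the cone depends only on τ and n. -/

noncomputable section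
namespace QWeyl
open Filter Topology Complex

/-! ### Entire functions -/

lemma eq_of_mul_eq_mul {h A B : ℂ → ℂ} (hh : Differentiable ℂ h) (hA : Differentiable ℂ A)
    (hB : Differentiable ℂ B) (h0 : ∃ z, h z ≠ 0) (H : ∀ z, h z * A z = h z * B z) (z : ℂ) :
    A z = B z := by
  have h1 : AnalyticOnNhd ℂ h Set.univ := fun z _ => hh.analyticAt z
  have h2 : AnalyticOnNhd ℂ (A - B) Set.univ := fun z _ => (hA.sub hB).analyticAt z
  rcases h1.eq_zero_or_eq_zero_of_smul_eq_zero h2 (fun z _ => by simp [mul_sub, H z])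
    isPreconnected_univ with h | h
  · obtain ⟨z, hz⟩ := h0
    exact absurd (h z trivial) hz
  · simpa [sub_eq_zero] using h z trivial

/-- The zeros of h are simple, so the quotient has removable singularities with value f'/h'. Near
such a zero it coincides with the quotient of the difference slopes of f and h. -/
theorem exists_differentiable_mul_eq {f h : ℂ → ℂ} (hf : Differentiable ℂ f)
    (hh : Differentiable ℂ h) (hz : ∀ z, h z = 0 → f z = 0) (hs : ∀ z, h z = 0 → deriv h z ≠ 0) :
    ∃ g, Differentiable ℂ g ∧ ∀ z, f z = h z * g z := by
  classical
  refine ⟨fun z => if h z = 0 then deriv f z / deriv h z else f z / h z, fun z0 => ?_, fun z => ?_⟩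
  · have dd : ∀ {F : ℂ → ℂ}, Differentiable ℂ F → Differentiable ℂ (dslope F z0) := fun {F} hF =>
      differentiableOn_univ.1 ((Complex.differentiableOn_dslope univ_mem).2 hF.differentiableOn)
    by_cases h0 : h z0 = 0
    · have hd0 : dslope h z0 z0 ≠ 0 := by simpa using hs z0 h0
      have hev : ∀ᶠ z in 𝓝 z0, dslope h z0 z ≠ 0 :=
        (dd hh).continuous.continuousAt.eventually_ne hd0
      refine DifferentiableAt.congr_of_eventuallyEq
        (((dd hf) z0).div ((dd hh) z0) hd0) ?_
      filter_upwards [hev] with z hz1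
      by_cases hzz : z = z0
      · subst hzz; simp [h0]
      · have e1 : h z = (z - z0) * dslope h z0 z := by
          have := sub_smul_dslope h z0 z
          simp only [smul_eq_mul, h0, sub_zero] at this
          exact this.symm
        have e2 : f z = (z - z0) * dslope f z0 z := by
          have := sub_smul_dslope f z0 z
          simp only [smul_eq_mul, hz z0 h0, sub_zero] at this
          exact this.symm
        have h3 : z - z0 ≠ 0 := sub_ne_zero.2 hzz
        have h4 : h z ≠ 0 := by rw [e1]; exact mul_ne_zero h3 hz1
        simp only [h4, if_false, Pi.div_apply]
        rw [e1, e2, mul_div_mul_left _ _ h3]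
    · refine DifferentiableAt.congr_of_eventuallyEq ((hf z0).div (hh z0) h0) ?_
      filter_upwards [hh.continuous.continuousAt.eventually_ne h0] with z hz1
      simp [hz1]
  · by_cases h0 : h z = 0
    · simp [h0, hz z h0]
    · simp only [h0, if_false]; field_simp

/-- Every complex number is congruent to one in a given fundamental strip modulo `ℤτ`. -/
lemma exists_int_im_mem {τ : ℂ} (hi : 0 < τ.im) (b : ℝ) (z : ℂ) :
    ∃ k : ℤ, b < (z + k * τ).im ∧ (z + k * τ).im ≤ b + τ.im := by
  obtain ⟨k, hk, -⟩ := existsUnique_add_zsmul_mem_Ioc hi z.im b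
  exact ⟨k, by simpa using hk⟩

lemma norm_add_int {f : ℂ → ℂ} {w : ℂ} (h : ∀ z, ‖f (z + w)‖ = ‖f z‖) (k : ℤ) (z : ℂ) :
    ‖f (z + k * w)‖ = ‖f z‖ := by
  induction k using Int.induction_on with
  | zero => simp
  | succ k ih => rw [← ih, ← h (z + ((k : ℤ) : ℂ) * w)]; congr 2; push_cast; ring
  | pred k ih => rw [← ih, ← h (z + _)]; congr 2; push_cast; ring

/-- Liouville: the norm is bounded by its maximum over a fundamental rectangle. Periodicity is asked
only of the norm, so that theta functions of degree zero, whose multiplier under τ is a unimodular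
constant, are covered. -/
theorem exists_eq_const_of_norm_periodic {τ : ℂ} (hi : 0 < τ.im) {f : ℂ → ℂ}
    (hf : Differentiable ℂ f) (h1 : ∀ z, ‖f (z + 1)‖ = ‖f z‖) (h2 : ∀ z, ‖f (z + τ)‖ = ‖f z‖) :
    ∃ c, ∀ z, f z = c := by
  have hb : Bornology.IsBounded (Set.range f) := by
    have hK : IsCompact (Set.Icc (0 : ℝ) 1 ×ℂ Set.Icc (0 : ℝ) τ.im) :=
      isCompact_Icc.reProdIm isCompact_Icc
    obtain ⟨M, hM⟩ := (hK.image hf.continuous).isBounded.exists_norm_le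
    refine (isBounded_iff_forall_norm_le).2 ⟨M, ?_⟩
    rintro _ ⟨z, rfl⟩
    obtain ⟨k, hk1, hk2⟩ := exists_int_im_mem hi 0 z
    rw [← norm_add_int h2 k z, ← norm_add_int h1 (-⌊(z + k * τ).re⌋)]
    refine hM _ ⟨_, ?_, rfl⟩
    have ha := Int.floor_le (z + k * τ).re
    have hb := Int.lt_floor_add_one (z + k * τ).re
    have e1 : (z + k * τ + ((-⌊(z + k * τ).re⌋ : ℤ) : ℂ) * 1).re
      = (z + k * τ).re - ⌊(z + k * τ).re⌋ := by
      rw [mul_one, Complex.add_re, Complex.intCast_re]; push_cast; ring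
    have e2 : (z + k * τ + ((-⌊(z + k * τ).re⌋ : ℤ) : ℂ) * 1).im = (z + k * τ).im := by
      rw [mul_one, Complex.add_im, Complex.intCast_im]; ring
    rw [Complex.mem_reProdIm, e1, e2]
    exact ⟨⟨by linarith, by linarith⟩, hk1.le, by linarith⟩
  exact ⟨f 0, fun z => hf.apply_eq_apply_of_bounded hb z 0⟩

/-! ### The infinite product -/

/-- `∏_{m ≥ 1} (1 + Q ^ m u)` -/
def qProd (Q : ℝ) (u : ℂ) : ℂ := ∏' m : ℕ, (1 + (Q : ℂ) ^ (m + 1) * u)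

variable {Q : ℝ}

lemma summable_qProd (h0 : 0 < Q) (h1 : Q < 1) (u : ℂ) :
    Summable fun m : ℕ => ‖(Q : ℂ) ^ (m + 1) * u‖ := by
  have := ((summable_geometric_of_lt_one h0.le h1).mul_left Q).mul_right ‖u‖
  refine this.congr fun m => ?_
  simp [abs_of_pos h0, pow_succ']

lemma qProd_eq (h0 : 0 < Q) (h1 : Q < 1) (u : ℂ) :
    qProd Q u = (1 + Q * u) * qProd Q (Q * u) := by
  unfold qProd
  have := (multipliable_one_add_of_summable (summable_qProd h0 h1 u))
  rw [tprod_eq_zero_mul']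
  · simp only [zero_add, pow_one]
    congr 2; ext m; ring
  · refine (multipliable_one_add_of_summable (summable_qProd h0 h1 (Q * u))).congr fun m => ?_
    ring

lemma qProd_ne_zero (h0 : 0 < Q) (h1 : Q < 1) {u : ℂ} (hu : ‖u‖ < Q⁻¹) : qProd Q u ≠ 0 := by
  refine tprod_one_add_ne_zero_of_summable (fun m h => ?_) (summable_qProd h0 h1 u)
  have h2 : ‖(Q : ℂ) ^ (m + 1) * u‖ < 1 := by
    rw [norm_mul, norm_pow, Complex.norm_real, Real.norm_of_nonneg h0.le, pow_succ, mul_assoc]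
    have : Q * ‖u‖ < 1 := by
      have := mul_lt_mul_of_pos_left hu h0
      rwa [mul_inv_cancel₀ h0.ne'] at this
    calc Q ^ m * (Q * ‖u‖) ≤ 1 * (Q * ‖u‖) := by
          gcongr; exact pow_le_one₀ h0.le h1.le
      _ < 1 := by simpa
  rw [eq_neg_of_add_eq_zero_right h] at h2
  simp at h2

lemma qProd_conj (u : ℂ) : qProd Q ((starRingEnd ℂ) u) = (starRingEnd ℂ) (qProd Q u) := by
  unfold qProd
  have := Function.LeftInverse.map_tprod (L := .unconditional ℕ)
    (fun m : ℕ => 1 + (Q : ℂ) ^ (m + 1) * u)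
    (g := starRingEnd ℂ) (g' := starRingEnd ℂ)
    Complex.continuous_conj Complex.continuous_conj (fun x => by simp)
  rw [this]; simp

lemma differentiable_qProd (h0 : 0 < Q) (h1 : Q < 1) : Differentiable ℂ (qProd Q) := by
  intro u
  have hu : Summable fun m : ℕ => ‖Q ^ (m + 1) * (‖u‖ + 1)‖ := by
    have := summable_qProd h0 h1 ((‖u‖ + 1 : ℝ) : ℂ)
    simp only [norm_mul, norm_pow, Complex.norm_real] at this ⊢
    exact this
  have := Summable.hasProdLocallyUniformlyOn_nat_one_add (K := Metric.ball (0 : ℂ) (‖u‖ + 1))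
    (f := fun m u => (Q : ℂ) ^ (m + 1) * u) Metric.isOpen_ball hu
    (.of_forall fun m z hz => ?_) (fun m => by fun_prop)
  · rw [hasProdLocallyUniformlyOn_iff_tendstoLocallyUniformlyOn] at this
    exact (this.differentiableOn (.of_forall fun s => by
      refine DifferentiableOn.fun_finsetProd fun m _ => by fun_prop) Metric.isOpen_ball).differentiableAt
        (Metric.isOpen_ball.mem_nhds (by simp))
  · simp only [norm_mul, norm_pow, Complex.norm_real]
    gcongr
    rw [Real.norm_of_nonneg (by positivity)]
    simpa using (mem_ball_zero_iff.1 hz).le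

/-! ### The exponential `e^{2πiy}` -/

/-- `e^{2πiy}` -/
def E (y : ℂ) : ℂ := Complex.exp (2 * Real.pi * Complex.I * y)

lemma E_add (x y : ℂ) : E (x + y) = E x * E y := by simp [E, mul_add, Complex.exp_add]
lemma E_neg (x : ℂ) : E (-x) = (E x)⁻¹ := by simp [E, Complex.exp_neg]
lemma E_sub (x y : ℂ) : E (x - y) = E x / E y := by rw [sub_eq_add_neg, E_add, E_neg]; rfl
@[simp] lemma E_zero : E 0 = 1 := by simp [E]
@[simp] lemma E_ne_zero (x : ℂ) : E x ≠ 0 := Complex.exp_ne_zero _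
@[simp] lemma E_one : E 1 = 1 := by simp [E, Complex.exp_two_pi_mul_I]
lemma E_add_one (x : ℂ) : E (x + 1) = E x := by simp [E_add]
lemma E_int (k : ℤ) : E k = 1 := by
  rw [E, mul_comm]; exact Complex.exp_int_mul_two_pi_mul_I k
lemma E_half : E (1 / 2) = -1 := by
  rw [E, ← Complex.exp_pi_mul_I]; congr 1; ring
lemma E_eq_iff {x y : ℂ} : E x = E y ↔ ∃ k : ℤ, x = y + k := by
  rw [E, E, Complex.exp_eq_exp_iff_exists_int]
  refine exists_congr fun k => ?_
  have h : (2 * Real.pi * Complex.I : ℂ) ≠ 0 := Complex.two_pi_I_ne_zero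
  rw [show 2 * Real.pi * Complex.I * y + k * (2 * Real.pi * Complex.I)
    = 2 * Real.pi * Complex.I * (y + k) by ring]
  exact mul_right_inj' h
lemma norm_E (x : ℂ) : ‖E x‖ = Real.exp (-(2 * Real.pi * x.im)) := by
  rw [E, Complex.norm_exp]; simp
lemma conj_E (x : ℂ) : (starRingEnd ℂ) (E x) = E (-(starRingEnd ℂ) x) := by
  rw [E, E, ← Complex.exp_conj]; simp [Complex.conj_ofNat]
@[fun_prop] lemma differentiable_E : Differentiable ℂ E := by unfold E; fun_prop
lemma hasDerivAt_E (x : ℂ) : HasDerivAt E (2 * Real.pi * Complex.I * E x) x := by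
  have := ((hasDerivAt_id x).const_mul (2 * Real.pi * Complex.I)).cexp
  simp only [mul_one] at this
  rw [mul_comm (2 * Real.pi * Complex.I : ℂ) (E x)]
  exact this

/-! ### Zeros of quasiperiodic functions -/

lemma iff_add_int {p : ℂ → Prop} {w : ℂ} (h : ∀ z, p (z + w) ↔ p z) (k : ℤ) (z : ℂ) :
    p (z + k * w) ↔ p z := by
  induction k using Int.induction_on with
  | zero => simp
  | succ k ih =>
    rw [← ih, ← h (z + ((k : ℤ) : ℂ) * w)]
    exact iff_of_eq (congrArg p (by push_cast; ring))
  | pred k ih =>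
    rw [← ih, ← h (z + _)]
    exact iff_of_eq (congrArg p (by push_cast; ring))

lemma zero_add_iff {F m : ℂ → ℂ} {w : ℂ} (hm0 : ∀ z, m z ≠ 0)
    (h : ∀ z, F (z + w) = m z * F z) (z : ℂ) : F (z + w) = 0 ↔ F z = 0 := by
  rw [h]; simp [hm0 z]

/-- The multiplier does not vanish, so translation by a quasi-period preserves zeros of order at
least two; simplicity of zeros then need only be checked in one period strip. -/
lemma double_zero_add_iff {F m : ℂ → ℂ} {w : ℂ} (hF : Differentiable ℂ F)
    (hm : Differentiable ℂ m) (hm0 : ∀ z, m z ≠ 0)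
    (h : ∀ z, F (z + w) = m z * F z) (z : ℂ) :
    (F (z + w) = 0 ∧ deriv F (z + w) = 0) ↔ (F z = 0 ∧ deriv F z = 0) := by
  rw [zero_add_iff hm0 h]
  refine and_congr_right fun h0 => ?_
  have h1 : deriv F (z + w) = deriv m z * F z + m z * deriv F z := by
    rw [← deriv_comp_add_const, funext h]
    exact ((hm z).hasDerivAt.mul (hF z).hasDerivAt).deriv
  rw [h1, h0]; simp [hm0 z]

/-! ### The theta function -/

section theta
variable {τ : ℂ} (hτ : τ.re = 0) (hi : 0 < τ.im)

/-- `∏_{m ≥ 1} (1 + q^{2m} e^{2πiy}) (1 + q^{2m} e^{-2πiy})` -/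
def thetaK (τ y : ℂ) : ℂ :=
  qProd (Real.exp (-(2 * Real.pi * τ.im))) (E y) * qProd (Real.exp (-(2 * Real.pi * τ.im))) (E (-y))

include hi in
lemma nome_lt_one : Real.exp (-(2 * Real.pi * τ.im)) < 1 := by
  rw [Real.exp_lt_one_iff]; have := Real.pi_pos; nlinarith [mul_pos this hi]

include hτ in
lemma E_tau : E τ = (Real.exp (-(2 * Real.pi * τ.im)) : ℝ) := by
  rw [E, Complex.ofReal_exp]; congr 1
  apply Complex.ext <;> simp [hτ]

include hi in
@[fun_prop] lemma differentiable_thetaK : Differentiable ℂ (thetaK τ) := by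
  have := differentiable_qProd (Real.exp_pos _) (nome_lt_one hi)
  unfold thetaK; fun_prop

include hτ hi in
lemma thetaK_add (y : ℂ) : (1 + E (y + τ)) * thetaK τ (y + τ) = (1 + E (-y)) * thetaK τ y := by
  have h := qProd_eq (Real.exp_pos _) (nome_lt_one hi)
  have e1 : E (y + τ) = (Real.exp (-(2 * Real.pi * τ.im)) : ℝ) * E y := by
    rw [E_add, E_tau hτ, mul_comm]
  have e2 : (Real.exp (-(2 * Real.pi * τ.im)) : ℝ) * E (-(y + τ)) = E (-y) := by
    rw [← E_tau hτ, ← E_add]; congr 1; ring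
  unfold thetaK
  rw [h (E y), h (E (-(y + τ))), e2, e1]; ring

include hi in
-- Both products start at m = 1, so every factor is nonzero in this strip. The factor 1 + e^{-2πiy}
-- of the triple product therefore carries all zeros of θ(y+τ/2) there; the cancellation against P
-- rests on this.
lemma thetaK_ne_zero {y : ℂ} (h : |y.im| < τ.im) : thetaK τ y ≠ 0 := by
  have := abs_lt.1 h
  have := Real.pi_pos
  refine mul_ne_zero ?_ ?_ <;>
  · refine qProd_ne_zero (Real.exp_pos _) (nome_lt_one hi) ?_
    rw [norm_E, ← Real.exp_neg, Real.exp_lt_exp]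
    try rw [Complex.neg_im]
    nlinarith

lemma thetaK_conj (y : ℂ) : thetaK τ ((starRingEnd ℂ) y) = (starRingEnd ℂ) (thetaK τ y) := by
  rw [thetaK, thetaK, map_mul, ← qProd_conj, ← qProd_conj, conj_E, conj_E, map_neg, neg_neg]; ring

include hi in
lemma thetaK_pos (x : ℝ) : 0 < thetaK τ x := by
  have h : qProd (Real.exp (-(2 * Real.pi * τ.im))) (E (-x)) =
    (starRingEnd ℂ) (qProd (Real.exp (-(2 * Real.pi * τ.im))) (E x)) := by
    rw [← qProd_conj, conj_E, Complex.conj_ofReal]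
  have h0 := thetaK_ne_zero (τ := τ) hi (y := x) (by simpa using hi)
  rw [thetaK, h, Complex.mul_conj] at h0 ⊢
  have := Complex.normSq_nonneg (qProd (Real.exp (-(2 * Real.pi * τ.im))) (E x))
  norm_cast at *
  exact lt_of_le_of_ne this (Ne.symm h0)

include hi in
@[fun_prop] lemma differentiable_theta : Differentiable ℂ fun z => jacobiTheta₂ z τ :=
  fun z => differentiableAt_jacobiTheta₂_fst z hi

lemma theta_add_tau (z : ℂ) :
    jacobiTheta₂ (z + τ) τ = Complex.exp (-(Real.pi * Complex.I * (2 * z + τ))) * jacobiTheta₂ z τ := by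
  rw [jacobiTheta₂_add_left']; congr 2; ring

lemma theta_half_period : jacobiTheta₂ (1 / 2 + τ / 2) τ = 0 := by
  have h1 := theta_add_tau (τ := τ) (-(1 / 2 + τ / 2))
  have h2 : jacobiTheta₂ (-(1 / 2 + τ / 2) + τ) τ = jacobiTheta₂ (1 / 2 + τ / 2) τ := by
    rw [← jacobiTheta₂_add_left]; congr 1; ring
  rw [h2, jacobiTheta₂_neg_left, show -(Real.pi * Complex.I * (2 * -(1 / 2 + τ / 2) + τ))
    = Real.pi * Complex.I by ring, Complex.exp_pi_mul_I] at h1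
  linear_combination h1 / 2

include hτ in
lemma conj_tau : (starRingEnd ℂ) τ = -τ := by
  apply Complex.ext <;> simp [hτ]

include hτ in
lemma theta_conj (z : ℂ) :
    jacobiTheta₂ ((starRingEnd ℂ) z) τ = (starRingEnd ℂ) (jacobiTheta₂ z τ) := by
  rw [jacobiTheta₂_conj, conj_tau hτ, neg_neg]

include hτ hi in
-- At τ/2 the exponents n² + n of the nome make every term of the series a positive real number.
-- This fixes the sign of the constant in the triple product.
lemma theta_tau_half_pos : 0 < jacobiTheta₂ (τ / 2) τ := by
  have h := hasSum_jacobiTheta₂_term (τ / 2) hi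
  have e : ∀ n : ℤ, jacobiTheta₂_term n (τ / 2) τ
      = ((Real.exp (-(Real.pi * τ.im * (n + n ^ 2))) : ℝ) : ℂ) := fun n => by
    rw [jacobiTheta₂_term, Complex.ofReal_exp]; congr 1
    have : τ = Complex.I * τ.im := by apply Complex.ext <;> simp [hτ]
    generalize τ.im = t at *
    subst this
    push_cast
    ring_nf; rw [Complex.I_sq]; ring
  rw [show (fun n => jacobiTheta₂_term n (τ / 2) τ) = _ from funext e] at h
  have h2 := h.tsum_eq
  have hs : Summable fun n : ℤ => Real.exp (-(Real.pi * τ.im * (n + n ^ 2))) := by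
    exact_mod_cast h.summable
  rw [← Complex.ofReal_tsum] at h2
  rw [← h2]
  have := hs.tsum_pos (fun n => (Real.exp_pos _).le) 0 (Real.exp_pos _)
  exact_mod_cast this

include hτ hi in
/-- Jacobi's triple product, up to the value of the constant. -/
theorem theta_product : ∃ C : ℝ, 0 < C ∧
    (∀ y, jacobiTheta₂ (y + τ / 2) τ = C * ((1 + E (-y)) * thetaK τ y)) ∧
    ∀ y, (1 + E (-y)) * thetaK τ y = 0 → ((∃ k l : ℤ, y = 1 / 2 + k + l * τ) ∧
      deriv (fun y => (1 + E (-y)) * thetaK τ y) y ≠ 0) := by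
  set L : ℂ → ℂ := fun y => (1 + E (-y)) * thetaK τ y with hL
  have dK := differentiable_thetaK (τ := τ) hi
  have dL : Differentiable ℂ L := by fun_prop
  have dT := differentiable_theta (τ := τ) hi
  have Ladd : ∀ y, L (y + τ) = E (-(y + τ)) * L y := fun y => by
    simp only [hL]
    rw [← thetaK_add hτ hi y, E_neg]
    have := E_ne_zero (y + τ)
    field_simp
    ring
  have L1 : ∀ y, L (y + 1) = L y := fun y => by
    simp only [hL, thetaK, E_add_one, neg_add, E_add _ (-1), E_neg 1, E_one]
    simp
  have hm0 : ∀ y, E (-(y + τ)) ≠ 0 := fun y => E_ne_zero _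
  have hm : Differentiable ℂ fun y => E (-(y + τ)) := by fun_prop
  -- Any zero is moved by a multiple of τ into the strip |Im y| ≤ Im τ/2. There `thetaK` does not
  -- vanish, so the zero comes from 1 + e^{-2πiy}, whose zeros are simple.
  have key : ∀ y, L y = 0 → ((∃ k l : ℤ, y = 1 / 2 + k + l * τ) ∧ deriv L y ≠ 0) := by
    intro y hy
    obtain ⟨l, hl1, hl2⟩ := exists_int_im_mem hi (-(τ.im / 2)) y
    set y0 := y + l * τ with hy0
    have hK : thetaK τ y0 ≠ 0 := thetaK_ne_zero hi (abs_lt.2 ⟨by linarith, by linarith⟩)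
    have h0 : L y0 = 0 := (iff_add_int (p := fun y => L y = 0) (zero_add_iff hm0 Ladd) l y).2 hy
    have h1 : 1 + E (-y0) = 0 := (mul_eq_zero.1 h0).resolve_right hK
    have h2 : E y0 = E (1 / 2) := by
      rw [E_half, ← inv_inv (E y0), ← E_neg, eq_neg_of_add_eq_zero_right h1]; norm_num
    obtain ⟨k, hk⟩ := E_eq_iff.1 h2
    refine ⟨⟨k, -l, ?_⟩, fun hd => ?_⟩
    · rw [← hk, hy0]; push_cast; ring
    · have h3 := ((iff_add_int (p := fun y => L y = 0 ∧ deriv L y = 0)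
        (double_zero_add_iff dL hm hm0 Ladd) l y).2 ⟨hy, hd⟩).2
      rw [← hy0] at h3
      have hE : HasDerivAt (fun y => 1 + E (-y)) (-(2 * Real.pi * Complex.I * E (-y0))) y0 := by
        have := ((hasDerivAt_E (-y0)).comp y0 (hasDerivAt_neg y0)).const_add 1
        simpa using this
      rw [(HasDerivAt.fun_mul hE (dK y0).hasDerivAt).deriv, h1] at h3
      simp [hK, Complex.I_ne_zero, Real.pi_ne_zero] at h3
  have dM : Differentiable ℂ fun y => jacobiTheta₂ (y + τ / 2) τ := by
    exact dT.comp (by fun_prop : Differentiable ℂ fun y => y + τ / 2)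
  have M1 : ∀ y, jacobiTheta₂ (y + 1 + τ / 2) τ = jacobiTheta₂ (y + τ / 2) τ := fun y => by
    rw [← jacobiTheta₂_add_left (y + τ / 2)]; congr 1; ring
  have Madd : ∀ y, jacobiTheta₂ (y + τ + τ / 2) τ = E (-(y + τ)) * jacobiTheta₂ (y + τ / 2) τ :=
    fun y => by
    rw [show y + τ + τ / 2 = y + τ / 2 + τ by ring, theta_add_tau, E]; congr 2; ring
  -- The zeros of L are simple and are zeros of θ(y+τ/2), so the quotient is entire. Numerator and
  -- denominator have the same multipliers, hence the quotient is doubly periodic and constant.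
  obtain ⟨g, dg, hg⟩ := exists_differentiable_mul_eq dM dL (fun y hy => by
    obtain ⟨⟨k, l, rfl⟩, -⟩ := key y hy
    rw [iff_add_int (p := fun y => jacobiTheta₂ (y + τ / 2) τ = 0) 
      (zero_add_iff (F := fun y => jacobiTheta₂ (y + τ / 2) τ) hm0 Madd) l]
    have := iff_add_int (p := fun y => jacobiTheta₂ (y + τ / 2) τ = 0) (w := 1)
      (fun y => by rw [M1]) k (1 / 2)
    rw [mul_one] at this
    exact this.2 theta_half_period) (fun y hy => (key y hy).2)
  have hL0 : 0 < L 0 := by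
    have := thetaK_pos (τ := τ) hi 0
    simp only [hL, neg_zero, E_zero]
    rw [Complex.ofReal_zero] at this
    exact mul_pos (by norm_num) this
  have g1 := eq_of_mul_eq_mul dL (dg.comp (differentiable_id.add_const 1)) dg ⟨0, hL0.ne'⟩
    (fun y => by
      have := hg (y + 1)
      rw [M1, hg, L1] at this
      exact this.symm)
  have g2 := eq_of_mul_eq_mul dL (dg.comp (differentiable_id.add_const τ)) dg ⟨0, hL0.ne'⟩
    (fun y => by
      have := hg (y + τ)
      rw [Madd, hg y, Ladd] at this
      refine (mul_left_cancel₀ (hm0 y) ?_).symm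
      simp only [Function.comp, id]
      linear_combination this)
  obtain ⟨c, hc⟩ := exists_eq_const_of_norm_periodic hi dg
    (fun z => by rw [← g1 z]; rfl) (fun z => by rw [← g2 z]; rfl)
  have h0 := hg 0
  simp only [zero_add, hc] at h0
  have hc0 : 0 < c := by
    have : 0 < L 0 * c := h0 ▸ theta_tau_half_pos hτ hi
    exact (pos_iff_pos_of_mul_pos this).1 hL0
  have hcr : ((c.re : ℝ) : ℂ) = c := by
    rw [Complex.lt_def] at hc0
    apply Complex.ext <;> simp [← hc0.2]
  refine ⟨c.re, (Complex.lt_def.1 hc0).1, fun y => ?_, key⟩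
  rw [hcr, hg y, hc]; ring

include hτ hi in
lemma theta_eq_zero {z : ℂ} (hz : jacobiTheta₂ z τ = 0) :
    ∃ k l : ℤ, z = 1 / 2 + τ / 2 + k + l * τ := by
  obtain ⟨C, hC, h, h2⟩ := theta_product hτ hi
  have := h (z - τ / 2)
  rw [sub_add_cancel, hz] at this
  obtain ⟨⟨k, l, hkl⟩, -⟩ := h2 _ ((mul_eq_zero.1 this.symm).resolve_left (by exact_mod_cast hC.ne'))
  exact ⟨k, l, by linear_combination hkl⟩

include hτ hi in
lemma deriv_theta_ne_zero {z : ℂ} (hz : jacobiTheta₂ z τ = 0) :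
    deriv (fun z => jacobiTheta₂ z τ) z ≠ 0 := by
  obtain ⟨C, hC, h, h2⟩ := theta_product hτ hi
  have e := h (z - τ / 2)
  have hC' : (C : ℂ) ≠ 0 := by exact_mod_cast hC.ne'
  rw [sub_add_cancel, hz] at e
  obtain ⟨-, hd⟩ := h2 _ ((mul_eq_zero.1 e.symm).resolve_left hC')
  have e2 : (fun y => jacobiTheta₂ (y + τ / 2) τ) = fun y => C * ((1 + E (-y)) * thetaK τ y) :=
    funext h
  have e3 := congrArg (fun F => deriv F (z - τ / 2)) e2
  rw [deriv_const_mul_field, deriv_comp_add_const (fun z => jacobiTheta₂ z τ), sub_add_cancel] at e3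
  rw [e3]
  exact mul_ne_zero hC' hd

include hτ hi in
-- With w = e^{2πi(x+τ/2)}, the triple product at y = x - τ/2 regroups as C |1+w|² |∏(1+q^{2m}w)|².
-- Since |w| < 1, no factor vanishes.
lemma theta_pos (x : ℝ) : 0 < jacobiTheta₂ x τ := by
  obtain ⟨C, hC, h, -⟩ := theta_product hτ hi
  have e := h (x - τ / 2)
  have q0 := Real.exp_pos (-(2 * Real.pi * τ.im))
  have e1 : E (-(x - τ / 2)) = (starRingEnd ℂ) (E (x + τ / 2)) := by
    rw [conj_E]; congr 1; simp [conj_tau hτ, Complex.conj_ofNat]; ring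
  have e2 : (Real.exp (-(2 * Real.pi * τ.im)) : ℝ) * E (x - τ / 2) = E (x + τ / 2) := by
    rw [← E_tau hτ, ← E_add]; congr 1; ring
  rw [sub_add_cancel, thetaK, qProd_eq q0 (nome_lt_one hi) (E (x - τ / 2)), e2, e1, qProd_conj] at e
  have hn : ‖E (x + τ / 2)‖ < 1 := by
    rw [norm_E, Real.exp_lt_one_iff]
    simp only [Complex.add_im, Complex.ofReal_im, zero_add, neg_neg_iff_pos, Complex.div_ofNat_im]
    have := Real.pi_pos; positivity
  have n1 : 1 + E (x + τ / 2) ≠ 0 := fun h0 => by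
    rw [eq_neg_of_add_eq_zero_right h0] at hn; simp at hn
  have n2 : qProd (Real.exp (-(2 * Real.pi * τ.im))) (E (x + τ / 2)) ≠ 0 :=
    qProd_ne_zero q0 (nome_lt_one hi) (hn.trans ((one_lt_inv₀ q0).2 (nome_lt_one hi)))
  have : jacobiTheta₂ x τ = ((C * (Complex.normSq (1 + E (x + τ / 2)) * Complex.normSq (qProd
      (Real.exp (-(2 * Real.pi * τ.im))) (E (x + τ / 2)))) : ℝ) : ℂ) := by
    push_cast
    rw [← Complex.mul_conj, ← Complex.mul_conj, e]
    simp only [map_add, map_one]; ring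
  rw [this]
  have := Complex.normSq_pos.2 n1
  have := Complex.normSq_pos.2 n2
  exact_mod_cast (by positivity)

end theta

/-! ### Functions that are real or nonnegative on the real line -/

lemma eq_of_eq_ofReal {f g : ℂ → ℂ} (hf : Differentiable ℂ f) (hg : Differentiable ℂ g)
    (h : ∀ x : ℝ, f x = g x) : f = g := by
  refine AnalyticOnNhd.eq_of_frequently_eq (z₀ := 0) (fun z _ => hf.analyticAt z)
    (fun z _ => hg.analyticAt z) ?_
  have h1 : Tendsto (fun x : ℝ => (x : ℂ)) (𝓝[≠] 0) (𝓝[≠] 0) := by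
    refine tendsto_nhdsWithin_iff.2 ⟨?_, ?_⟩
    · exact (continuous_ofReal.tendsto' 0 0 ofReal_zero).mono_left nhdsWithin_le_nhds
    · filter_upwards [self_mem_nhdsWithin] with x hx
      simpa using hx
  exact h1.frequently (Eventually.frequently (.of_forall h))

lemma differentiable_conj_conj {f : ℂ → ℂ} (hf : Differentiable ℂ f) :
    Differentiable ℂ fun z => (starRingEnd ℂ) (f ((starRingEnd ℂ) z)) := by
  intro z
  have := (hf ((starRingEnd ℂ) z)).conj_conj
  rw [starRingEnd_self_apply] at this
  exact this

lemma map_conj_of_real {f : ℂ → ℂ} (hf : Differentiable ℂ f)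
    (h : ∀ x : ℝ, (starRingEnd ℂ) (f x) = f x) (z : ℂ) :
    f ((starRingEnd ℂ) z) = (starRingEnd ℂ) (f z) := by
  have := congrFun (eq_of_eq_ofReal (differentiable_conj_conj hf) hf (fun x => by simp [h]))
    ((starRingEnd ℂ) z)
  simpa using this.symm

lemma conj_eq_of_nonneg {z : ℂ} (h : 0 ≤ z) : (starRingEnd ℂ) z = z := by
  rw [Complex.le_def] at h
  exact Complex.conj_eq_iff_im.2 h.2.symm

/-- The real part has a minimum at the zero and the imaginary part vanishes identically on ℝ, so
both parts of the derivative vanish. -/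
lemma deriv_eq_zero_of_nonneg {F : ℂ → ℂ} (hF : Differentiable ℂ F) (h : ∀ x : ℝ, 0 ≤ F x)
    {x : ℝ} (hx : F x = 0) : deriv F x = 0 := by
  have h1 : HasDerivAt (fun x : ℝ => (F x).re) (deriv F x).re x :=
    (hF x).hasDerivAt.real_of_complex
  have h2 : HasDerivAt (fun x : ℝ => (-I * F x).re) (-I * deriv F x).re x :=
    ((hF x).hasDerivAt.const_mul (-I)).real_of_complex
  have h3 : IsLocalMin (fun x : ℝ => (F x).re) x :=
    Filter.Eventually.of_forall fun y => by
      simp only [hx]; exact (Complex.le_def.1 (h y)).1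
  have h4 : (fun x : ℝ => (-I * F x).re) = fun _ => 0 := by
    funext y; simp [← (Complex.le_def.1 (h y)).2]
  rw [h4] at h2
  have h5 := h2.unique (hasDerivAt_const x 0)
  apply Complex.ext
  · exact h3.hasDerivAt_eq_zero h1
  · simpa using h5

/-- The zeros of N are isolated, so N can be divided out on a punctured neighbourhood of each real
point; continuity of h gives the point itself. -/
lemma nonneg_of_mul_nonneg {N h : ℂ → ℂ} (hN : Differentiable ℂ N) (hh : Continuous h)
    (hN0 : ∃ z, N z ≠ 0) (h1 : ∀ x : ℝ, 0 ≤ N x) (h2 : ∀ x : ℝ, 0 ≤ N x * h x) (x : ℝ) :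
    0 ≤ h x := by
  have hc : IsClosed {x : ℝ | 0 ≤ h x} :=
    isClosed_le continuous_const (hh.comp continuous_ofReal)
  suffices h : ∃ᶠ y in 𝓝[≠] x, y ∈ {x : ℝ | 0 ≤ h x} from
    hc.mem_of_frequently_of_tendsto h (tendsto_id.mono_left nhdsWithin_le_nhds)
  have hs : ∀ᶠ y in 𝓝[≠] (x : ℂ), N y ≠ 0 := by
    rcases (hN.analyticAt x).eventually_eq_zero_or_eventually_ne_zero with h | h
    · obtain ⟨z, hz⟩ := hN0
      have := AnalyticOnNhd.eq_of_eventuallyEq (f := N) (g := 0) (z₀ := x)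
        (fun z _ => hN.analyticAt z) (fun z _ => analyticAt_const) h
      exact absurd (congrFun this z) hz
    · exact h
  have ht : Tendsto (fun x : ℝ => (x : ℂ)) (𝓝[≠] x) (𝓝[≠] x) := by
    refine tendsto_nhdsWithin_iff.2 ⟨?_, ?_⟩
    · exact (continuous_ofReal.tendsto x).mono_left nhdsWithin_le_nhds
    · filter_upwards [self_mem_nhdsWithin] with x hx
      simpa using hx
  refine Eventually.frequently ((ht.eventually hs).mono fun y hy => ?_)
  have hp : 0 < N y := lt_of_le_of_ne (h1 y) (Ne.symm hy)
  have : 0 ≤ (N y)⁻¹ * (N y * h y) := mul_nonneg (inv_nonneg.2 hp.le) (h2 y)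
  rwa [inv_mul_cancel_left₀ hy] at this

/-- The involution has no fixed points, so taking one index from each pair writes the product as a
product of |φ i|². -/
lemma prod_nonneg_of_pairing {n : ℕ} {φ : Fin n → ℂ} (s : Fin n → Fin n) (hs : ∀ i, s (s i) = i)
    (hne : ∀ i, s i ≠ i) (h : ∀ i, φ (s i) = (starRingEnd ℂ) (φ i)) : 0 ≤ ∏ i, φ i := by
  rw [← Finset.prod_filter_mul_prod_filter_not Finset.univ (fun i => i < s i) φ]
  have : ∏ i with ¬ i < s i, φ i = ∏ i with i < s i, φ (s i) := by
    symm
    refine Finset.prod_bij' (fun i _ => s i) (fun i _ => s i) ?_ ?_ ?_ ?_ ?_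
    · intro i; simp only [Finset.mem_filter_univ, hs]; exact fun h => h.le.not_gt
    · intro i; simp only [Finset.mem_filter_univ, hs, not_lt]
      exact fun h => lt_of_le_of_ne h (hne i)
    · simp [hs]
    · simp [hs]
    · simp
  rw [this, ← Finset.prod_mul_distrib]
  refine Finset.prod_nonneg fun i _ => ?_
  rw [h, Complex.mul_conj]
  exact_mod_cast Complex.normSq_nonneg _

/-! ### Theta functions of degree `n` -/

/-- `f` is entire with `f(x+1) = f(x)` and `f(x+τ) = e^{-πi(2nx + nτ - 2s)} f(x)`. -/
structure IsTheta (τ : ℂ) (n : ℕ) (s : ℝ) (f : ℂ → ℂ) : Prop where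
  diff : Differentiable ℂ f
  add_one : ∀ x, f (x + 1) = f x
  add_tau : ∀ x, f (x + τ) =
    Complex.exp (-(Real.pi * Complex.I * (2 * n * x + n * τ - 2 * s))) * f x

/-- The nonzero theta functions that are nonnegative on `ℝ` and, suitably normalized, on
`ℝ + τ / 2`. -/
def posTheta (τ : ℂ) (n : ℕ) (s : ℝ) : Set (ℂ → ℂ) :=
  {f | f ≠ 0 ∧ IsTheta τ n s f ∧ ∀ x : ℝ, 0 ≤ f x ∧
    0 ≤ Complex.exp (Real.pi * Complex.I * (n * x - s)) * f (x + τ / 2)}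

/-! ### Zeros and products of theta functions. -/

section theta
variable {τ : ℂ} {n : ℕ} {s : ℝ} {f : ℂ → ℂ}

/-- Without zeros, G = f'/f would be entire with G(z+1) = G(z) and G(z+τ) = G(z) - 2πin. Then G' is
doubly periodic, hence constant, and G is affine. The period 1 makes G constant, which contradicts n
≠ 0. -/
lemma IsTheta.exists_zero (hi : 0 < τ.im) (hn : n ≠ 0) (hf : IsTheta τ n s f) : ∃ z, f z = 0 := by
  by_contra! h0
  have d1 : Differentiable ℂ (deriv f) := hf.diff.deriv
  have dG : Differentiable ℂ fun z => deriv f z / f z := fun z => (d1 z).div (hf.diff z) (h0 z)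
  set G : ℂ → ℂ := fun z => deriv f z / f z with hG
  have G1 : ∀ z, G (z + 1) = G z := fun z => by
    simp only [hG, hf.add_one]
    rw [← deriv_comp_add_const, funext hf.add_one]
  have Gt : ∀ z, G (z + τ) = G z - 2 * Real.pi * I * n := fun z => by
    simp only [hG]
    have e : HasDerivAt (fun x => Complex.exp (-(Real.pi * I * (2 * n * x + n * τ - 2 * s))))
        (Complex.exp (-(Real.pi * I * (2 * n * z + n * τ - 2 * s))) * -(Real.pi * I * (2 * n))) z := by
      have := (((((hasDerivAt_id z).const_mul (2 * n : ℂ)).add_const (n * τ : ℂ)).sub_const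
        (2 * s : ℂ)).const_mul (Real.pi * I : ℂ)).fun_neg.cexp
      simpa using this
    rw [← deriv_comp_add_const, funext hf.add_tau, hf.add_tau,
      (e.fun_mul (hf.diff z).hasDerivAt).deriv]
    have := h0 z
    have := Complex.exp_ne_zero (-(Real.pi * I * (2 * n * z + n * τ - 2 * s)))
    field_simp
    ring
  have dG' : Differentiable ℂ (deriv G) := dG.deriv
  obtain ⟨c, hc⟩ := exists_eq_const_of_norm_periodic hi dG'
    (fun z => by rw [← deriv_comp_add_const, funext G1])
    (fun z => by rw [← deriv_comp_add_const, funext Gt]; simp)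
  have hconst : ∀ z, G z - c * z = G 0 - c * 0 := fun z => by
    refine is_const_of_deriv_eq_zero (f := fun z => G z - c * z) (dG.sub (by fun_prop)) (fun z => ?_) z 0
    have := ((dG z).hasDerivAt.fun_sub ((hasDerivAt_id z).const_mul c)).deriv
    simp only [id] at this
    rw [this, hc]; ring
  have c0 : c = 0 := by
    have h1 := hconst 1
    have h2 := G1 0
    rw [zero_add] at h2
    rw [h2] at h1; linear_combination -h1
  have h3 := hconst τ
  have h4 := Gt 0
  rw [zero_add] at h4
  rw [c0, h4] at h3
  have : (2 * Real.pi * I * n : ℂ) = 0 := by linear_combination -h3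
  simp [Real.pi_ne_zero, hn] at this

/-- `e^{πiy} θ(y + τ/2)` -/
def thetaHalf (τ y : ℂ) : ℂ := Complex.exp (Real.pi * I * y) * jacobiTheta₂ (y + τ / 2) τ

/-- Conjugation sends the line ℝ+τ/2 to ℝ-τ/2, and the prefactor e^{πiy} absorbs the multiplier of θ
that leads back. This symmetry makes the normalized values real on ℝ. -/
lemma thetaHalf_conj (hτ : τ.re = 0) (y : ℂ) :
    thetaHalf τ ((starRingEnd ℂ) y) = (starRingEnd ℂ) (thetaHalf τ y) := by
  rw [thetaHalf, thetaHalf, map_mul, ← theta_conj hτ, ← Complex.exp_conj]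
  have : (starRingEnd ℂ) y + τ / 2 = (starRingEnd ℂ) (y + τ / 2) + τ := by
    simp [conj_tau hτ, Complex.conj_ofNat]; ring
  rw [this, theta_add_tau, ← mul_assoc, ← Complex.exp_add]
  congr 2
  simp [conj_tau hτ, Complex.conj_ofNat]; ring

/-- Distributing the normalizing factor over the n theta factors leaves the constant e^{πi(∑a - s)}.
It equals 1 precisely when ∑a - s is an even integer, the origin of the condition modulo 2ℤ. -/
lemma exp_mul_prod_theta {n : ℕ} (a : Fin n → ℂ) (s : ℂ) (y : ℂ) :
    Complex.exp (Real.pi * I * (n * y - s)) * ∏ i, jacobiTheta₂ (y + τ / 2 - a i) τ =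
    Complex.exp (Real.pi * I * (∑ i, a i - s)) * ∏ i, thetaHalf τ (y - a i) := by
  simp only [thetaHalf, Finset.prod_mul_distrib, ← Complex.exp_sum]
  rw [← mul_assoc, ← Complex.exp_add]
  congr 2
  · rw [← Finset.mul_sum, Finset.sum_sub_distrib]; simp; ring
  · funext i; congr 1; ring

/-- The quasi-periods see ∑a - s only modulo ℤ; its parity matters only for the sign on ℝ+τ/2. -/
lemma isTheta_prod (hi : 0 < τ.im) {n : ℕ} (a : Fin n → ℂ) {s : ℝ}
    (h : ∃ k : ℤ, ∑ i, a i - s = k) (r : ℂ) :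
    IsTheta τ n s fun z => r * thetaProd τ a z := by
  have dT := differentiable_theta (τ := τ) hi
  refine ⟨?_, fun x => ?_, fun x => ?_⟩
  · unfold thetaProd
    refine (differentiable_const r).mul (Differentiable.fun_finsetProd fun i _ => ?_)
    exact dT.comp (by fun_prop : Differentiable ℂ fun z => z - a i)
  · simp only [thetaProd]
    congr 2; funext i
    rw [← jacobiTheta₂_add_left (x - a i)]; congr 1; ring
  · simp only [thetaProd]
    have e : ∀ i, jacobiTheta₂ (x + τ - a i) τ = Complex.exp (-(Real.pi * I * (2 * (x - a i) + τ)))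
        * jacobiTheta₂ (x - a i) τ := fun i => by
      rw [← theta_add_tau]; congr 1; ring
    simp only [e, Finset.prod_mul_distrib, ← Complex.exp_sum]
    rw [mul_left_comm]
    congr 1
    obtain ⟨k, hk⟩ := h
    refine Complex.exp_eq_exp_iff_exists_int.2 ⟨k, ?_⟩
    rw [Finset.sum_neg_distrib, ← Finset.mul_sum, Finset.sum_add_distrib, ← Finset.mul_sum,
      Finset.sum_sub_distrib]
    simp only [Finset.sum_const, Finset.card_univ, Fintype.card_fin, nsmul_eq_mul]
    linear_combination (2 * Real.pi * I) * hk

lemma exp_int_even (k : ℤ) : Complex.exp (Real.pi * I * (2 * k)) = 1 := by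
  rw [show (Real.pi * I * (2 * k) : ℂ) = k * (2 * Real.pi * I) by ring]
  exact Complex.exp_int_mul_two_pi_mul_I k

lemma exists_theta_prod_ne_zero (hτ : τ.re = 0) (hi : 0 < τ.im) {n : ℕ} (a : Fin n → ℂ) :
    thetaProd τ a ≠ 0 := by
  intro h
  have hd : ∀ i, ∀ᶠ z in 𝓝[≠] (0 : ℂ), jacobiTheta₂ (z - a i) τ ≠ 0 := fun i => by
    have dT : Differentiable ℂ fun z => jacobiTheta₂ (z - a i) τ :=
      (differentiable_theta (τ := τ) hi).comp (by fun_prop : Differentiable ℂ fun z => z - a i)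
    rcases (dT.analyticAt 0).eventually_eq_zero_or_eventually_ne_zero with h | h
    · have := AnalyticOnNhd.eq_of_eventuallyEq (g := 0) (z₀ := 0)
        (fun z _ => dT.analyticAt z) (fun z _ => analyticAt_const) h
      have h2 := congrFun this (a i)
      simp only [sub_self] at h2
      have h3 := theta_pos hτ hi 0
      rw [ofReal_zero] at h3
      exact absurd h2 h3.ne'
    · exact h
  obtain ⟨z, hz⟩ := (eventually_all.2 hd).exists
  exact Finset.prod_ne_zero_iff.2 (fun i _ => hz i) (congrFun h z)

theorem theta_prod_mem_posTheta (hτ : τ.re = 0) (hi : 0 < τ.im) {n : ℕ} (a : Fin n → ℂ) {s : ℝ}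
    (p : Fin n → Fin n) (hp : ∀ i, p (p i) = i ∧ p i ≠ i ∧ a (p i) = (starRingEnd ℂ) (a i))
    (h : ∃ k : ℤ, ∑ i, a i - s = 2 * k) {r : ℝ} (hr : 0 < r) :
    (fun z => r * thetaProd τ a z) ∈ posTheta τ n s := by
  have hr' : (0 : ℂ) < r := by exact_mod_cast hr
  refine ⟨fun h0 => ?_, isTheta_prod hi a ?_ r, fun x => ⟨mul_nonneg hr'.le ?_, ?_⟩⟩
  · refine exists_theta_prod_ne_zero hτ hi a (funext fun z => ?_)
    simpa [hr.ne'] using congrFun h0 z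
  · obtain ⟨k, hk⟩ := h
    exact ⟨2 * k, by rw [hk]; push_cast; ring⟩
  · refine prod_nonneg_of_pairing p (fun i => (hp i).1) (fun i => (hp i).2.1) fun i => ?_
    rw [(hp i).2.2, ← theta_conj hτ, map_sub, Complex.conj_ofReal]
  · obtain ⟨k, hk⟩ := h
    rw [mul_left_comm, thetaProd, exp_mul_prod_theta, hk, exp_int_even, one_mul]
    refine mul_nonneg hr'.le (prod_nonneg_of_pairing p (fun i => (hp i).1) (fun i => (hp i).2.1)
      fun i => ?_)
    rw [(hp i).2.2, ← thetaHalf_conj hτ, map_sub, Complex.conj_ofReal]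

end theta

/-! ### Factorization of nonnegative theta functions into conjugate pairs. -/

section theta
variable {τ : ℂ} {n : ℕ} {s : ℝ} {f : ℂ → ℂ}

@[fun_prop] lemma differentiable_thetaHalf (hi : 0 < τ.im) : Differentiable ℂ (thetaHalf τ) := by
  have : Differentiable ℂ fun y => jacobiTheta₂ (y + τ / 2) τ :=
    (differentiable_theta hi).comp (by fun_prop : Differentiable ℂ fun y => y + τ / 2)
  unfold thetaHalf; fun_prop

/-- A nonnegative theta function is divisible by `θ(z - a) θ(z - ā)` for some `a`. -/
lemma exists_pair_factor (hτ : τ.re = 0) (hi : 0 < τ.im) (hn : n ≠ 0) (hf : f ∈ posTheta τ n s) :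
    ∃ (a : ℂ) (h : ℂ → ℂ), Differentiable ℂ h ∧
      ∀ z, f z = jacobiTheta₂ (z - a) τ * jacobiTheta₂ (z - (starRingEnd ℂ) a) τ * h z := by
  obtain ⟨-, hq, hpos⟩ := hf
  have dT := differentiable_theta (τ := τ) hi
  have dTs : ∀ a : ℂ, Differentiable ℂ fun z => jacobiTheta₂ (z - a) τ := fun a =>
    dT.comp (by fun_prop : Differentiable ℂ fun z => z - a)
  have hdT : ∀ a z : ℂ, jacobiTheta₂ (z - a) τ = 0 →
      deriv (fun z => jacobiTheta₂ (z - a) τ) z ≠ 0 := fun a z hz => by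
    rw [deriv_comp_sub_const (fun z => jacobiTheta₂ z τ)]
    exact deriv_theta_ne_zero hτ hi hz
  have hm0 : ∀ x, Complex.exp (-(Real.pi * I * (2 * n * x + n * τ - 2 * s))) ≠ 0 :=
    fun x => Complex.exp_ne_zero _
  have hzero : ∀ {F : ℂ → ℂ} {m : ℂ → ℂ} (_ : ∀ z, m z ≠ 0) (_ : ∀ z, F (z + 1) = F z)
      (_ : ∀ z, F (z + τ) = m z * F z) (k l : ℤ) (z : ℂ), F (z + k + l * τ) = 0 ↔ F z = 0 := by
    intro F m hm h1 h2 k l z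
    rw [iff_add_int (p := fun y => F y = 0) (zero_add_iff hm h2)]
    simpa using iff_add_int (p := fun y => F y = 0) (w := 1) (fun y => by rw [h1]) k z
  obtain ⟨z0, hz0⟩ := hq.exists_zero hi hn
  obtain ⟨l, hl1, hl2⟩ := exists_int_im_mem hi (-(τ.im / 2)) z0
  set z1 := z0 + l * τ with hz1
  have h1 : f z1 = 0 := (iff_add_int (p := fun y => f y = 0) (zero_add_iff hm0 hq.add_tau) l z0).2 hz0
  -- The zero of θ lies at 1/2 + τ/2, so this shift makes θ(z-a) vanish exactly on z1 + ℤ + ℤτ.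
  set a := z1 - 1 / 2 - τ / 2 with ha
  have hza : jacobiTheta₂ (z1 - a) τ = 0 := by
    rw [ha]; convert theta_half_period (τ := τ) using 2; ring
  obtain ⟨g, dg, hg⟩ := exists_differentiable_mul_eq hq.diff (dTs a) (fun z hz => by
    obtain ⟨k, l, h⟩ := theta_eq_zero hτ hi hz
    have : z = z1 + k + l * τ := by rw [ha] at h; linear_combination h
    rw [this, hzero hm0 hq.add_one hq.add_tau]
    exact h1) (hdT a)
  have hT0 : ∃ z, jacobiTheta₂ (z - a) τ ≠ 0 := ⟨a, by
    have := theta_pos hτ hi 0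
    rw [sub_self]; rw [ofReal_zero] at this; exact this.ne'⟩
  have g1 : ∀ z, g (z + 1) = g z := eq_of_mul_eq_mul (dTs a) (A := fun z => g (z + 1))
    (dg.comp (differentiable_id.add_const 1)) dg hT0 (fun z => by
      have := hg (z + 1)
      rw [hq.add_one, hg z, show z + 1 - a = z - a + 1 by ring, jacobiTheta₂_add_left] at this
      exact this.symm)
  have g2 : ∀ z, g (z + τ) = Complex.exp (-(Real.pi * I * (2 * n * z + n * τ - 2 * s))
      + Real.pi * I * (2 * (z - a) + τ)) * g z :=
    eq_of_mul_eq_mul (dTs a) (A := fun z => g (z + τ)) (B := fun z => _ * g z)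
    (dg.comp (differentiable_id.add_const τ)) (by fun_prop) hT0 (fun z => by
      have := hg (z + τ)
      rw [hq.add_tau, hg z, show z + τ - a = z - a + τ by ring, theta_add_tau] at this
      rw [Complex.exp_add]
      have e : Complex.exp (-(Real.pi * I * (2 * (z - a) + τ)))
        * Complex.exp (Real.pi * I * (2 * (z - a) + τ)) = 1 := by
        rw [← Complex.exp_add, neg_add_cancel, Complex.exp_zero]
      linear_combination -(Complex.exp (Real.pi * I * (2 * (z - a) + τ))) * this
        - (jacobiTheta₂ (z - a) τ * g (z + τ)) * e)
  have hreal : ∀ z, f ((starRingEnd ℂ) z) = (starRingEnd ℂ) (f z) :=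
    map_conj_of_real hq.diff fun x => conj_eq_of_nonneg (hpos x).1
  have hdouble : deriv f z1 = 0 → g z1 = 0 := fun hd => by
    rw [funext hg, ((dTs a z1).hasDerivAt.fun_mul (dg z1).hasDerivAt).deriv, hza] at hd
    have : g z1 = 0 := by simpa [hdT a z1 hza] using hd
    exact this
  -- After one factor at z1 is removed, the conjugate of z1 must still be a zero. This is immediate
  -- when the two are inequivalent modulo the lattice; otherwise f has to vanish doubly at z1, by
  -- nonnegativity.
  have hgc : g ((starRingEnd ℂ) z1) = 0 := by
    have hfc : f ((starRingEnd ℂ) z1) = 0 := by rw [hreal, h1, map_zero]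
    by_cases hc : jacobiTheta₂ ((starRingEnd ℂ) z1 - a) τ = 0
    · obtain ⟨k, j, hkj⟩ := theta_eq_zero hτ hi hc
      have e : (starRingEnd ℂ) z1 = z1 + k + j * τ := by rw [ha] at hkj; linear_combination hkj
      have e1 := congrArg Complex.re e
      have e2 := congrArg Complex.im e
      simp only [conj_re, conj_im, add_re, add_im, intCast_re, intCast_im, mul_re, mul_im, hτ,
        mul_zero, zero_mul, sub_zero, add_zero] at e1 e2
      have hk : k = 0 := by exact_mod_cast (by linarith : (k : ℝ) = 0)
      subst hk
      -- Here -2 Im z1 = j Im τ with -Im τ/2 < Im z1 ≤ Im τ/2. Thus z1 is real (j = 0) or lies on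
      -- ℝ+τ/2 (j = -1), the two lines on which f is controlled.
      have hj : -1 ≤ j ∧ j ≤ 0 := by
        constructor
        · by_contra! h
          have : (j : ℝ) ≤ -2 := by exact_mod_cast (by omega)
          nlinarith
        · by_contra! h
          have : (1 : ℝ) ≤ j := by exact_mod_cast (by omega)
          nlinarith
      have hj' : j = 0 ∨ j = -1 := by omega
      rcases hj' with rfl | rfl
      · have ee : (starRingEnd ℂ) z1 = z1 := by rw [e]; simp
        rw [ee]
        refine hdouble ?_
        obtain ⟨x, hx⟩ := Complex.conj_eq_iff_real.1 ee
        rw [hx] at h1 ⊢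
        exact deriv_eq_zero_of_nonneg hq.diff (fun x => (hpos x).1) h1
      · have him : z1.im = τ.im / 2 := by push_cast at e2; linarith
        have hz : z1 = (z1.re : ℂ) + τ / 2 := by
          apply Complex.ext
          · simp [hτ]
          · simp [him]
        have ee : (starRingEnd ℂ) z1 + τ = z1 := by rw [e]; push_cast; ring
        have : g z1 = 0 := by
          refine hdouble ?_
          have dF : Differentiable ℂ fun y => Complex.exp (Real.pi * I * (n * y - s)) * f (y + τ / 2) := by
            have := hq.diff.comp (by fun_prop : Differentiable ℂ fun y => y + τ / 2)
            exact Differentiable.fun_mul (by fun_prop) this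
          have hF := deriv_eq_zero_of_nonneg dF (fun x => (hpos x).2) (x := z1.re)
            (by rw [← hz, h1, mul_zero])
          have d2 : HasDerivAt (fun y => f (y + τ / 2)) (deriv f z1) (z1.re : ℂ) := by
            have := (hq.diff (z1.re + τ / 2)).hasDerivAt.comp_add_const (z1.re : ℂ) (τ / 2)
            rwa [← hz] at this
          have d1 : DifferentiableAt ℂ (fun y => Complex.exp (Real.pi * I * (n * y - s)))
            (z1.re : ℂ) := by fun_prop
          rw [(d1.hasDerivAt.fun_mul d2).deriv, ← hz, h1] at hF
          simpa using hF
        rw [← ee, g2] at this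
        exact (mul_eq_zero.1 this).resolve_left (Complex.exp_ne_zero _)
    · rw [hg] at hfc
      exact (mul_eq_zero.1 hfc).resolve_left hc
  obtain ⟨h, dh, hh⟩ := exists_differentiable_mul_eq dg (dTs ((starRingEnd ℂ) a)) (fun z hz => by
    obtain ⟨k, l, h⟩ := theta_eq_zero hτ hi hz
    -- Conjugation turns the -τ/2 in a into +τ/2, so the zeros of θ(z-ā) are displaced from the
    -- conjugate of z1 by one additional τ.
    have : z = (starRingEnd ℂ) z1 + k + (l + 1 : ℤ) * τ := by
      rw [ha] at h
      simp only [map_sub, map_div₀, map_one, conj_tau hτ, Complex.conj_ofNat] at h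
      push_cast
      linear_combination h
    rw [this, hzero (fun z => Complex.exp_ne_zero _) g1 g2]
    exact hgc) (hdT _)
  exact ⟨a, h, dh, fun z => by rw [hg, hh, mul_assoc]⟩

/-- The quotient in `exists_pair_factor` is a nonnegative theta function. -/
lemma quotient_mem_posTheta (hτ : τ.re = 0) (hi : 0 < τ.im) (hf : f ∈ posTheta τ (n + 2) s)
    {a : ℂ} {h : ℂ → ℂ} (dh : Differentiable ℂ h)
    (hh : ∀ z, f z = jacobiTheta₂ (z - a) τ * jacobiTheta₂ (z - (starRingEnd ℂ) a) τ * h z) :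
    h ∈ posTheta τ n (s - 2 * a.re) := by
  obtain ⟨hf0, hq, hpos⟩ := hf
  have dT := differentiable_theta (τ := τ) hi
  set N : ℂ → ℂ := fun z => jacobiTheta₂ (z - a) τ * jacobiTheta₂ (z - (starRingEnd ℂ) a) τ with hN
  have dTs : ∀ a : ℂ, Differentiable ℂ fun z => jacobiTheta₂ (z - a) τ := fun a =>
    dT.comp (by fun_prop : Differentiable ℂ fun z => z - a)
  have dN : Differentiable ℂ N := (dTs a).mul (dTs _)
  have N0 : ∃ z, N z ≠ 0 := by
    by_contra! h0
    exact hf0 (funext fun z => by rw [hh]; simp only [hN] at h0; rw [h0]; simp)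
  have hac : a + (starRingEnd ℂ) a = 2 * a.re := by
    rw [Complex.add_conj]; push_cast; ring
  have N1 : ∀ z, N (z + 1) = N z := fun z => by
    simp only [hN]
    rw [show z + 1 - a = z - a + 1 by ring, jacobiTheta₂_add_left,
      show z + 1 - (starRingEnd ℂ) a = z - (starRingEnd ℂ) a + 1 by ring, jacobiTheta₂_add_left]
  have Nt : ∀ z, N (z + τ) = Complex.exp (-(Real.pi * I * (4 * z + 2 * τ - 4 * a.re))) * N z := by
    intro z
    simp only [hN]
    rw [show z + τ - a = z - a + τ by ring, theta_add_tau,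
      show z + τ - (starRingEnd ℂ) a = z - (starRingEnd ℂ) a + τ by ring, theta_add_tau,
      mul_mul_mul_comm, ← Complex.exp_add]
    congr 2
    linear_combination 2 * Real.pi * I * hac
  refine ⟨fun h0 => hf0 (funext fun z => by rw [hh, h0]; simp), ⟨dh, ?_, ?_⟩, fun x => ⟨?_, ?_⟩⟩
  · exact eq_of_mul_eq_mul dN (A := fun z => h (z + 1))
      (dh.comp (differentiable_id.add_const 1)) dh N0 (fun z => by
      have h3 := hh (z + 1)
      rw [hq.add_one, hh z] at h3
      have e1 := N1 z
      simp only [hN] at e1 ⊢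
      rw [e1] at h3
      exact h3.symm)
  · refine eq_of_mul_eq_mul dN (A := fun z => h (z + τ)) (B := fun z => _ * h z)
      (dh.comp (differentiable_id.add_const τ)) (by fun_prop) N0 (fun z => ?_)
    have h3 := hh (z + τ)
    rw [hq.add_tau, hh z] at h3
    have e1 := Nt z
    simp only [hN] at e1 ⊢
    rw [e1] at h3
    have e : Complex.exp (-(Real.pi * I * (2 * (n + 2 : ℕ) * z + (n + 2 : ℕ) * τ - 2 * s)))
      = Complex.exp (-(Real.pi * I * (4 * z + 2 * τ - 4 * a.re)))
      * Complex.exp (-(Real.pi * I * (2 * n * z + n * τ - 2 * (s - 2 * a.re : ℝ)))) := by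
      rw [← Complex.exp_add]; congr 1; push_cast; ring
    rw [e] at h3
    refine mul_left_cancel₀ (Complex.exp_ne_zero (-(Real.pi * I * (4 * z + 2 * τ - 4 * a.re)))) ?_
    linear_combination -h3
  · refine nonneg_of_mul_nonneg dN dh.continuous N0 (fun x => ?_) (fun x => ?_) x
    · simp only [hN]
      rw [← Complex.conj_ofReal x, ← map_sub, theta_conj hτ, Complex.conj_ofReal, Complex.mul_conj]
      exact_mod_cast Complex.normSq_nonneg _
    · rw [← hh x]; exact (hpos x).1
  · have dH := differentiable_thetaHalf (τ := τ) hi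
    -- On ℝ+τ/2 the normalizing factor of degree n+2 splits into those of the two theta factors and
    -- that of degree n. The two theta factors multiply to a square modulus on ℝ.
    have key := nonneg_of_mul_nonneg (N := fun y => thetaHalf τ (y - a) * thetaHalf τ (y - (starRingEnd ℂ) a))
      (h := fun y => Complex.exp (Real.pi * I * (n * y - (s - 2 * a.re : ℝ))) * h (y + τ / 2))
      ?_ ?_ ?_ (fun x => ?_) (fun x => ?_) x
    · exact key
    · exact (dH.comp (by fun_prop : Differentiable ℂ fun y => y - a)).mul
        (dH.comp (by fun_prop : Differentiable ℂ fun y => y - (starRingEnd ℂ) a))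
    · exact Continuous.mul (by fun_prop) (dh.continuous.comp (by fun_prop))
    · obtain ⟨z, hz⟩ := N0
      refine ⟨z - τ / 2, ?_⟩
      simp only [thetaHalf, show ∀ b, z - τ / 2 - b + τ / 2 = z - b by intro b; ring]
      simp only [hN, mul_ne_zero_iff] at hz
      simp [hz, Complex.exp_ne_zero]
    · rw [← Complex.conj_ofReal x, ← map_sub, thetaHalf_conj hτ, Complex.conj_ofReal,
        Complex.mul_conj]
      exact_mod_cast Complex.normSq_nonneg _
    · convert (hpos x).2 using 1
      simp only [thetaHalf]
      rw [hh, show (x : ℂ) - a + τ / 2 = x + τ / 2 - a by ring,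
        show (x : ℂ) - (starRingEnd ℂ) a + τ / 2 = x + τ / 2 - (starRingEnd ℂ) a by ring]
      have e : Complex.exp (Real.pi * I * ((n + 2 : ℕ) * x - s))
        = Complex.exp (Real.pi * I * (x - a)) * Complex.exp (Real.pi * I * (x - (starRingEnd ℂ) a))
        * Complex.exp (Real.pi * I * (n * x - (s - 2 * a.re : ℝ))) := by
        rw [← Complex.exp_add, ← Complex.exp_add]; congr 1; push_cast
        linear_combination Real.pi * I * hac
      rw [e]; ring

/-- Induction on the number of pairs: one pair is removed at a time, each lowering the degree by 2
and the characteristic by 2 Re a. In degree zero only a positive constant is left. -/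
theorem exists_theta_factorization (hτ : τ.re = 0) (hi : 0 < τ.im) (k : ℕ) :
    ∀ (s : ℝ) (f : ℂ → ℂ), f ∈ posTheta τ (2 * k) s → ∃ (r : ℝ) (a : Fin k → ℂ), 0 < r ∧
      (∃ l : ℤ, ∑ i, 2 * (a i).re - s = 2 * l) ∧
      ∀ z, f z = r * ∏ i, (jacobiTheta₂ (z - a i) τ * jacobiTheta₂ (z - (starRingEnd ℂ) (a i)) τ) := by
  induction k with
  | zero =>
    rintro s f ⟨hf0, hq, hpos⟩
    obtain ⟨c, hc⟩ := exists_eq_const_of_norm_periodic hi hq.diff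
      (fun z => by rw [hq.add_one]) (fun z => by
        rw [hq.add_tau, norm_mul, Complex.norm_exp]
        simp)
    have hc0 : c ≠ 0 := fun h => hf0 (funext fun z => by simp [hc, h])
    have h0 := hpos 0
    simp only [hc] at h0
    have hcp : 0 < c := lt_of_le_of_ne h0.1 hc0.symm
    have hcr : ((c.re : ℝ) : ℂ) = c := Complex.conj_eq_iff_re.1 (conj_eq_of_nonneg h0.1)
    -- For a constant, the condition on ℝ+τ/2 says that the unimodular number e^{-πis} is
    -- nonnegative. Hence it is 1 and s is an even integer.
    have he : 0 ≤ Complex.exp (-(Real.pi * I * s)) := by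
      have h1 : 0 ≤ Complex.exp (Real.pi * I * (((2 * 0 : ℕ) : ℂ) * (0 : ℝ) - s)) * c * c⁻¹ :=
        mul_nonneg h0.2 (inv_nonneg.2 h0.1)
      rw [mul_inv_cancel_right₀ hc0] at h1
      convert h1 using 2; push_cast; ring
    have he1 : Complex.exp (-(Real.pi * I * s)) = 1 := by
      have : ‖Complex.exp (-(Real.pi * I * s))‖ = 1 := by rw [Complex.norm_exp]; simp
      have h2 := Complex.eq_coe_norm_of_nonneg he
      rw [h2, this]; simp
    obtain ⟨m, hm⟩ := Complex.exp_eq_one_iff.1 he1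
    refine ⟨c.re, Fin.elim0, (Complex.lt_def.1 hcp).1, ⟨m, ?_⟩, fun z => by simp [hc, hcr]⟩
    have hpi : (Real.pi * I : ℂ) ≠ 0 := by simp [Real.pi_ne_zero]
    have : (-s : ℂ) = 2 * m := mul_left_cancel₀ hpi (by linear_combination hm)
    rw [Fin.sum_univ_zero, zero_sub]
    exact_mod_cast this
  | succ k ih =>
    intro s f hf
    obtain ⟨b, h, dh, hh⟩ := exists_pair_factor hτ hi (by omega) hf
    obtain ⟨r, a, hr, ⟨l, hl⟩, hprod⟩ := ih _ h (quotient_mem_posTheta hτ hi hf dh hh)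
    refine ⟨r, Fin.cons b a, hr, ⟨l, ?_⟩, fun z => ?_⟩
    · rw [Fin.sum_univ_succ]; simp only [Fin.cons_zero, Fin.cons_succ]; linarith
    · rw [Fin.prod_univ_succ]; simp only [Fin.cons_zero, Fin.cons_succ]
      rw [hh, hprod]; ring

end theta

/-! ### Explicit independent theta functions and real structure. -/

section theta
variable {τ : ℂ} {n : ℕ} {s : ℝ} {f : ℂ → ℂ}

lemma IsTheta.add {f g : ℂ → ℂ} (hf : IsTheta τ n s f) (hg : IsTheta τ n s g) :
    IsTheta τ n s (f + g) :=
  ⟨hf.diff.add hg.diff, fun x => by simp [hf.add_one, hg.add_one],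
    fun x => by simp [hf.add_tau, hg.add_tau, mul_add]⟩

lemma IsTheta.smul {f : ℂ → ℂ} (c : ℂ) (hf : IsTheta τ n s f) : IsTheta τ n s (c • f) :=
  ⟨hf.diff.const_smul c, fun x => by simp [hf.add_one],
    fun x => by simp only [Pi.smul_apply, hf.add_tau, smul_eq_mul]; ring⟩

lemma IsTheta.conj (hτ : τ.re = 0) (hf : IsTheta τ n s f) :
    IsTheta τ n s fun z => (starRingEnd ℂ) (f ((starRingEnd ℂ) z)) := by
  refine ⟨differentiable_conj_conj hf.diff, fun x => by simp [hf.add_one], fun x => ?_⟩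
  have h := hf.add_tau ((starRingEnd ℂ) x - τ)
  rw [sub_add_cancel] at h
  rw [map_add, conj_tau hτ, ← sub_eq_add_neg, h, map_mul, ← mul_assoc, ← Complex.exp_conj,
    ← Complex.exp_add]
  have : ∀ u v : ℂ, u = 0 → v = Complex.exp u * v := by rintro _ v rfl; simp
  refine this _ _ ?_
  simp [conj_tau hτ, Complex.conj_ofNat]; ring

/-- Explicit theta functions of degree `n`. -/
def thetaBasis (τ : ℂ) (n : ℕ) (s : ℝ) (j : Fin n) (z : ℂ) : ℂ :=
  E (j * z) * jacobiTheta₂ (n * z + j * τ - s) (n * τ)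

lemma isTheta_thetaBasis (hi : 0 < τ.im) (j : Fin n) : IsTheta τ n s (thetaBasis τ n s j) := by
  have hn : 0 < n := j.pos
  have hni : 0 < (n * τ).im := by simp [hi, hn]
  refine ⟨?_, fun x => ?_, fun x => ?_⟩
  · have : Differentiable ℂ fun z : ℂ => jacobiTheta₂ (n * z + j * τ - s) (n * τ) :=
      (differentiable_theta hni).comp (by fun_prop : Differentiable ℂ fun z : ℂ => n * z + j * τ - s)
    unfold thetaBasis
    fun_prop
  · have e := iff_add_int (p := fun y => ∀ c, jacobiTheta₂ y (n * τ) = c ↔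
      jacobiTheta₂ (n * x + j * τ - s) (n * τ) = c) (w := 1)
      (fun z => by simp only [jacobiTheta₂_add_left]) n (n * x + j * τ - s)
    have e2 := ((e.2 fun c => Iff.rfl) _).2 rfl
    rw [thetaBasis, thetaBasis, ← e2, mul_add, mul_one, E_add, ← Int.cast_natCast (j : ℕ), E_int,
      mul_one]
    congr 2; push_cast; ring
  · rw [thetaBasis, thetaBasis, show n * (x + τ) + j * τ - s = n * x + j * τ - s + n * τ by ring,
      theta_add_tau, ← mul_assoc, ← mul_assoc, E, E, ← Complex.exp_add, ← Complex.exp_add]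
    congr 2; ring

lemma thetaBasis_ne_zero (hτ : τ.re = 0) (hi : 0 < τ.im) (j : Fin n) :
    thetaBasis τ n s j ≠ 0 := by
  have hn : 0 < n := j.pos
  have hn' : (n : ℂ) ≠ 0 := by exact_mod_cast hn.ne'
  have hni : 0 < (n * τ).im := by simp [hi, hn]
  intro h
  have h1 := congrFun h ((s - j * τ) / n)
  rw [thetaBasis, mul_div_cancel₀ _ hn', show s - j * τ + j * τ - s = ((0 : ℝ) : ℂ) by simp] at h1
  have := theta_pos (τ := n * τ) (by simp [hτ]) hni 0
  exact this.ne' (by simpa using h1)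

/-- They are eigenvectors of the translation z ↦ z + 1/n with the distinct eigenvalues e^{2πij/n}.
-/
lemma linearIndependent_thetaBasis (hτ : τ.re = 0) (hi : 0 < τ.im) :
    LinearIndependent ℂ (thetaBasis τ n s) := by
  rcases Nat.eq_zero_or_pos n with rfl | hn
  · exact linearIndependent_empty_type
  have hn' : (n : ℂ) ≠ 0 := by exact_mod_cast hn.ne'
  let S : Module.End ℂ (ℂ → ℂ) := LinearMap.funLeft ℂ ℂ fun z => z + 1 / n
  refine Module.End.eigenvectors_linearIndependent' S (fun j : Fin n => E (j / n)) (fun i j h => ?_) _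
    fun j => ⟨?_, thetaBasis_ne_zero hτ hi j⟩
  · obtain ⟨k, hk⟩ := E_eq_iff.1 h
    have h1 : (i : ℂ) = j + k * n := by field_simp at hk; linear_combination hk
    have h2 : (i : ℤ) = j + k * n := by exact_mod_cast h1
    have h3 : ((i : ℤ) - j) = k * n := by omega
    have := i.2
    have := j.2
    have h4 : (i : ℤ) - j = 0 := Int.eq_zero_of_abs_lt_dvd (Dvd.intro_left k h3.symm)
      (by rw [abs_lt]; omega)
    exact Fin.ext (by omega)
  · rw [Module.End.mem_eigenspace_iff]
    funext z
    simp only [S, LinearMap.funLeft_apply, Pi.smul_apply, smul_eq_mul, thetaBasis]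
    rw [mul_add, show n * (z + 1 / n) + j * τ - s = n * z + j * τ - s + 1 by field_simp; ring,
      jacobiTheta₂_add_left, E_add, mul_one_div]
    ring

/-! ### The real span of the cone -/

/-- Translates between k chosen zeros with their conjugates, as the factorization supplies them, and
a family of 2k zeros with a fixed-point-free involution, as in the theorem. -/
lemma exists_pairing {k : ℕ} (b : Fin k → ℂ) : ∃ (a : Fin (2 * k) → ℂ)
    (p : Equiv.Perm (Fin (2 * k))), (∀ i, p (p i) = i ∧ p i ≠ i ∧ a (p i) = (starRingEnd ℂ) (a i)) ∧
    (∑ i, a i = ∑ j, 2 * (b j).re) ∧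
    ∀ F : ℂ → ℂ, ∏ i, F (a i) = ∏ j, (F (b j) * F ((starRingEnd ℂ) (b j))) := by
  let e : Fin 2 × Fin k ≃ Fin (2 * k) := finProdFinEquiv
  let φ : Fin 2 × Fin k → ℂ := fun i => if i.1 = 0 then b i.2 else (starRingEnd ℂ) (b i.2)
  let σ : Equiv.Perm (Fin 2 × Fin k) := Equiv.prodCongr (Equiv.swap 0 1) (Equiv.refl _)
  refine ⟨fun i => φ (e.symm i), e.symm.trans (σ.trans e), fun i => ?_, ?_, fun F => ?_⟩
  · obtain ⟨⟨b', j⟩, rfl⟩ := e.surjective i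
    refine ⟨?_, ?_, ?_⟩
    · simp [σ]
    · simp only [Equiv.trans_apply, Equiv.symm_apply_apply, ne_eq, EmbeddingLike.apply_eq_iff_eq]
      fin_cases b' <;> simp [σ]
    · fin_cases b' <;> simp [φ, σ]
  · rw [e.symm.sum_comp φ, Fintype.sum_prod_type_right]
    refine (Finset.sum_congr rfl fun j _ => ?_).trans (by push_cast; rfl)
    rw [Fin.sum_univ_two]
    simp only [φ]
    simp [Complex.add_conj]
  · rw [e.symm.prod_comp (fun i => F (φ i)), Fintype.prod_prod_type_right]
    refine Finset.prod_congr rfl fun j _ => ?_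
    rw [Fin.prod_univ_two]
    simp [φ]

/-- All parameters are taken to be s/(2k) ± τ/4. They add up to s, and the zeros lie at heights (l +
1/4) Im τ and (l + 3/4) Im τ, away from the lines ℝ and ℝ+τ/2. -/
lemma exists_strictly_pos (hτ : τ.re = 0) (hi : 0 < τ.im) {k : ℕ} (hk : k ≠ 0) (s : ℝ) :
    ∃ f ∈ posTheta τ (2 * k) s, ∀ x : ℝ, f x ≠ 0 ∧ f (x + τ / 2) ≠ 0 := by
  obtain ⟨a, p, hp, hsum, hprod⟩ := exists_pairing
    (fun _ : Fin k => ((s / (2 * k) : ℝ) : ℂ) + τ / 4)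
  have hk' : (k : ℂ) ≠ 0 := by exact_mod_cast hk
  have hs : ∑ i, a i - s = 2 * (0 : ℤ) := by
    have e : ∀ x : ℝ, (((x : ℂ) + τ / 4).re) = x := fun x => by
      rw [add_re, ofReal_re, Complex.div_ofNat_re, hτ]; simp
    rw [hsum]
    simp only [e, Finset.sum_const, Finset.card_univ, Fintype.card_fin, nsmul_eq_mul]
    push_cast; field_simp; simp
  refine ⟨_, theta_prod_mem_posTheta hτ hi a p hp ⟨0, hs⟩ one_pos, fun x => ?_⟩
  have hne : ∀ z : ℂ, (∀ l : ℤ, (z.im ≠ (l + 3 / 4) * τ.im ∧ z.im ≠ (l + 1 / 4) * τ.im)) →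
      ((1 : ℝ) : ℂ) * thetaProd τ a z ≠ 0 := fun z hz => by
    rw [ofReal_one, one_mul, thetaProd, hprod (fun b => jacobiTheta₂ (z - b) τ)]
    refine Finset.prod_ne_zero_iff.2 fun i _ => mul_ne_zero (fun h0 => ?_) (fun h0 => ?_)
    · obtain ⟨m, l, h⟩ := theta_eq_zero hτ hi h0
      refine (hz l).1 ?_
      have := congrArg Complex.im h
      simp only [sub_im, add_im, ofReal_im, Complex.div_ofNat_im, Complex.one_im, intCast_im, mul_im,
        intCast_re, zero_mul, add_zero, zero_add, zero_div] at this
      linarith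
    · obtain ⟨m, l, h⟩ := theta_eq_zero hτ hi h0
      refine (hz l).2 ?_
      have := congrArg Complex.im h
      simp only [sub_im, add_im, conj_im, ofReal_im, Complex.div_ofNat_im, Complex.one_im, intCast_im,
        mul_im, intCast_re, zero_mul, add_zero, zero_add, zero_div] at this
      linarith
  have h4 : ∀ l : ℤ, ∀ c : ℤ, (c = 1 ∨ c = 3 ∨ c = -1) → (4 * (l : ℝ) + c) * τ.im ≠ 0 := by
    intro l c hc
    refine mul_ne_zero ?_ hi.ne'
    intro h
    have : 4 * l + c = 0 := by exact_mod_cast h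
    omega
  constructor
  · refine hne _ fun l => ⟨fun h => h4 l 3 (by simp) ?_, fun h => h4 l 1 (by simp) ?_⟩ <;>
    · rw [ofReal_im] at h; push_cast; linarith
  · refine hne _ fun l => ⟨fun h => h4 l 1 (by simp) ?_, fun h => h4 l (-1) (by simp) ?_⟩ <;>
    · simp only [add_im, ofReal_im, Complex.div_ofNat_im, zero_add] at h; push_cast; linarith

/-- By compactness of a period, |ψ|/|φ| has a bound M; the threshold M + 1 gives strict positivity.
-/
lemma exists_bound {φ ψ : ℝ → ℂ} (hφ : Continuous φ) (hψ : Continuous ψ)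
    (p1 : ∀ x, φ (x + 1) = φ x) (p2 : ∀ x, ψ (x + 1) = ψ x) (hpos : ∀ x, 0 < φ x)
    (hr : ∀ x, (starRingEnd ℂ) (ψ x) = ψ x) :
    ∃ M : ℝ, ∀ N : ℝ, M ≤ N → ∀ x, 0 < N * φ x + ψ x := by
  have hc : Continuous fun x => ‖ψ x‖ / ‖φ x‖ :=
    hψ.norm.div₀ hφ.norm fun x => norm_ne_zero_iff.2 (hpos x).ne'
  obtain ⟨M, hM⟩ := (isCompact_Icc (a := (0 : ℝ)) (b := 1)).exists_bound_of_continuousOn hc.continuousOn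
  have hM' : ∀ x, ‖ψ x‖ ≤ M * ‖φ x‖ := fun x => by
    have h1 := Function.Periodic.sub_int_mul_eq p1 (x := x) (n := ⌊x⌋)
    have h2 := Function.Periodic.sub_int_mul_eq p2 (x := x) (n := ⌊x⌋)
    rw [← h1, ← h2, ← div_le_iff₀ (norm_pos_iff.2 (hpos _).ne')]
    have := hM (x - ⌊x⌋ * 1) ⟨by linarith [Int.floor_le x], by linarith [Int.lt_floor_add_one x]⟩
    exact (le_abs_self _).trans this
  refine ⟨M + 1, fun N hN x => ?_⟩
  have e1 := Complex.eq_coe_norm_of_nonneg (hpos x).le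
  have e2 := Complex.conj_eq_iff_re.1 (hr x)
  have h0 := norm_pos_iff.2 (hpos x).ne'
  have h3 := neg_abs_le (ψ x).re
  have h4 := Complex.abs_re_le_norm (ψ x)
  have h5 := hM' x
  rw [e1, ← e2]
  have : 0 < N * ‖φ x‖ + (ψ x).re := by nlinarith
  exact_mod_cast this

/-- Reflection sends x+τ/2 to x-τ/2, and the multiplier of f under τ is what the normalizing factor
changes by under conjugation. -/
lemma IsTheta.half_real (hτ : τ.re = 0) (hf : IsTheta τ n s f)
    (hr : ∀ x : ℝ, (starRingEnd ℂ) (f x) = f x) (x : ℝ) :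
    (starRingEnd ℂ) (Complex.exp (Real.pi * I * (n * x - s)) * f (x + τ / 2)) =
      Complex.exp (Real.pi * I * (n * x - s)) * f (x + τ / 2) := by
  rw [map_mul, ← map_conj_of_real hf.diff hr, ← Complex.exp_conj]
  have e := hf.add_tau (x - τ / 2)
  rw [show (x : ℂ) - τ / 2 + τ = x + τ / 2 by ring] at e
  rw [e, map_add, map_div₀, conj_tau hτ, Complex.conj_ofReal, Complex.conj_ofNat, neg_div,
    ← sub_eq_add_neg, ← mul_assoc, ← Complex.exp_add]
  congr 2
  simp; ring

/-- The factor e^{πinx} is 1-periodic because the degree n = 2k is even. -/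
lemma IsTheta.half_add_one {k : ℕ} (hf : IsTheta τ (2 * k) s f) (x : ℂ) :
    Complex.exp (Real.pi * I * ((2 * k : ℕ) * (x + 1) - s)) * f (x + 1 + τ / 2) =
      Complex.exp (Real.pi * I * ((2 * k : ℕ) * x - s)) * f (x + τ / 2) := by
  rw [show x + 1 + τ / 2 = x + τ / 2 + 1 by ring, hf.add_one]
  congr 1
  refine Complex.exp_eq_exp_iff_exists_int.2 ⟨k, ?_⟩
  push_cast; ring

/-- The theta functions that are real on `ℝ`. -/
def realTheta (τ : ℂ) (n : ℕ) (s : ℝ) : Submodule ℝ (ℂ → ℂ) where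
  carrier := {f | IsTheta τ n s f ∧ ∀ x : ℝ, (starRingEnd ℂ) (f x) = f x}
  add_mem' hf hg := ⟨hf.1.add hg.1, fun x => by simp [hf.2 x, hg.2 x]⟩
  zero_mem' := ⟨⟨differentiable_const 0, by simp, by simp⟩, by simp⟩
  smul_mem' c f hf := ⟨hf.1.smul (c : ℂ), fun x => by
    have : (c • f) x = (c : ℂ) * f x := rfl
    rw [this, map_mul, Complex.conj_ofReal, hf.2 x]⟩

lemma posTheta_subset_realTheta : posTheta τ n s ⊆ realTheta τ n s :=
  fun _ hf => ⟨hf.2.1, fun x => conj_eq_of_nonneg (hf.2.2 x).1⟩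

/-- With f strictly positive on both lines, Nf + g lies in the cone for large N, so g = (Nf + g) -
Nf is a difference of elements of the cone. -/
theorem span_posTheta (hτ : τ.re = 0) (hi : 0 < τ.im) {k : ℕ} (hk : k ≠ 0) (s : ℝ) :
    Submodule.span ℝ (posTheta τ (2 * k) s) = realTheta τ (2 * k) s := by
  refine le_antisymm (Submodule.span_le.2 posTheta_subset_realTheta) ?_
  rintro g ⟨hg, hgr⟩
  obtain ⟨f, hf, hf0⟩ := exists_strictly_pos hτ hi hk s
  have hfc := hf.2.1.diff.continuous
  have hgc := hg.diff.continuous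
  obtain ⟨M, hM⟩ := exists_bound (φ := fun x => f x) (ψ := fun x => g x)
    (hfc.comp continuous_ofReal) (hgc.comp continuous_ofReal)
    (fun x => by push_cast; exact hf.2.1.add_one x) (fun x => by push_cast; exact hg.add_one x)
    (fun x => lt_of_le_of_ne (hf.2.2 x).1 (hf0 x).1.symm) hgr
  obtain ⟨M', hM'⟩ := exists_bound
    (φ := fun x => Complex.exp (Real.pi * I * ((2 * k : ℕ) * x - s)) * f (x + τ / 2))
    (ψ := fun x => Complex.exp (Real.pi * I * ((2 * k : ℕ) * x - s)) * g (x + τ / 2))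
    (Continuous.mul (by fun_prop) (hfc.comp (by fun_prop)))
    (Continuous.mul (by fun_prop) (hgc.comp (by fun_prop)))
    (fun x => by push_cast; exact_mod_cast hf.2.1.half_add_one x)
    (fun x => by push_cast; exact_mod_cast hg.half_add_one x)
    (fun x => lt_of_le_of_ne (hf.2.2 x).2 (mul_ne_zero (Complex.exp_ne_zero _) (hf0 x).2).symm)
    (hg.half_real hτ hgr)
  set N := max M M'
  have e : ∀ z, (N • f + g) z = N * f z + g z := fun z => rfl
  have hH : N • f + g ∈ posTheta τ (2 * k) s := by
    have h1 : ∀ x : ℝ, 0 < (N • f + g) x := fun x => by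
      rw [e]; exact hM N (le_max_left _ _) x
    refine ⟨fun h0 => (h1 0).ne' (by rw [h0]; rfl), (hf.2.1.smul (N : ℂ)).add hg,
      fun x => ⟨(h1 x).le, ?_⟩⟩
    rw [e]
    have := (hM' N (le_max_right _ _) x).le
    refine this.trans (le_of_eq (by ring))
  have : g = (N • f + g) - N • f := by abel
  rw [this]
  exact Submodule.sub_mem _ (Submodule.subset_span hH)
    (Submodule.smul_mem _ _ (Submodule.subset_span hf))

/-- Every theta function is uniquely F + iG with F, G real on ℝ, because z ↦ conj(f(conj z))
preserves the space. The real dimension is therefore half of 2n. That the explicit family spans is a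
hypothesis here; it is obtained later from the count of moments. -/
theorem rank_realTheta (hτ : τ.re = 0) (hi : 0 < τ.im)
    (h : ∀ f, IsTheta τ n s f → f ∈ Submodule.span ℂ (Set.range (thetaBasis τ n s))) :
    Module.rank ℝ (realTheta τ n s) = n := by
  let b : (Fin n → ℂ) →ₗ[ℝ] (ℂ → ℂ) :=
    (Fintype.linearCombination ℂ (thetaBasis τ n s)).restrictScalars ℝ
  have hb : Function.Injective b := by
    have := linearIndependent_thetaBasis (n := n) (s := s) hτ hi
    exact this.fintypeLinearCombination_injective
  have hbr : ∀ f, f ∈ LinearMap.range b ↔ IsTheta τ n s f := fun f => by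
    have e : f ∈ LinearMap.range b ↔ f ∈ Submodule.span ℂ (Set.range (thetaBasis τ n s)) := by
      rw [← Fintype.range_linearCombination]; rfl
    rw [e]
    clear e
    refine ⟨fun hf => ?_, h f⟩
    induction hf using Submodule.span_induction with
    | mem x hx => obtain ⟨j, rfl⟩ := hx; exact isTheta_thetaBasis hi j
    | zero => exact ⟨differentiable_const 0, by simp, by simp⟩
    | add x y _ _ hx hy => exact hx.add hy
    | smul c x _ hx => exact hx.smul c
  -- The complexification map (F, G) ↦ F + iG. It is injective because F and G are recovered from
  -- the real and imaginary parts on ℝ.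
  let Φ : (realTheta τ n s × realTheta τ n s) →ₗ[ℝ] (ℂ → ℂ) :=
    { toFun := fun p => (p.1 : ℂ → ℂ) + I • (p.2 : ℂ → ℂ)
      map_add' := fun p q => by
        simp only [Prod.fst_add, Prod.snd_add, Submodule.coe_add, smul_add]; abel
      map_smul' := fun c p => by
        simp only [Prod.smul_fst, Prod.smul_snd, Submodule.coe_smul, RingHom.id_apply, smul_add]
        rw [smul_comm] }
  have hval : ∀ p z, Φ p z = (p.1 : ℂ → ℂ) z + I * (p.2 : ℂ → ℂ) z := fun p z => rfl
  have hinj : Function.Injective Φ := by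
    rw [← LinearMap.ker_eq_bot, LinearMap.ker_eq_bot']
    intro p hp
    have h0 : ∀ x : ℝ, (p.1 : ℂ → ℂ) x = 0 ∧ (p.2 : ℂ → ℂ) x = 0 := fun x => by
      have h1 := hval p x
      rw [hp] at h1
      have h2 := congrArg (starRingEnd ℂ) h1
      rw [map_add, map_mul, Complex.conj_I, p.1.2.2 x, p.2.2.2 x] at h2
      simp only [Pi.zero_apply, map_zero] at h1 h2
      refine ⟨by linear_combination -(h1 + h2) / 2, ?_⟩
      have : I * (p.2 : ℂ → ℂ) x = 0 := by linear_combination (h2 - h1) / 2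
      simpa using this
    have hz : ∀ g : realTheta τ n s, (∀ x : ℝ, (g : ℂ → ℂ) x = 0) → g = 0 :=
      fun g hg => Subtype.ext (eq_of_eq_ofReal g.2.1.diff
        (differentiable_const 0) fun x => by rw [hg]; rfl)
    exact Prod.ext (hz _ fun x => (h0 x).1) (hz _ fun x => (h0 x).2)
  have hrange : LinearMap.range Φ = LinearMap.range b := by
    ext f
    rw [hbr]
    constructor
    · rintro ⟨p, rfl⟩
      exact p.1.2.1.add (p.2.2.1.smul I)
    · intro hf
      have hc := hf.conj hτ
      refine ⟨⟨⟨_, (hf.add hc).smul (1 / 2), fun x => ?_⟩,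
        ⟨_, (hf.add (hc.smul (-1))).smul (1 / (2 * I)), fun x => ?_⟩⟩, ?_⟩
      · simp [Complex.conj_ofNat]; ring
      · simp [Complex.conj_ofNat]; ring
      · refine funext fun z => ?_
        rw [hval]
        simp
        field_simp
        linear_combination -(f z - (starRingEnd ℂ) (f ((starRingEnd ℂ) z))) * I_sq
  have h1 := LinearMap.finrank_range_of_inj hinj
  have h2 := LinearMap.finrank_range_of_inj hb
  rw [hrange, h2, finrank_real_of_complex, Module.finrank_fin_fun] at h1
  have hfin : Module.Finite ℝ (realTheta τ n s) := by
    have : Module.Finite ℝ (LinearMap.range Φ) := by rw [hrange]; infer_instance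
    have := Module.Finite.equiv (LinearEquiv.ofInjective Φ hinj).symm
    exact Module.Finite.of_surjective (LinearMap.fst ℝ (realTheta τ n s) (realTheta τ n s))
      LinearMap.fst_surjective
  rw [Module.finrank_prod] at h1
  rw [← Module.finrank_eq_rank]
  exact_mod_cast (by omega : Module.finrank ℝ (realTheta τ n s) = n)

/-! ### Translation -/

/-- Replacing z by z + d adds 2nd to the linear term of the multiplier and nd to the normalizing
exponent, so both conditions hold with s - nd. -/
lemma translate_mem_posTheta (hf : f ∈ posTheta τ n s) (d : ℝ) :
    (fun z => f (z + d)) ∈ posTheta τ n (s - n * d) := by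
  obtain ⟨h0, hq, hp⟩ := hf
  refine ⟨fun h => h0 (funext fun z => ?_), ⟨?_, fun x => ?_, fun x => ?_⟩, fun x => ⟨?_, ?_⟩⟩
  · have := congrFun h (z - d)
    simpa using this
  · exact hq.diff.comp (by fun_prop : Differentiable ℂ fun z : ℂ => z + d)
  · rw [show x + 1 + d = x + d + 1 by ring, hq.add_one]
  · rw [show x + τ + d = x + d + τ by ring, hq.add_tau]
    congr 2; push_cast; ring
  · have := (hp (x + d)).1; push_cast at this; exact this
  · have := (hp (x + d)).2; push_cast at this ⊢
    refine this.trans (le_of_eq ?_)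
    rw [show (x : ℂ) + d + τ / 2 = x + τ / 2 + d by ring]
    congr 2; ring

end theta

/-! ### Evaluation of Laurent polynomials at units -/

section laurent
open LaurentPolynomial (C invert)
variable {B B' : Type*} [Ring B] [Algebra ℂ B] [Ring B'] [Algebra ℂ B']

/-- Evaluation of Laurent polynomials at a unit. -/
def laurentHom (X : Bˣ) : ℂ[T;T⁻¹] →ₐ[ℂ] B :=
  AddMonoidAlgebra.lift ℂ B ℤ ((Units.coeHom B).comp (zpowersHom Bˣ X))

lemma laurentHom_T (X : Bˣ) (k : ℤ) : laurentHom X (.T k) = ((X ^ k : Bˣ) : B) := by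
  rw [laurentHom, LaurentPolynomial.T, AddMonoidAlgebra.lift_single]; simp

lemma laurentHom_T_one (X : Bˣ) : laurentHom X (.T 1) = (X : B) := by simp [laurentHom_T]

lemma laurentEval_eq {x y : B} (hxy : x * y = 1) (hyx : y * x = 1) (R : ℂ[T;T⁻¹]) :
    laurentEval x y R = laurentHom ⟨x, y, hxy, hyx⟩ R := by
  rw [laurentHom, AddMonoidAlgebra.lift_apply, laurentEval]
  refine Finsupp.sum_congr fun k _ => ?_
  congr 1
  simp only [MonoidHom.comp_apply, zpowersHom_apply, toAdd_ofAdd, Units.coeHom_apply]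
  rcases Int.le_total 0 k with h | h
  · obtain ⟨m, rfl⟩ := Int.eq_ofNat_of_zero_le h
    simp
  · obtain ⟨m, hm⟩ := Int.eq_ofNat_of_zero_le (neg_nonneg.2 h)
    obtain rfl : k = -m := by omega
    simp [zpow_neg, ← inv_pow]

/-- The variable, as a unit. -/
def TUnit : (ℂ[T;T⁻¹])ˣ :=
  ⟨.T 1, .T (-1), by rw [← LaurentPolynomial.T_add, add_neg_cancel, LaurentPolynomial.T_zero],
    by rw [← LaurentPolynomial.T_add, neg_add_cancel, LaurentPolynomial.T_zero]⟩

lemma TUnit_zpow (k : ℤ) : ((TUnit ^ k : (ℂ[T;T⁻¹])ˣ) : ℂ[T;T⁻¹]) = .T k := by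
  have h : ∀ m : ℕ, ((TUnit ^ m : (ℂ[T;T⁻¹])ˣ) : ℂ[T;T⁻¹]) = .T m := fun m => by
    simp [TUnit, LaurentPolynomial.T_pow]
  have h' : ∀ m : ℕ, ((TUnit⁻¹ ^ m : (ℂ[T;T⁻¹])ˣ) : ℂ[T;T⁻¹]) = .T (-m) := fun m => by
    simp [TUnit, LaurentPolynomial.T_pow]
  rcases Int.le_total 0 k with hk | hk
  · obtain ⟨m, rfl⟩ := Int.eq_ofNat_of_zero_le hk
    simpa using h m
  · obtain ⟨m, hm⟩ := Int.eq_ofNat_of_zero_le (neg_nonneg.2 hk)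
    obtain rfl : k = -m := by omega
    simpa using h' m

lemma eq_laurentHom (φ : ℂ[T;T⁻¹] →ₐ[ℂ] B) (X : Bˣ) (h : φ (.T 1) = X) (R : ℂ[T;T⁻¹]) :
    φ R = laurentHom X R := by
  have hX : Units.map (φ : ℂ[T;T⁻¹] →* B) TUnit = X := Units.ext h
  have hT : ∀ k, φ (.T k) = laurentHom X (.T k) := fun k => by
    rw [laurentHom_T, ← hX, ← map_zpow, Units.coe_map, TUnit_zpow]; rfl
  induction R using LaurentPolynomial.induction_on' with
  | add p q hp hq => rw [map_add, map_add, hp, hq]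
  | C_mul_T n a => rw [← LaurentPolynomial.smul_eq_C_mul, map_smul, map_smul, hT]

lemma map_laurentHom (φ : B →ₐ[ℂ] B') (X : Bˣ) (R : ℂ[T;T⁻¹]) :
    φ (laurentHom X R) = laurentHom (Units.map (φ : B →* B') X) R :=
  eq_laurentHom (φ.comp (laurentHom X)) _ (by simp [laurentHom_T_one]) R

lemma map_laurentEval (φ : B →ₐ[ℂ] B') (x y : B) (R : ℂ[T;T⁻¹]) :
    φ (laurentEval x y R) = laurentEval (φ x) (φ y) R := by
  simp [laurentEval, Finsupp.sum]

lemma laurentHom_semiconj {a : B} {X Y : Bˣ} (h : SemiconjBy a (X : B) Y) (R : ℂ[T;T⁻¹]) :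
    a * laurentHom X R = laurentHom Y R * a := by
  induction R using LaurentPolynomial.induction_on' with
  | add p q hp hq => simp only [map_add, mul_add, add_mul, hp, hq]
  | C_mul_T n c =>
    rw [← LaurentPolynomial.smul_eq_C_mul, map_smul, map_smul, mul_smul_comm, smul_mul_assoc,
      laurentHom_T, laurentHom_T, (h.units_zpow_right n).eq]

/-- `R(z) ↦ R(cz)` -/
def scale (c : ℂˣ) : ℂ[T;T⁻¹] →ₐ[ℂ] ℂ[T;T⁻¹] :=
  laurentHom (Units.map (algebraMap ℂ ℂ[T;T⁻¹] : ℂ →* ℂ[T;T⁻¹]) c * TUnit)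

lemma scale_T (c : ℂˣ) (k : ℤ) : scale c (.T k) = ((c ^ k : ℂˣ) : ℂ) • .T k := by
  rw [scale, laurentHom_T, mul_zpow, Units.val_mul, TUnit_zpow, ← map_zpow, Units.coe_map,
    Algebra.smul_def]
  rfl

lemma scale_T_one (c : ℂˣ) : scale c (.T 1) = (c : ℂ) • .T 1 := by simp [scale_T]

lemma laurentHom_scale {c : ℂˣ} {X Y : Bˣ} (h : (Y : B) = (c : ℂ) • (X : B)) (R : ℂ[T;T⁻¹]) :
    laurentHom X (scale c R) = laurentHom Y R :=
  eq_laurentHom ((laurentHom X).comp (scale c)) _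
    (by rw [AlgHom.comp_apply, scale_T_one, map_smul, laurentHom_T_one, h]) R

lemma laurentHom_TUnit (R : ℂ[T;T⁻¹]) : laurentHom TUnit R = R :=
  (eq_laurentHom (AlgHom.id ℂ _) TUnit rfl R).symm

lemma scale_scale (a b : ℂˣ) (R : ℂ[T;T⁻¹]) : scale a (scale b R) = scale (a * b) R := by
  rw [scale]
  refine laurentHom_scale ?_ R
  simp only [Units.val_mul, Units.coe_map, map_mul]
  rw [Algebra.smul_def, mul_left_comm, mul_assoc]
  rfl

@[simp] lemma scale_one (R : ℂ[T;T⁻¹]) : scale 1 R = R := by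
  rw [scale, map_one, one_mul, laurentHom_TUnit]

lemma scale_injective (c : ℂˣ) : Function.Injective (scale c) := fun R S h => by
  have := congrArg (scale c⁻¹) h
  simpa [scale_scale] using this

lemma scale_ne_zero (c : ℂˣ) {R : ℂ[T;T⁻¹]} (h : R ≠ 0) : scale c R ≠ 0 := by
  rwa [Ne, map_eq_zero_iff _ (scale_injective c)]

lemma scale_surjective (c : ℂˣ) (R : ℂ[T;T⁻¹]) : ∃ S, scale c S = R :=
  ⟨scale c⁻¹ R, by simp [scale_scale]⟩

/-- Complex conjugation of the coefficients. -/
def conjL : ℂ[T;T⁻¹] →+* ℂ[T;T⁻¹] := AddMonoidAlgebra.mapRingHom ℤ (starRingEnd ℂ)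

lemma conjL_smul_T (a : ℂ) (k : ℤ) : conjL (a • .T k) = (starRingEnd ℂ) a • .T k := by
  rw [LaurentPolynomial.T, AddMonoidAlgebra.smul_single', AddMonoidAlgebra.smul_single', conjL,
    AddMonoidAlgebra.mapRingHom_single, map_mul, map_one]

/-- The Laurent polynomial with values `conj (R z)` on the unit circle. -/
def starL : ℂ[T;T⁻¹] →+* ℂ[T;T⁻¹] := (invert (R := ℂ) : ℂ[T;T⁻¹] →+* ℂ[T;T⁻¹]).comp conjL

lemma starL_smul_T (a : ℂ) (k : ℤ) : starL (a • .T k) = (starRingEnd ℂ) a • .T (-k) := by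
  change invert (conjL _) = _
  rw [conjL_smul_T, map_smul, LaurentPolynomial.invert_T]

lemma laurent_induction {p : ℂ[T;T⁻¹] → Prop} (R : ℂ[T;T⁻¹]) (add : ∀ R S, p R → p S → p (R + S))
    (smul_T : ∀ (a : ℂ) k, p (a • .T k)) : p R := by
  induction R using LaurentPolynomial.induction_on' with
  | add p q hp hq => exact add p q hp hq
  | C_mul_T n a => rw [← LaurentPolynomial.smul_eq_C_mul]; exact smul_T a n

/-- A conjugate-linear homomorphism `φ` maps `R(X)` to `R*(Y)`, `φ(X) = Y⁻¹`. -/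
lemma map_laurentHom_conj (φ : B →+* B') (hφ : ∀ (a : ℂ) x, φ (a • x) = (starRingEnd ℂ) a • φ x)
    (X : Bˣ) (Y : B'ˣ) (h : Units.map (φ : B →* B') X = Y⁻¹) (R : ℂ[T;T⁻¹]) :
    φ (laurentHom X R) = laurentHom Y (starL R) := by
  induction R using laurent_induction with
  | add R S hR hS => rw [map_add, map_add, hR, hS, map_add, map_add]
  | smul_T a k =>
    rw [starL_smul_T, map_smul (laurentHom X), map_smul (laurentHom Y), hφ, laurentHom_T, laurentHom_T, zpow_neg, ← inv_zpow,
      ← h, ← map_zpow]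
    rfl

lemma map_laurentEval_conj (φ : B →+* B') (hφ : ∀ (a : ℂ) x, φ (a • x) = (starRingEnd ℂ) a • φ x)
    {x y : B} (h1 : φ x * φ y = 1) (h2 : φ y * φ x = 1) (R : ℂ[T;T⁻¹]) :
    φ (laurentEval x y R) = laurentHom ⟨φ y, φ x, h2, h1⟩ (starL R) := by
  have e1 : φ (laurentEval x y R) = laurentEval (φ x) (φ y) (conjL R) := by
    have hc : (conjL R).coeff = R.coeff.mapRange (starRingEnd ℂ) (map_zero _) := rfl
    rw [laurentEval, laurentEval, map_finsuppSum, hc, Finsupp.sum_mapRange_index (by simp)]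
    exact Finsupp.sum_congr fun k _ => by simp [hφ]
  rw [e1, laurentEval_eq h1 h2]
  have e2 : starL R = invert (conjL R) := rfl
  rw [e2]
  symm
  refine eq_laurentHom ((laurentHom ⟨φ y, φ x, h2, h1⟩).comp
    ((invert (R := ℂ)) : ℂ[T;T⁻¹] →ₐ[ℂ] ℂ[T;T⁻¹])) _ ?_ _
  simp [laurentHom_T]

lemma evalAt_eq {z : ℂ} (hz : z ≠ 0) (R : ℂ[T;T⁻¹]) : evalAt R z = laurentHom (Units.mk0 z hz) R := by
  rw [evalAt, laurentEval_eq (mul_inv_cancel₀ hz) (inv_mul_cancel₀ hz)]; rfl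

lemma evalAt_T {z : ℂ} (hz : z ≠ 0) (k : ℤ) : evalAt (.T k) z = z ^ k := by
  rw [evalAt_eq hz, laurentHom_T]; simp

lemma evalAt_mul {z : ℂ} (hz : z ≠ 0) (R S : ℂ[T;T⁻¹]) :
    evalAt (R * S) z = evalAt R z * evalAt S z := by simp [evalAt_eq hz]

lemma evalAt_add {z : ℂ} (hz : z ≠ 0) (R S : ℂ[T;T⁻¹]) :
    evalAt (R + S) z = evalAt R z + evalAt S z := by simp [evalAt_eq hz]

lemma evalAt_smul {z : ℂ} (hz : z ≠ 0) (a : ℂ) (R : ℂ[T;T⁻¹]) :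
    evalAt (a • R) z = a * evalAt R z := by simp [evalAt_eq hz]

lemma evalAt_scale {z : ℂ} (hz : z ≠ 0) (c : ℂˣ) (R : ℂ[T;T⁻¹]) :
    evalAt (scale c R) z = evalAt R (c * z) := by
  rw [evalAt_eq hz, evalAt_eq (mul_ne_zero c.ne_zero hz)]
  exact laurentHom_scale (by simp) R

lemma evalAt_starL {z : ℂ} (hz : z ≠ 0) (R : ℂ[T;T⁻¹]) :
    evalAt (starL R) z = (starRingEnd ℂ) (evalAt R ((starRingEnd ℂ) z)⁻¹) := by
  have hz' : ((starRingEnd ℂ) z)⁻¹ ≠ 0 := by simpa using hz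
  rw [evalAt_eq hz, evalAt_eq hz']
  refine (map_laurentHom_conj (starRingEnd ℂ) (fun a x => by simp) _ _ ?_ R).symm
  ext; simp

lemma differentiableOn_evalAt (R : ℂ[T;T⁻¹]) : DifferentiableOn ℂ (evalAt R) {0}ᶜ := by
  induction R using laurent_induction with
  | add R S hR hS => exact (hR.add hS).congr fun z hz => evalAt_add hz R S
  | smul_T a k =>
    have : DifferentiableOn ℂ (fun z : ℂ => a * z ^ k) {0}ᶜ := fun z hz =>
      ((differentiableAt_zpow.2 (Or.inl hz)).const_mul a).differentiableWithinAt
    exact this.congr fun z hz => by rw [evalAt_smul hz, evalAt_T hz]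

@[fun_prop] lemma differentiable_evalAt_E (R : ℂ[T;T⁻¹]) : Differentiable ℂ fun z => evalAt R (E z) :=
  fun z => ((differentiableOn_evalAt R).differentiableAt
    (isOpen_compl_singleton.mem_nhds (E_ne_zero z))).comp z (differentiable_E z)

lemma evalAt_toLaurent {z : ℂ} (hz : z ≠ 0) (f : Polynomial ℂ) :
    evalAt (Polynomial.toLaurent f) z = f.eval z := by
  rw [evalAt_eq hz]
  have := Polynomial.algHom_ext (f := (laurentHom (Units.mk0 z hz)).comp Polynomial.toLaurentAlg)
    (g := Polynomial.aeval z) (by simp [laurentHom_T_one])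
  simpa using congrArg (fun F => F f) this

lemma eq_zero_of_evalAt {s : Set ℂ} (hs : s.Infinite) {R : ℂ[T;T⁻¹]}
    (h : ∀ z ∈ s, z ≠ 0 ∧ evalAt R z = 0) : R = 0 := by
  obtain ⟨n, f, hf⟩ := LaurentPolynomial.exists_T_pow R
  have hz : ∀ z : ℂ, z ≠ 0 → f.eval z = evalAt R z * z ^ n := fun z hz => by
    rw [← evalAt_toLaurent hz, hf, evalAt_mul hz, evalAt_T hz]; simp
  have h0 : f = 0 := Polynomial.eq_zero_of_infinite_isRoot f (hs.mono fun z hzs => by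
    rw [Set.mem_ofPred_eq, Polynomial.IsRoot, hz z (h z hzs).1, (h z hzs).2, zero_mul])
  rw [h0, map_zero] at hf
  have := congrArg (· * (.T (-n) : ℂ[T;T⁻¹])) hf
  rw [zero_mul, mul_assoc, ← LaurentPolynomial.T_add, add_neg_cancel, LaurentPolynomial.T_zero,
    mul_one] at this
  exact this.symm

lemma infinite_image_E {a b : ℝ} (hab : a < b) : ((fun x : ℝ => E x) '' Set.Ioo a b).Infinite := by
  refine Set.infinite_of_injOn_mapsTo (s := Set.Ioo a (min b (a + 1))) (f := fun x : ℝ => E x)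
    (fun x hx y hy hxy => ?_) (fun x hx => ⟨x, ⟨hx.1, hx.2.trans_le (min_le_left _ _)⟩, rfl⟩)
    (Set.Ioo_infinite (lt_min hab (by linarith)))
  obtain ⟨k, hk⟩ := E_eq_iff.1 hxy
  have hk' : x = y + k := by exact_mod_cast hk
  have e1 := hx.2.trans_le (min_le_right _ _)
  have e2 := hy.2.trans_le (min_le_right _ _)
  have h1 : (k : ℝ) < 1 := by linarith [hy.1]
  have h2 : (-1 : ℝ) < k := by linarith [hx.1]
  have : k = 0 := by
    have a1 : k < 1 := by exact_mod_cast h1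
    have a2 : -1 < k := by exact_mod_cast h2
    omega
  simpa [this] using hk'

lemma infinite_range_E : (Set.range fun x : ℝ => E x).Infinite :=
  (infinite_image_E zero_lt_one).mono (Set.image_subset_range _ _)

lemma eq_of_evalAt_E {R S : ℂ[T;T⁻¹]} (h : ∀ x : ℝ, evalAt R (E x) = evalAt S (E x)) : R = S := by
  rw [← sub_eq_zero]
  refine eq_zero_of_evalAt infinite_range_E ?_
  rintro _ ⟨x, rfl⟩
  refine ⟨E_ne_zero _, ?_⟩
  have := h x
  rw [evalAt_eq (E_ne_zero _)] at this ⊢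
  rw [evalAt_eq (E_ne_zero _)] at this
  rw [map_sub, this, sub_self]

lemma norm_E_ofReal (x : ℝ) : ‖E x‖ = 1 := by simp [norm_E]

lemma conj_inv_E (x : ℝ) : ((starRingEnd ℂ) (E x))⁻¹ = E x := by
  rw [conj_E, E_neg, inv_inv, Complex.conj_ofReal]

lemma RealOnCircle.starL_eq {P : ℂ[T;T⁻¹]} (h : RealOnCircle P) : starL P = P :=
  eq_of_evalAt_E fun x => by
    rw [evalAt_starL (E_ne_zero _), conj_inv_E]
    exact Complex.conj_eq_iff_im.2 (h _ (norm_E_ofReal x))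

end laurent

/-! ### The algebra: generators and a spanning set -/

section algebra
variable {q : ℂˣ} {P : ℂ[T;T⁻¹]}

lemma el_Z_mul_Zi (q : ℂ) (P : ℂ[T;T⁻¹]) : el q P .Z * el q P .Zi = 1 := by
  rw [el, el, ← map_mul, RingQuot.mkAlgHom_rel ℂ Rel.Z_Zi, map_one]

lemma el_Zi_mul_Z (q : ℂ) (P : ℂ[T;T⁻¹]) : el q P .Zi * el q P .Z = 1 := by
  rw [el, el, ← map_mul, RingQuot.mkAlgHom_rel ℂ Rel.Zi_Z, map_one]

/-- The generator `Z`, as a unit. -/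
def zUnit (q : ℂ) (P : ℂ[T;T⁻¹]) : (Alg q P)ˣ :=
  ⟨el q P .Z, el q P .Zi, el_Z_mul_Zi q P, el_Zi_mul_Z q P⟩

lemma ofLaurent_eq (q : ℂ) (P R : ℂ[T;T⁻¹]) : ofLaurent q P R = laurentHom (zUnit q P) R :=
  laurentEval_eq _ _ R

lemma el_Z_mul_u (q : ℂ) (P : ℂ[T;T⁻¹]) :
    el q P .Z * el q P .u * el q P .Zi = q ^ 2 • el q P .u := by
  simp only [el, ← map_mul]
  rw [RingQuot.mkAlgHom_rel ℂ Rel.Z_u, map_smul]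

lemma el_Z_mul_v (q : ℂ) (P : ℂ[T;T⁻¹]) :
    el q P .Z * el q P .v * el q P .Zi = (q ^ 2)⁻¹ • el q P .v := by
  simp only [el, ← map_mul]
  rw [RingQuot.mkAlgHom_rel ℂ Rel.Z_v, map_smul]

lemma smul_Z_mul {c d : ℂ} (h : c * d = 1) (q : ℂ) (P : ℂ[T;T⁻¹]) :
    (c • el q P .Z) * (d • el q P .Zi) = 1 ∧ (d • el q P .Zi) * (c • el q P .Z) = 1 := by
  rw [smul_mul_smul_comm, smul_mul_smul_comm, mul_comm d c, h, el_Z_mul_Zi, el_Zi_mul_Z, one_smul]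
  exact ⟨rfl, rfl⟩

lemma laurentEval_smul_Z (c : ℂˣ) (q : ℂ) (P R : ℂ[T;T⁻¹]) :
    laurentEval ((c : ℂ) • el q P .Z) ((c : ℂ)⁻¹ • el q P .Zi) R =
      laurentHom (zUnit q P) (scale c R) := by
  obtain ⟨h1, h2⟩ := smul_Z_mul (mul_inv_cancel₀ c.ne_zero) q P
  rw [laurentEval_eq h1 h2]
  exact (laurentHom_scale rfl R).symm

lemma el_u_mul_v (q : ℂˣ) (P : ℂ[T;T⁻¹]) :
    el q P .u * el q P .v = laurentHom (zUnit q P) (scale q⁻¹ P) := by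
  rw [← laurentEval_smul_Z]
  simp only [el, ← map_mul]
  rw [RingQuot.mkAlgHom_rel ℂ Rel.u_v, map_laurentEval, map_smul, map_smul]
  simp

lemma el_v_mul_u (q : ℂˣ) (P : ℂ[T;T⁻¹]) :
    el q P .v * el q P .u = laurentHom (zUnit q P) (scale q P) := by
  rw [← laurentEval_smul_Z]
  simp only [el, ← map_mul]
  rw [RingQuot.mkAlgHom_rel ℂ Rel.v_u, map_laurentEval, map_smul, map_smul]

lemma mul_laurentHom {a : Alg q P} {c : ℂˣ}
    (h : el q P .Z * a * el q P .Zi = (c : ℂ) • a) (R : ℂ[T;T⁻¹]) :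
    a * laurentHom (zUnit q P) R = laurentHom (zUnit q P) (scale c⁻¹ R) * a := by
  obtain ⟨h1, h2⟩ := smul_Z_mul (mul_inv_cancel₀ (c⁻¹).ne_zero) (q : ℂ) P
  rw [laurentHom_scale (Y := ⟨_, _, h1, h2⟩) rfl]
  refine laurentHom_semiconj ?_ R
  have e : el q P .Z * a = (c : ℂ) • (a * el q P .Z) := by
    rw [← smul_mul_assoc, ← h, mul_assoc, el_Zi_mul_Z, mul_one]
  change a * el q P .Z = ((c⁻¹ : ℂˣ) : ℂ) • el q P .Z * a
  rw [smul_mul_assoc, e, smul_smul, Units.inv_mul, one_smul]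

/-- `a` is homogeneous of degree `i`. -/
def IsHom (q : ℂˣ) (P : ℂ[T;T⁻¹]) (i : ℤ) (a : Alg q P) : Prop :=
  el q P .Z * a * el q P .Zi = (q : ℂ) ^ (2 * i) • a

lemma IsHom.mul {i j : ℤ} {a b : Alg q P} (ha : IsHom q P i a) (hb : IsHom q P j b) :
    IsHom q P (i + j) (a * b) := by
  have e : el q P .Z * (a * b) * el q P .Zi
      = (el q P .Z * a * el q P .Zi) * (el q P .Z * b * el q P .Zi) := by
    simp only [mul_assoc]
    rw [← mul_assoc (el q P .Zi) (el q P .Z), el_Zi_mul_Z, one_mul]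
  rw [IsHom, e, ha, hb, smul_mul_smul_comm, ← zpow_add₀ q.ne_zero]
  congr 2; ring

lemma isHom_one : IsHom q P 0 (1 : Alg q P) := by simp [IsHom, el_Z_mul_Zi]

lemma IsHom.pow {i : ℤ} {a : Alg q P} (ha : IsHom q P i a) (k : ℕ) : IsHom q P (k * i) (a ^ k) := by
  induction k with
  | zero => simpa using isHom_one
  | succ k ih =>
    rw [pow_succ]; convert ih.mul ha using 1; push_cast; ring

lemma isHom_u : IsHom q P 1 (el q P .u) := by
  rw [IsHom, el_Z_mul_u]; rfl

lemma isHom_v : IsHom q P (-1) (el q P .v) := by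
  rw [IsHom, el_Z_mul_v, mul_neg, mul_one, zpow_neg]; rfl

lemma isHom_laurentHom (R : ℂ[T;T⁻¹]) : IsHom q P 0 (laurentHom (zUnit q P) R) := by
  have h : SemiconjBy (el q P .Z) (zUnit q P : Alg q P) (zUnit q P) := rfl
  rw [IsHom, laurentHom_semiconj h, mul_assoc, el_Z_mul_Zi]; simp

lemma IsHom.mul_laurentHom {i : ℤ} {a : Alg q P} (ha : IsHom q P i a) (R : ℂ[T;T⁻¹]) :
    a * laurentHom (zUnit q P) R = laurentHom (zUnit q P) (scale (q ^ (2 * i))⁻¹ R) * a :=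
  QWeyl.mul_laurentHom (by rw [ha]; simp) R

/-- `u ^ i` for `i ≥ 0`, `v ^ (-i)` for `i ≤ 0`. -/
def uv (q : ℂˣ) (P : ℂ[T;T⁻¹]) (i : ℤ) : Alg q P := el q P .u ^ i.toNat * el q P .v ^ (-i).toNat

@[simp] lemma uv_zero : uv q P 0 = 1 := by simp [uv]
@[simp] lemma uv_natCast (k : ℕ) : uv q P k = el q P .u ^ k := by simp [uv]
@[simp] lemma uv_neg_natCast (k : ℕ) : uv q P (-k) = el q P .v ^ k := by simp [uv]

lemma int_cases (i : ℤ) : (∃ k : ℕ, i = k) ∨ ∃ k : ℕ, i = -(k + 1 : ℕ) := by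
  rcases Int.le_total 0 i with h | h
  · exact Or.inl (Int.eq_ofNat_of_zero_le h)
  · by_cases h0 : i = 0
    · exact Or.inl ⟨0, h0⟩
    · exact Or.inr ⟨(-i - 1).toNat, by omega⟩

lemma isHom_uv (i : ℤ) : IsHom q P i (uv q P i) := by
  rcases int_cases i with ⟨k, rfl⟩ | ⟨k, rfl⟩
  · rw [uv_natCast]; convert isHom_u.pow k using 1; ring
  · rw [uv_neg_natCast]; convert isHom_v.pow (k + 1) using 1; push_cast; ring

lemma u_mul_uv (q : ℂˣ) (P : ℂ[T;T⁻¹]) (i : ℤ) : el q P .u * uv q P i =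
    laurentHom (zUnit q P) (if 0 ≤ i then 1 else scale q⁻¹ P) * uv q P (i + 1) := by
  rcases int_cases i with ⟨k, rfl⟩ | ⟨k, rfl⟩
  · rw [if_pos (by omega), map_one, one_mul, ← Nat.cast_add_one, uv_natCast, uv_natCast, pow_succ']
  · rw [if_neg (by omega), show -((k + 1 : ℕ) : ℤ) + 1 = -(k : ℕ) by push_cast; ring,
      uv_neg_natCast, uv_neg_natCast, pow_succ', ← mul_assoc, el_u_mul_v]

lemma v_mul_uv (q : ℂˣ) (P : ℂ[T;T⁻¹]) (i : ℤ) : el q P .v * uv q P i =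
    laurentHom (zUnit q P) (if i ≤ 0 then 1 else scale q P) * uv q P (i - 1) := by
  rcases int_cases (-i) with ⟨k, hk⟩ | ⟨k, hk⟩
  · obtain rfl : i = -k := by omega
    rw [if_pos (by omega), map_one, one_mul, show -(k : ℤ) - 1 = -(k + 1 : ℕ) by push_cast; ring,
      uv_neg_natCast, uv_neg_natCast, pow_succ']
  · obtain rfl : i = (k + 1 : ℕ) := by omega
    rw [if_neg (by omega), show ((k + 1 : ℕ) : ℤ) - 1 = (k : ℕ) by push_cast; ring,
      uv_natCast, uv_natCast, pow_succ', ← mul_assoc, el_v_mul_u]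

/-- The factor D is made explicit only for i = -1, where the product lands in degree zero and the
trace sees it. Elsewhere only D ≠ 0 is needed, for positivity. -/
lemma uv_mul_u (q : ℂˣ) (P : ℂ[T;T⁻¹]) (i : ℤ) : ∃ D, (P ≠ 0 → D ≠ 0) ∧ (i = -1 → D = scale q P) ∧
    uv q P i * el q P .u = laurentHom (zUnit q P) D * uv q P (i + 1) := by
  rcases int_cases i with ⟨k, rfl⟩ | ⟨k, rfl⟩
  · refine ⟨1, fun _ => one_ne_zero, fun h => by omega, ?_⟩
    rw [map_one, one_mul, ← Nat.cast_add_one, uv_natCast, uv_natCast, pow_succ]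
  · refine ⟨scale (q ^ (2 * -(k : ℤ)))⁻¹ (scale q P), fun h => scale_ne_zero _ (scale_ne_zero _ h),
      fun h => ?_, ?_⟩
    · obtain rfl : k = 0 := by omega
      simp
    · rw [show -((k + 1 : ℕ) : ℤ) + 1 = -(k : ℕ) by push_cast; ring, ← (isHom_uv _).mul_laurentHom,
        uv_neg_natCast, uv_neg_natCast, pow_succ, mul_assoc, el_v_mul_u]

lemma uv_mul_v (q : ℂˣ) (P : ℂ[T;T⁻¹]) (i : ℤ) : ∃ D, (P ≠ 0 → D ≠ 0) ∧ (i = 1 → D = scale q⁻¹ P) ∧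
    uv q P i * el q P .v = laurentHom (zUnit q P) D * uv q P (i - 1) := by
  rcases int_cases (-i) with ⟨k, hk⟩ | ⟨k, hk⟩
  · obtain rfl : i = -k := by omega
    refine ⟨1, fun _ => one_ne_zero, fun h => by omega, ?_⟩
    rw [map_one, one_mul, show -(k : ℤ) - 1 = -(k + 1 : ℕ) by push_cast; ring,
      uv_neg_natCast, uv_neg_natCast, pow_succ]
  · obtain rfl : i = (k + 1 : ℕ) := by omega
    refine ⟨scale (q ^ (2 * (k : ℤ)))⁻¹ (scale q⁻¹ P), fun h => scale_ne_zero _ (scale_ne_zero _ h),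
      fun h => ?_, ?_⟩
    · obtain rfl : k = 0 := by omega
      simp
    · rw [show ((k + 1 : ℕ) : ℤ) - 1 = (k : ℕ) by push_cast; ring, ← (isHom_uv _).mul_laurentHom,
        uv_natCast, uv_natCast, pow_succ, mul_assoc, el_u_mul_v]

/-- The monomial `R(Z) u^i` or `R(Z) v^{-i}`. -/
def mon (q : ℂˣ) (P : ℂ[T;T⁻¹]) (i : ℤ) : ℂ[T;T⁻¹] →ₗ[ℂ] Alg q P :=
  (LinearMap.mulRight ℂ (uv q P i)).comp (laurentHom (zUnit q P)).toLinearMap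

lemma mon_apply (i : ℤ) (R : ℂ[T;T⁻¹]) : mon q P i R = laurentHom (zUnit q P) R * uv q P i := rfl

lemma isHom_mon (i : ℤ) (R : ℂ[T;T⁻¹]) : IsHom q P i (mon q P i R) := by
  have := (isHom_laurentHom (q := q) (P := P) R).mul (isHom_uv i)
  rwa [zero_add] at this

lemma alg_induction {q : ℂ} {p : Alg q P → Prop} (h0 : ∀ c : ℂ, p (algebraMap ℂ _ c))
    (h1 : ∀ g, p (el q P g)) (hm : ∀ a b, p a → p b → p (a * b)) (ha : ∀ a b, p a → p b → p (a + b))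
    (a : Alg q P) : p a := by
  obtain ⟨x, rfl⟩ := RingQuot.mkAlgHom_surjective ℂ (Rel q P) a
  induction x using FreeAlgebra.induction with
  | grade0 r => rw [AlgHom.commutes]; exact h0 r
  | grade1 x => exact h1 x
  | mul a b ha hb => rw [map_mul]; exact hm _ _ ha hb
  | add a b ha' hb => rw [map_add]; exact ha _ _ ha' hb

/-- The span of the monomials contains 1 and is stable under left multiplication by the generators,
hence by the whole algebra. -/
theorem exists_eq_sum_mon (a : Alg q P) :
    ∃ R : ℤ →₀ ℂ[T;T⁻¹], a = R.sum fun i r => mon q P i r := by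
  have hmem : ∀ i R, mon q P i R ∈ LinearMap.range (Finsupp.lsum ℂ fun i => mon q P i) :=
    fun i R => ⟨Finsupp.single i R, by simp⟩
  suffices h : ∀ a : Alg q P, ∀ b ∈ LinearMap.range (Finsupp.lsum ℂ fun i => mon q P i),
      a * b ∈ LinearMap.range (Finsupp.lsum ℂ fun i => mon q P i) by
    obtain ⟨R, hR⟩ := h a 1 (by simpa [mon_apply] using hmem 0 1)
    exact ⟨R, by rw [mul_one] at hR; exact hR.symm⟩
  intro a
  induction a using alg_induction with
  | h0 c => intro b hb; rw [← Algebra.smul_def]; exact Submodule.smul_mem _ c hb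
  | h1 g =>
    rintro _ ⟨R, rfl⟩
    rw [Finsupp.lsum_apply, Finsupp.mul_sum]
    refine Submodule.sum_mem _ fun i _ => ?_
    change el (q : ℂ) P g * mon q P i (R i) ∈ _
    rw [mon_apply]
    have hz : ∀ S : ℂ[T;T⁻¹], laurentHom (zUnit (q : ℂ) P) S *
        (laurentHom (zUnit (q : ℂ) P) (R i) * uv q P i) = mon q P i (S * R i) := fun S => by
      rw [mon_apply, map_mul, mul_assoc]
    cases g with
    | u =>
      rw [← mul_assoc, isHom_u.mul_laurentHom, mul_assoc, u_mul_uv, ← mul_assoc, ← map_mul]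
      exact hmem _ _
    | v =>
      rw [← mul_assoc, isHom_v.mul_laurentHom, mul_assoc, v_mul_uv, ← mul_assoc, ← map_mul]
      exact hmem _ _
    | Z =>
      have := hz (.T 1)
      rw [laurentHom_T_one] at this
      change (zUnit (q : ℂ) P : Alg q P) * _ ∈ _
      rw [this]; exact hmem _ _
    | Zi =>
      have := hz (.T (-1))
      rw [laurentHom_T, zpow_neg_one] at this
      change (((zUnit (q : ℂ) P)⁻¹ : (Alg q P)ˣ) : Alg q P) * _ ∈ _
      rw [this]; exact hmem _ _
  | hm a b ha hb => intro x hx; rw [mul_assoc]; exact ha _ (hb _ hx)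
  | ha a b ha hb => intro x hx; rw [add_mul]; exact Submodule.add_mem _ (ha _ hx) (hb _ hx)

/-! ### A faithful representation -/

/-- Multiplication by Laurent polynomials. -/
def repZ : ℂ[T;T⁻¹] →ₐ[ℂ] Module.End ℂ (ℤ → ℂ[T;T⁻¹]) := Algebra.lsmul ℂ ℂ (ℤ → ℂ[T;T⁻¹])

lemma repZ_apply (R : ℂ[T;T⁻¹]) (F : ℤ → ℂ[T;T⁻¹]) (i : ℤ) : repZ R F i = R * F i := rfl

/-- The action of `u`. -/
def repU (q : ℂˣ) : Module.End ℂ (ℤ → ℂ[T;T⁻¹]) :=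
  -- The model is the algebra of series ∑ F_i(Z) U^i with U invertible and ZU = q²UZ. Here u acts as
  -- U, and v as P(qZ)U⁻¹, which forces uv = P(q⁻¹Z) and vu = P(qZ).
  LinearMap.pi fun i => (scale (q ^ 2)⁻¹).toLinearMap ∘ₗ LinearMap.proj (i - 1)

lemma repU_apply (F : ℤ → ℂ[T;T⁻¹]) (i : ℤ) : repU q F i = scale (q ^ 2)⁻¹ (F (i - 1)) := rfl

/-- The action of `v`. -/
def repV (q : ℂˣ) (P : ℂ[T;T⁻¹]) : Module.End ℂ (ℤ → ℂ[T;T⁻¹]) :=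
  LinearMap.pi fun i => LinearMap.mulLeft ℂ (scale q P) ∘ₗ (scale (q ^ 2)).toLinearMap ∘ₗ
    LinearMap.proj (i + 1)

lemma repV_apply (F : ℤ → ℂ[T;T⁻¹]) (i : ℤ) :
    repV q P F i = scale q P * scale (q ^ 2) (F (i + 1)) := rfl

/-- The action of the generators. -/
def repGen (q : ℂˣ) (P : ℂ[T;T⁻¹]) : Gen → Module.End ℂ (ℤ → ℂ[T;T⁻¹])
  | .u => repU q
  | .v => repV q P
  | .Z => repZ (.T 1)
  | .Zi => repZ (.T (-1))

lemma laurentEval_repZ (c : ℂˣ) (R : ℂ[T;T⁻¹]) :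
    laurentEval ((c : ℂ) • repZ (.T 1)) ((c : ℂ)⁻¹ • repZ (.T (-1))) R = repZ (scale c R) := by
  have h : (c : ℂ) * (c : ℂ)⁻¹ = 1 := mul_inv_cancel₀ c.ne_zero
  have h1 : ((c : ℂ) • .T 1 : ℂ[T;T⁻¹]) * ((c : ℂ)⁻¹ • .T (-1)) = 1 := by
    rw [smul_mul_smul_comm, h, one_smul, ← LaurentPolynomial.T_add, add_neg_cancel,
      LaurentPolynomial.T_zero]
  rw [← map_smul, ← map_smul, ← map_laurentEval, laurentEval_eq h1 (by rw [mul_comm, h1])]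
  congr 1
  have := laurentHom_scale (X := TUnit) (Y := ⟨_, _, h1, by rw [mul_comm, h1]⟩) (c := c) rfl R
  rw [laurentHom_TUnit] at this
  exact this.symm

lemma T_mul_T_neg (R : ℂ[T;T⁻¹]) : (.T 1 : ℂ[T;T⁻¹]) * (.T (-1) * R) = R := by
  rw [← mul_assoc, ← LaurentPolynomial.T_add, add_neg_cancel, LaurentPolynomial.T_zero, one_mul]

lemma T_neg_mul_T (R : ℂ[T;T⁻¹]) : (.T (-1) : ℂ[T;T⁻¹]) * (.T 1 * R) = R := by
  rw [← mul_assoc, ← LaurentPolynomial.T_add, neg_add_cancel, LaurentPolynomial.T_zero, one_mul]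

/-- The representation. -/
def rep (q : ℂˣ) (P : ℂ[T;T⁻¹]) : Alg q P →ₐ[ℂ] Module.End ℂ (ℤ → ℂ[T;T⁻¹]) :=
  RingQuot.liftAlgHom ℂ ⟨FreeAlgebra.lift ℂ (repGen q P), fun x y h => by
    cases h with
    | Z_Zi =>
      refine LinearMap.ext fun F => funext fun i => ?_
      simp [repGen, repZ_apply, T_mul_T_neg, -LaurentPolynomial.T_mul]
    | Zi_Z =>
      refine LinearMap.ext fun F => funext fun i => ?_
      simp [repGen, repZ_apply, T_neg_mul_T, -LaurentPolynomial.T_mul]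
    | Z_u =>
      refine LinearMap.ext fun F => funext fun i => ?_
      simp only [map_mul, map_smul, gen, FreeAlgebra.lift_ι_apply, repGen, Module.End.mul_apply,
        repZ_apply, repU_apply, LinearMap.smul_apply, Pi.smul_apply, scale_T, smul_mul_assoc,
        mul_smul_comm, T_mul_T_neg]
      simp
    | Z_v =>
      refine LinearMap.ext fun F => funext fun i => ?_
      simp only [map_mul, map_smul, gen, FreeAlgebra.lift_ι_apply, repGen, Module.End.mul_apply,
        repZ_apply, repV_apply, LinearMap.smul_apply, Pi.smul_apply, scale_T, smul_mul_assoc,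
        mul_smul_comm]
      rw [mul_left_comm (LaurentPolynomial.T 1 : ℂ[T;T⁻¹]), T_mul_T_neg]
      simp
    | u_v =>
      have := laurentEval_repZ q⁻¹ P
      rw [Units.val_inv_eq_inv_val, inv_inv] at this
      simp only [map_mul, map_smul, gen, FreeAlgebra.lift_ι_apply, map_laurentEval, repGen, this]
      refine LinearMap.ext fun F => funext fun i => ?_
      simp only [Module.End.mul_apply, repZ_apply, repU_apply, repV_apply, map_mul, scale_scale,
        sub_add_cancel, inv_mul_cancel, scale_one]
      congr 3
      rw [sq]; group
    | v_u =>
      simp only [map_mul, map_smul, gen, FreeAlgebra.lift_ι_apply, map_laurentEval, repGen,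
        laurentEval_repZ]
      refine LinearMap.ext fun F => funext fun i => ?_
      simp only [Module.End.mul_apply, repZ_apply, repU_apply, repV_apply, scale_scale,
        add_sub_cancel_right, mul_inv_cancel, scale_one]⟩

lemma rep_el (g : Gen) : rep q P (el q P g) = repGen q P g := by
  rw [rep, el, RingQuot.liftAlgHom_mkAlgHom_apply, FreeAlgebra.lift_ι_apply]

lemma rep_laurentHom (R : ℂ[T;T⁻¹]) : rep q P (laurentHom (zUnit q P) R) = repZ R := by
  rw [map_laurentHom, ← eq_laurentHom repZ]
  exact (rep_el .Z).symm

lemma repU_single (i : ℤ) (S : ℂ[T;T⁻¹]) :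
    repU q (Pi.single i S) = Pi.single (i + 1) (scale (q ^ 2)⁻¹ S) := by
  funext j
  rw [repU_apply]
  by_cases h : j = i + 1
  · subst h; simp
  · rw [Pi.single_eq_of_ne h, Pi.single_eq_of_ne (by omega), map_zero]

lemma repV_single (i : ℤ) (S : ℂ[T;T⁻¹]) :
    repV q P (Pi.single i S) = Pi.single (i - 1) (scale q P * scale (q ^ 2) S) := by
  funext j
  rw [repV_apply]
  by_cases h : j = i - 1
  · subst h; simp
  · rw [Pi.single_eq_of_ne h, Pi.single_eq_of_ne (by omega), map_zero, mul_zero]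

/-- The images of the monomials of degree i sit in the i-th coordinate, multiplied by a fixed
nonzero Laurent polynomial. Hence nonzero monomials stay nonzero, and the degree zero part of an
element can be read off. -/
lemma rep_uv_single (hP : P ≠ 0) (i : ℤ) :
    ∃ S, S ≠ 0 ∧ (i = 0 → S = 1) ∧ rep q P (uv q P i) (Pi.single 0 1) = Pi.single i S := by
  rcases int_cases i with ⟨k, rfl⟩ | ⟨k, rfl⟩
  · refine ⟨1, one_ne_zero, fun _ => rfl, ?_⟩
    rw [uv_natCast]
    induction k with
    | zero => simp
    | succ k ih =>
      rw [pow_succ', map_mul, Module.End.mul_apply, ih, rep_el]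
      simp [repGen, repU_single]
  · suffices h : ∀ k : ℕ, ∃ S, S ≠ 0 ∧
        rep q P (uv q P (-(k : ℕ))) (Pi.single 0 1) = Pi.single (-(k : ℕ) : ℤ) S by
      obtain ⟨S, h1, h2⟩ := h (k + 1)
      exact ⟨S, h1, fun h => by omega, h2⟩
    intro k
    induction k with
    | zero => exact ⟨1, one_ne_zero, by simp⟩
    | succ k ih =>
      obtain ⟨S, hS, h⟩ := ih
      rw [uv_neg_natCast] at h ⊢
      refine ⟨scale q P * scale (q ^ 2) S, mul_ne_zero (scale_ne_zero _ hP) (scale_ne_zero _ hS), ?_⟩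
      rw [pow_succ', map_mul, Module.End.mul_apply, h, rep_el, repGen, repV_single]
      congr 1; push_cast; ring

lemma mon_ne_zero (hP : P ≠ 0) (i : ℤ) {R : ℂ[T;T⁻¹]} (hR : R ≠ 0) : mon q P i R ≠ 0 := by
  intro h
  obtain ⟨S, hS, -, e⟩ := rep_uv_single (q := q) hP i
  have := congrArg (fun a => rep q P a (Pi.single 0 1) i) h
  simp only [mon_apply, map_mul, Module.End.mul_apply, e, rep_laurentHom, repZ_apply, map_zero,
    LinearMap.zero_apply, Pi.zero_apply, Pi.single_eq_same] at this
  exact mul_ne_zero hR hS this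

/-- The degree zero component, as a Laurent polynomial. -/
def comp0 (q : ℂˣ) (P : ℂ[T;T⁻¹]) : Alg q P →ₗ[ℂ] ℂ[T;T⁻¹] :=
  LinearMap.proj 0 ∘ₗ LinearMap.applyₗ (Pi.single 0 1) ∘ₗ (rep q P).toLinearMap

lemma comp0_mon (hP : P ≠ 0) (i : ℤ) (R : ℂ[T;T⁻¹]) :
    comp0 q P (mon q P i R) = if i = 0 then R else 0 := by
  obtain ⟨S, hS, h1, e⟩ := rep_uv_single (q := q) hP i
  change rep q P (mon q P i R) (Pi.single 0 1) 0 = _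
  rw [mon_apply, map_mul, Module.End.mul_apply, e, rep_laurentHom, repZ_apply]
  split_ifs with h
  · subst h; simp [h1 rfl]
  · rw [Pi.single_eq_of_ne (Ne.symm h), mul_zero]

end algebra

/-! ### The automorphisms `g_t` and `ρ` -/

section automorphisms
variable {q : ℂˣ} {P : ℂ[T;T⁻¹]} {t : ℂ} {c : ℝ}

/-- `g_t`, as an algebra homomorphism. -/
def twistHom (q : ℂˣ) (P : ℂ[T;T⁻¹]) (t : ℂˣ) : Alg q P →ₐ[ℂ] Alg q P :=
  RingQuot.liftAlgHom ℂ ⟨FreeAlgebra.lift ℂ fun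
    | .u => (t : ℂ) • el q P .u
    | .v => (t : ℂ)⁻¹ • el q P .v
    | .Z => el q P .Z
    | .Zi => el q P .Zi, fun x y h => by
    have ht : (t : ℂ) * (t : ℂ)⁻¹ = 1 := mul_inv_cancel₀ t.ne_zero
    cases h with
    | Z_Zi => simp [gen, el_Z_mul_Zi]
    | Zi_Z => simp [gen, el_Zi_mul_Z]
    | Z_u =>
      simp only [map_mul, map_smul, gen, FreeAlgebra.lift_ι_apply, mul_smul_comm, smul_mul_assoc,
        el_Z_mul_u]
      rw [smul_comm]
    | Z_v =>
      simp only [map_mul, map_smul, gen, FreeAlgebra.lift_ι_apply, mul_smul_comm, smul_mul_assoc,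
        el_Z_mul_v]
      rw [smul_comm]
    | u_v =>
      have := laurentEval_smul_Z q⁻¹ q P P
      rw [Units.val_inv_eq_inv_val, inv_inv] at this
      simp only [map_mul, map_smul, gen, FreeAlgebra.lift_ι_apply, map_laurentEval, this,
        smul_mul_smul_comm, ht, one_smul, el_u_mul_v]
    | v_u =>
      simp only [map_mul, map_smul, gen, FreeAlgebra.lift_ι_apply, map_laurentEval,
        laurentEval_smul_Z, smul_mul_smul_comm, mul_comm (t : ℂ)⁻¹, ht, one_smul, el_v_mul_u]⟩

lemma twistHom_el (t : ℂˣ) (g : Gen) : twistHom q P t (el q P g) = match g with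
    | .u => (t : ℂ) • el q P .u
    | .v => (t : ℂ)⁻¹ • el q P .v
    | .Z => el q P .Z
    | .Zi => el q P .Zi := by
  have h : twistHom q P t (RingQuot.mkAlgHom ℂ (Rel q P) (gen g)) = _ :=
    RingQuot.liftAlgHom_mkAlgHom_apply ℂ _ _ _
  rw [FreeAlgebra.lift_ι_apply] at h
  exact h

lemma twistHom_twistHom_inv (t : ℂˣ) (a : Alg q P) : twistHom q P t (twistHom q P t⁻¹ a) = a := by
  induction a using alg_induction with
  | h0 c => simp
  | h1 g => cases g <;> simp [twistHom_el, smul_smul]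
  | hm a b ha hb => rw [map_mul, map_mul, ha, hb]
  | ha a b ha hb => rw [map_add, map_add, ha, hb]

lemma exists_isTwist (ht : t ≠ 0) : ∃ g, IsTwist q P t g := by
  refine ⟨AlgEquiv.ofAlgHom (twistHom q P (Units.mk0 t ht)) (twistHom q P (Units.mk0 t ht)⁻¹)
    (AlgHom.ext fun a => twistHom_twistHom_inv _ a) (AlgHom.ext fun a => ?_), ?_, ?_, ?_⟩
  · have := twistHom_twistHom_inv (Units.mk0 t ht)⁻¹ a
    rwa [inv_inv] at this
  · exact twistHom_el _ .u
  · exact twistHom_el _ .v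
  · exact twistHom_el _ .Z

lemma IsTwist.map_laurentHom {g : Alg q P ≃ₐ[ℂ] Alg q P} (hg : IsTwist q P t g) (R : ℂ[T;T⁻¹]) :
    g (laurentHom (zUnit q P) R) = laurentHom (zUnit q P) R := by
  have h : g (laurentHom (zUnit q P) R) = (g : Alg q P →ₐ[ℂ] Alg q P) (laurentHom (zUnit q P) R) := rfl
  rw [h, QWeyl.map_laurentHom]
  congr 1
  exact congrArg _ (Units.ext hg.map_Z)

lemma IsTwist.map_Zi {g : Alg q P ≃ₐ[ℂ] Alg q P} (hg : IsTwist q P t g) :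
    g (el q P .Zi) = el q P .Zi := by
  have := hg.map_laurentHom (.T (-1))
  rwa [laurentHom_T, zpow_neg_one] at this

/-- The conjugate-linear homomorphism from the free algebra with given values at the generators. -/
def conjFree {B : Type*} [Ring B] [Algebra ℂ B] (f : Gen → B) : FreeAlgebra ℂ Gen →+* B :=
  -- With scalars acting on B through conjugation, the conjugate-linear map becomes linear and the
  -- universal property of the free algebra applies.
  letI : Algebra ℂ B := Algebra.compHom B (starRingEnd ℂ)
  (FreeAlgebra.lift ℂ f).toRingHom

lemma conjFree_gen {B : Type*} [Ring B] [Algebra ℂ B] (f : Gen → B) (g : Gen) :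
    conjFree f (gen g) = f g :=
  letI : Algebra ℂ B := Algebra.compHom B (starRingEnd ℂ)
  FreeAlgebra.lift_ι_apply f g

lemma conjFree_smul {B : Type*} [Ring B] [Algebra ℂ B] (f : Gen → B) (a : ℂ) (x : FreeAlgebra ℂ Gen) :
    conjFree f (a • x) = (starRingEnd ℂ) a • conjFree f x :=
  letI : Algebra ℂ B := Algebra.compHom B (starRingEnd ℂ)
  map_smul (FreeAlgebra.lift ℂ f) a x

lemma exp_mul_exp_neg (x : ℂ) : Complex.exp x * Complex.exp (-x) = 1 := by
  rw [← Complex.exp_add, add_neg_cancel, Complex.exp_zero]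

/-- `ρ`, as a homomorphism. -/
def conjHom (q : ℂˣ) (P : ℂ[T;T⁻¹]) (c : ℝ) (hq : (starRingEnd ℂ) (q : ℂ) = q) (hP : starL P = P) :
    Alg q P →+* Alg q P :=
  RingQuot.lift ⟨conjFree fun
    | .u => Complex.exp (-(Real.pi * Complex.I * c)) • el q P .v
    | .v => Complex.exp (Real.pi * Complex.I * c) • el q P .u
    | .Z => el q P .Zi
    | .Zi => el q P .Z, fun x y h => by
    have hZv : el q P .Zi * el q P .v * el q P .Z = (q : ℂ) ^ 2 • el q P .v := by
      have := congrArg (fun a => el q P .Zi * a * el q P .Z) (el_Z_mul_v q P)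
      simp only [mul_smul_comm, smul_mul_assoc] at this
      rw [mul_assoc (el q P .Z), ← mul_assoc (el q P .Zi), el_Zi_mul_Z, one_mul, mul_assoc,
        el_Zi_mul_Z, mul_one] at this
      conv_rhs => rw [this, smul_smul, mul_inv_cancel₀ (pow_ne_zero 2 q.ne_zero), one_smul]
    have hZu : el q P .Zi * el q P .u * el q P .Z = ((q : ℂ) ^ 2)⁻¹ • el q P .u := by
      have := congrArg (fun a => el q P .Zi * a * el q P .Z) (el_Z_mul_u q P)
      simp only [mul_smul_comm, smul_mul_assoc] at this
      rw [mul_assoc (el q P .Z), ← mul_assoc (el q P .Zi), el_Zi_mul_Z, one_mul, mul_assoc,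
        el_Zi_mul_Z, mul_one] at this
      conv_rhs => rw [this, smul_smul, inv_mul_cancel₀ (pow_ne_zero 2 q.ne_zero), one_smul]
    cases h with
    | Z_Zi => simp [conjFree_gen, el_Zi_mul_Z]
    | Zi_Z => simp [conjFree_gen, el_Z_mul_Zi]
    | Z_u =>
      simp only [map_mul, conjFree_smul, conjFree_gen, mul_smul_comm, smul_mul_assoc, hZv, map_pow,
        hq]
      rw [smul_comm]
    | Z_v =>
      simp only [map_mul, conjFree_smul, conjFree_gen, mul_smul_comm, smul_mul_assoc, hZu, map_pow,
        hq, map_inv₀]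
      rw [smul_comm]
    | u_v =>
      have h1 : (q : ℂ)⁻¹ * q = 1 := inv_mul_cancel₀ q.ne_zero
      have h2 : (q : ℂ) * (q : ℂ)⁻¹ = 1 := mul_inv_cancel₀ q.ne_zero
      rw [map_mul, conjFree_gen, conjFree_gen, smul_mul_smul_comm, mul_comm, exp_mul_exp_neg,
        one_smul, el_v_mul_u, map_laurentEval_conj _ (conjFree_smul _)
          (by simp only [conjFree_smul, conjFree_gen, smul_mul_smul_comm, map_inv₀, hq, h1,
            el_Zi_mul_Z, one_smul])
          (by simp only [conjFree_smul, conjFree_gen, smul_mul_smul_comm, map_inv₀, hq, h2,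
            el_Z_mul_Zi, one_smul]), hP]
      refine laurentHom_scale ?_ P
      simp only [conjFree_smul, conjFree_gen, hq]
      rfl
    | v_u =>
      have h1 : (q : ℂ)⁻¹ * q = 1 := inv_mul_cancel₀ q.ne_zero
      have h2 : (q : ℂ) * (q : ℂ)⁻¹ = 1 := mul_inv_cancel₀ q.ne_zero
      rw [map_mul, conjFree_gen, conjFree_gen, smul_mul_smul_comm, exp_mul_exp_neg,
        one_smul, el_u_mul_v, map_laurentEval_conj _ (conjFree_smul _)
          (by simp only [conjFree_smul, conjFree_gen, smul_mul_smul_comm, map_inv₀, hq, h2,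
            el_Zi_mul_Z, one_smul])
          (by simp only [conjFree_smul, conjFree_gen, smul_mul_smul_comm, map_inv₀, hq, h1,
            el_Z_mul_Zi, one_smul]), hP]
      refine laurentHom_scale ?_ P
      simp only [conjFree_smul, conjFree_gen, map_inv₀, hq, Units.val_inv_eq_inv_val]
      rfl⟩

section
variable (hq : (starRingEnd ℂ) (q : ℂ) = q) (hP : starL P = P)

lemma conjHom_mk (x : FreeAlgebra ℂ Gen) :
    conjHom q P c hq hP (RingQuot.mkAlgHom ℂ (Rel q P) x) = conjFree (fun
    | .u => Complex.exp (-(Real.pi * Complex.I * c)) • el q P .v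
    | .v => Complex.exp (Real.pi * Complex.I * c) • el q P .u
    | .Z => el q P .Zi
    | .Zi => el q P .Z) x := by
  have h : RingQuot.mkAlgHom ℂ (Rel q P) x = RingQuot.mkRingHom (Rel q P) x := by
    rw [← RingQuot.mkAlgHom_coe ℂ]; rfl
  rw [h, conjHom, RingQuot.lift_mkRingHom_apply]

lemma conjHom_el (g : Gen) : conjHom q P c hq hP (el q P g) = match g with
    | .u => Complex.exp (-(Real.pi * Complex.I * c)) • el q P .v
    | .v => Complex.exp (Real.pi * Complex.I * c) • el q P .u
    | .Z => el q P .Zi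
    | .Zi => el q P .Z := by
  rw [el, conjHom_mk, conjFree_gen]

lemma conjHom_smul (a : ℂ) (x : Alg q P) :
    conjHom q P c hq hP (a • x) = (starRingEnd ℂ) a • conjHom q P c hq hP x := by
  obtain ⟨y, rfl⟩ := RingQuot.mkAlgHom_surjective ℂ (Rel q P) x
  rw [← map_smul, conjHom_mk, conjHom_mk, conjFree_smul]

lemma conjHom_conjHom (a : Alg q P) : conjHom q P c hq hP (conjHom q P (-c) hq hP a) = a := by
  induction a using alg_induction with
  | h0 c => rw [Algebra.algebraMap_eq_smul_one, conjHom_smul, conjHom_smul]; simp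
  | h1 g =>
    cases g <;> simp only [conjHom_el, conjHom_smul, smul_smul, ← Complex.exp_conj] <;>
    · rw [← Complex.exp_add]
      simp
  | hm a b ha hb => rw [map_mul, map_mul, ha, hb]
  | ha a b ha hb => rw [map_add, map_add, ha, hb]

include hq hP in
lemma exists_isConjugation (c : ℝ) : ∃ ρ, IsConjugation q P c ρ := by
  refine ⟨RingEquiv.ofRingHom (conjHom q P c hq hP) (conjHom q P (-c) hq hP)
    (RingHom.ext fun a => conjHom_conjHom hq hP a) (RingHom.ext fun a => ?_), ?_, ?_, ?_, ?_⟩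
  · have := conjHom_conjHom (c := -c) hq hP a
    rwa [neg_neg] at this
  · exact conjHom_smul hq hP
  · exact conjHom_el hq hP .u
  · exact conjHom_el hq hP .v
  · exact conjHom_el hq hP .Z

end

lemma IsConjugation.map_laurentHom {ρ : Alg q P ≃+* Alg q P} (hρ : IsConjugation q P c ρ)
    (R : ℂ[T;T⁻¹]) : ρ (laurentHom (zUnit q P) R) = laurentHom (zUnit q P) (starL R) := by
  refine map_laurentHom_conj (ρ : Alg q P →+* Alg q P) hρ.map_smul _ _ ?_ R
  ext
  exact hρ.map_Z

lemma IsConjugation.map_Zi {ρ : Alg q P ≃+* Alg q P} (hρ : IsConjugation q P c ρ) :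
    ρ (el q P .Zi) = el q P .Z := by
  have := hρ.map_laurentHom (.T (-1))
  have e := starL_smul_T 1 (-1)
  rw [one_smul, map_one, one_smul, neg_neg] at e
  rwa [laurentHom_T, zpow_neg_one, e, laurentHom_T_one] at this

lemma IsConjugation.isHom {ρ : Alg q P ≃+* Alg q P} (hρ : IsConjugation q P c ρ)
    (hq : (starRingEnd ℂ) (q : ℂ) = q) {i : ℤ} {a : Alg q P} (ha : IsHom q P i a) :
    IsHom q P (-i) (ρ a) := by
  have h := congrArg ρ ha
  rw [map_mul, map_mul, hρ.map_Z, hρ.map_Zi, hρ.map_smul, map_zpow₀, hq] at h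
  have h2 := congrArg (fun x => el q P .Z * x * el q P .Zi) h
  simp only [mul_smul_comm, smul_mul_assoc] at h2
  rw [mul_assoc (el q P .Zi), ← mul_assoc (el q P .Z), el_Z_mul_Zi, one_mul, mul_assoc,
    el_Z_mul_Zi, mul_one] at h2
  have e : (q : ℂ) ^ (2 * -i) * (q : ℂ) ^ (2 * i) = 1 := by
    rw [← zpow_add₀ q.ne_zero]; simp
  rw [IsHom]
  conv_rhs => rw [h2, smul_smul, e, one_smul]

lemma IsConjugation.sq_u {ρ : Alg q P ≃+* Alg q P} (hρ : IsConjugation q P c ρ) :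
    ρ (ρ (el q P .u)) = Complex.exp (2 * Real.pi * I * c) • el q P .u := by
  rw [hρ.map_u, hρ.map_smul, hρ.map_v, smul_smul, ← Complex.exp_conj, ← Complex.exp_add]
  congr 2; simp; ring

lemma IsConjugation.sq_v {ρ : Alg q P ≃+* Alg q P} (hρ : IsConjugation q P c ρ) :
    ρ (ρ (el q P .v)) = (Complex.exp (2 * Real.pi * I * c))⁻¹ • el q P .v := by
  rw [hρ.map_v, hρ.map_smul, hρ.map_u, smul_smul, ← Complex.exp_conj, ← Complex.exp_add,
    ← Complex.exp_neg]
  congr 2; simp; ring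

end automorphisms

/-! ### Traces and linear functionals on Laurent polynomials -/

section traces
variable {q : ℂˣ} {P : ℂ[T;T⁻¹]} {t : ℂ} {c : ℝ}

/-- The linear map that is `L` in degree zero and vanishes in the other degrees. -/
def traceOf (q : ℂˣ) (P : ℂ[T;T⁻¹]) (L : ℂ[T;T⁻¹] →ₗ[ℂ] ℂ) : Alg q P →ₗ[ℂ] ℂ := L ∘ₗ comp0 q P

/-- The condition on the degree zero part of a twisted trace. -/
def IsTwFun (q : ℂˣ) (P : ℂ[T;T⁻¹]) (t : ℂ) (L : ℂ[T;T⁻¹] →ₗ[ℂ] ℂ) : Prop :=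
  ∀ M, L (scale q⁻¹ (P * M)) = t * L (scale q (P * M))

lemma traceOf_mon (hP : P ≠ 0) (L : ℂ[T;T⁻¹] →ₗ[ℂ] ℂ) (i : ℤ) (R : ℂ[T;T⁻¹]) :
    traceOf q P L (mon q P i R) = if i = 0 then L R else 0 := by
  rw [traceOf, LinearMap.comp_apply, comp0_mon hP]
  split_ifs <;> simp

lemma traceOf_laurentHom (hP : P ≠ 0) (L : ℂ[T;T⁻¹] →ₗ[ℂ] ℂ) (R : ℂ[T;T⁻¹]) :
    traceOf q P L (laurentHom (zUnit q P) R) = L R := by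
  have := traceOf_mon (q := q) hP L 0 R
  simpa [mon_apply] using this

lemma laurentHom_mul_mon (i : ℤ) (R S : ℂ[T;T⁻¹]) :
    laurentHom (zUnit q P) S * mon q P i R = mon q P i (S * R) := by
  rw [mon_apply, mon_apply, map_mul, mul_assoc]

lemma mon_mul_laurentHom (i : ℤ) (R S : ℂ[T;T⁻¹]) :
    mon q P i R * laurentHom (zUnit q P) S = mon q P i (R * scale (q ^ (2 * i))⁻¹ S) := by
  rw [mon_apply, mon_apply, map_mul, mul_assoc, (isHom_uv i).mul_laurentHom, mul_assoc]

lemma u_mul_mon (i : ℤ) (R : ℂ[T;T⁻¹]) : el q P .u * mon q P i R =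
    mon q P (i + 1) (scale (q ^ 2)⁻¹ R * if 0 ≤ i then 1 else scale q⁻¹ P) := by
  rw [mon_apply, ← mul_assoc, isHom_u.mul_laurentHom, mul_assoc, u_mul_uv, ← mul_assoc, ← map_mul,
    mon_apply]
  rfl

lemma v_mul_mon (i : ℤ) (R : ℂ[T;T⁻¹]) : el q P .v * mon q P i R =
    mon q P (i - 1) (scale (q ^ 2) R * if i ≤ 0 then 1 else scale q P) := by
  rw [mon_apply, ← mul_assoc, isHom_v.mul_laurentHom, mul_assoc, v_mul_uv, ← mul_assoc, ← map_mul,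
    mon_apply]
  simp

lemma mon_mul_u (i : ℤ) (R : ℂ[T;T⁻¹]) : ∃ D, (P ≠ 0 → D ≠ 0) ∧ (i = -1 → D = scale q P) ∧
    mon q P i R * el q P .u = mon q P (i + 1) (R * D) := by
  obtain ⟨D, h1, h2, h3⟩ := uv_mul_u q P i
  exact ⟨D, h1, h2, by rw [mon_apply, mul_assoc, h3, ← mul_assoc, ← map_mul, mon_apply]⟩

lemma mon_mul_v (i : ℤ) (R : ℂ[T;T⁻¹]) : ∃ D, (P ≠ 0 → D ≠ 0) ∧ (i = 1 → D = scale q⁻¹ P) ∧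
    mon q P i R * el q P .v = mon q P (i - 1) (R * D) := by
  obtain ⟨D, h1, h2, h3⟩ := uv_mul_v q P i
  exact ⟨D, h1, h2, by rw [mon_apply, mul_assoc, h3, ← mul_assoc, ← map_mul, mon_apply]⟩

lemma u_commutes (hP : P ≠ 0) {L : ℂ[T;T⁻¹] →ₗ[ℂ] ℂ} (hL : IsTwFun q P t L) (i : ℤ)
    (R : ℂ[T;T⁻¹]) : traceOf q P L (el q P .u * mon q P i R) =
      t * traceOf q P L (mon q P i R * el q P .u) := by
  obtain ⟨D, -, hD, e⟩ := mon_mul_u (q := q) (P := P) i R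
  rw [e, u_mul_mon, traceOf_mon hP, traceOf_mon hP]
  by_cases h : i + 1 = 0
  · rw [if_pos h, if_pos h, if_neg (by omega), hD (by omega)]
    have h2 : (q ^ 2)⁻¹ = q⁻¹ * q⁻¹ := by rw [sq, mul_inv]
    have := hL (scale q⁻¹ R)
    rw [map_mul (scale q⁻¹), map_mul (scale q), scale_scale, scale_scale, mul_inv_cancel, scale_one] at this
    rw [mul_comm R, ← this, mul_comm, h2]
  · rw [if_neg h, if_neg h, mul_zero]

lemma v_commutes (hP : P ≠ 0) {L : ℂ[T;T⁻¹] →ₗ[ℂ] ℂ} (hL : IsTwFun q P t L) (i : ℤ)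
    (R : ℂ[T;T⁻¹]) : t * traceOf q P L (el q P .v * mon q P i R) =
      traceOf q P L (mon q P i R * el q P .v) := by
  obtain ⟨D, -, hD, e⟩ := mon_mul_v (q := q) (P := P) i R
  rw [e, v_mul_mon, traceOf_mon hP, traceOf_mon hP]
  by_cases h : i - 1 = 0
  · rw [if_pos h, if_pos h, if_neg (by omega), hD (by omega)]
    have := hL (scale q R)
    rw [map_mul (scale q⁻¹), map_mul (scale q), scale_scale, scale_scale, inv_mul_cancel, scale_one] at this
    rw [mul_comm R, this, mul_comm (scale q P), sq]
  · rw [if_neg h, if_neg h, mul_zero]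

lemma laurentHom_commutes (hP : P ≠ 0) (L : ℂ[T;T⁻¹] →ₗ[ℂ] ℂ) (i : ℤ) (R S : ℂ[T;T⁻¹]) :
    traceOf q P L (laurentHom (zUnit q P) S * mon q P i R) =
      traceOf q P L (mon q P i R * laurentHom (zUnit q P) S) := by
  rw [laurentHom_mul_mon, mon_mul_laurentHom, traceOf_mon hP, traceOf_mon hP]
  by_cases h : i = 0
  · subst h; rw [mul_zero, zpow_zero, inv_one, scale_one, mul_comm]
  · rw [if_neg h, if_neg h]

/-- The identity T(ab) = T(b g(a)) for all b is stable under sums and products in a, so it need only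
be checked for a generator a and a monomial b. The condition on L enters only when a and b have
degrees 1 and -1, in either order. -/
lemma isTwistedTrace_traceOf (hP : P ≠ 0) (ht : t ≠ 0) {L : ℂ[T;T⁻¹] →ₗ[ℂ] ℂ}
    (hL : IsTwFun q P t L) : IsTwistedTrace q P t (traceOf q P L) := by
  obtain ⟨g, hg⟩ := exists_isTwist (q := q) (P := P) ht
  refine ⟨g, hg, fun a => ?_⟩
  have key : ∀ a, (∀ i R, traceOf q P L (a * mon q P i R) = traceOf q P L (mon q P i R * g a)) →
      ∀ b, traceOf q P L (a * b) = traceOf q P L (b * g a) := fun a h b => by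
    obtain ⟨R, rfl⟩ := exists_eq_sum_mon b
    simp only [Finsupp.sum, Finset.mul_sum, Finset.sum_mul, map_sum]
    exact Finset.sum_congr rfl fun i _ => h i _
  induction a using alg_induction with
  | h0 c =>
    intro b
    rw [AlgEquiv.commutes, Algebra.commutes]
  | h1 x =>
    refine key _ fun i R => ?_
    cases x with
    | u => rw [hg.map_u, mul_smul_comm, map_smul, smul_eq_mul, u_commutes hP hL]
    | v =>
      rw [hg.map_v, mul_smul_comm, map_smul, smul_eq_mul, ← v_commutes hP hL,
        inv_mul_cancel_left₀ ht]
    | Z =>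
      have := laurentHom_commutes (q := q) hP L i R (.T 1)
      rw [laurentHom_T_one] at this
      rw [hg.map_Z]
      exact this
    | Zi =>
      have := laurentHom_commutes (q := q) hP L i R (.T (-1))
      rw [laurentHom_T, zpow_neg_one] at this
      rw [hg.map_Zi]
      exact this
  | hm a b ha hb => intro x; rw [mul_assoc, ha, mul_assoc, hb, map_mul g, mul_assoc]
  | ha a b ha hb => intro x; rw [add_mul, map_add, ha, hb, map_add g, mul_add, map_add]

/-- Since Z is fixed by the twist, T(ZaZ⁻¹) = T(a), whereas the left side is q^{2i} T(a). -/
lemma IsTwistedTrace.eq_zero {T : Alg q P →ₗ[ℂ] ℂ} (hT : IsTwistedTrace q P t T)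
    {i : ℤ} (hi : (q : ℂ) ^ (2 * i) ≠ 1) {a : Alg q P} (ha : IsHom q P i a) : T a = 0 := by
  obtain ⟨g, hg, h⟩ := hT
  have h1 := h (el q P .Z) (a * el q P .Zi)
  rw [hg.map_Z, mul_assoc, el_Zi_mul_Z, mul_one, ← mul_assoc, ha, map_smul, smul_eq_mul] at h1
  have : ((q : ℂ) ^ (2 * i) - 1) * T a = 0 := by linear_combination h1
  exact (mul_eq_zero.1 this).resolve_left (sub_ne_zero.2 hi)

lemma IsTwistedTrace.eq_traceOf (hP : P ≠ 0) (hq : ∀ i : ℤ, i ≠ 0 → (q : ℂ) ^ (2 * i) ≠ 1)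
    {T : Alg q P →ₗ[ℂ] ℂ} (hT : IsTwistedTrace q P t T) :
    T = traceOf q P (T ∘ₗ (laurentHom (zUnit q P)).toLinearMap) := by
  refine LinearMap.ext fun a => ?_
  obtain ⟨R, rfl⟩ := exists_eq_sum_mon a
  simp only [Finsupp.sum, map_sum]
  refine Finset.sum_congr rfl fun i _ => ?_
  rw [traceOf_mon hP]
  split_ifs with h
  · subst h; simp [mon_apply]
  · exact hT.eq_zero (hq i h) (isHom_mon i _)

/-- This is the trace property for u and M(qZ)v: moving Z past u turns M(qZ) into M(q⁻¹Z), next to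
uv = P(q⁻¹Z), while the other order gives vu = P(qZ). -/
lemma IsTwistedTrace.isTwFun {T : Alg q P →ₗ[ℂ] ℂ} (hT : IsTwistedTrace q P t T) :
    IsTwFun q P t (T ∘ₗ (laurentHom (zUnit q P)).toLinearMap) := fun M => by
  obtain ⟨g, hg, h⟩ := hT
  have h1 := h (el q P .u) (laurentHom (zUnit q P) (scale q M) * el q P .v)
  rw [hg.map_u, ← mul_assoc, isHom_u.mul_laurentHom, mul_assoc, el_u_mul_v, mul_smul_comm,
    mul_assoc, el_v_mul_u, ← map_mul, ← map_mul, map_smul, scale_scale, mul_comm _ (scale q⁻¹ P),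
    mul_comm _ (scale q P), ← map_mul] at h1
  have e : (q ^ (2 * 1 : ℤ))⁻¹ * q = q⁻¹ := by
    rw [mul_one, zpow_ofNat, sq]; simp
  rw [e, ← map_mul] at h1
  exact h1

/-! ### Positivity -/

/-- The factor x is moved cyclically to the end, where it becomes g(x) = ρ(ρ(x)). For x = u and b of
degree i, this exchanges degree i+1 for degree i-1. -/
lemma trace_mul_conj_shift {T : Alg q P →ₗ[ℂ] ℂ} {g : Alg q P ≃ₐ[ℂ] Alg q P}
    (h : ∀ a b, T (a * b) = T (b * g a)) (ρ : Alg q P ≃+* Alg q P) {x : Alg q P}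
    (hx : ρ (ρ x) = g x) (b : Alg q P) :
    T (x * b * ρ (x * b)) = T (b * ρ x * ρ (b * ρ x)) := by
  rw [map_mul ρ, map_mul ρ, hx, mul_assoc, h]
  simp only [mul_assoc]

lemma IsConjugation.smul_mul {ρ : Alg q P ≃+* Alg q P} (hρ : IsConjugation q P c ρ)
    (T : Alg q P →ₗ[ℂ] ℂ) {e : ℂ} (he : ‖e‖ = 1) (a : Alg q P) :
    T (e • a * ρ (e • a)) = T (a * ρ a) := by
  rw [hρ.map_smul, smul_mul_smul_comm, Complex.mul_conj, Complex.normSq_eq_norm_sq, he]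
  simp

lemma mon_one_mul_conj {ρ : Alg q P ≃+* Alg q P} (hρ : IsConjugation q P c ρ) (R : ℂ[T;T⁻¹]) :
    mon q P 1 R * ρ (mon q P 1 R) = Complex.exp (-(Real.pi * I * c)) •
      laurentHom (zUnit q P) (R * scale (q ^ 2)⁻¹ (starL R) * scale q⁻¹ P) := by
  have e : mon q P 1 R = laurentHom (zUnit q P) R * el q P .u := by
    have := uv_natCast (q := q) (P := P) 1
    rw [mon_apply]
    rw [Nat.cast_one, pow_one] at this
    rw [this]
  rw [e, map_mul, hρ.map_laurentHom, hρ.map_u, mul_smul_comm, mul_smul_comm,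
    mul_assoc (laurentHom (zUnit (q : ℂ) P) R), ← mul_assoc (el q P .u), isHom_u.mul_laurentHom, mul_assoc _ _ (el q P .v), el_u_mul_v,
    map_mul (laurentHom _), map_mul (laurentHom _), ← mul_assoc]
  rfl

/-- Degrees are orthogonal, and the cyclic shift reduces each degree to one two steps nearer to {0,
1}. The two conditions are positivity on R(Z) and on R(Z)u, where uρ(u) = e^{-πic} uv. -/
theorem isPositive_traceOf_iff (hP : P ≠ 0) (hPs : starL P = P) (hq : (starRingEnd ℂ) (q : ℂ) = q)
    {L : ℂ[T;T⁻¹] →ₗ[ℂ] ℂ} (hq1 : ∀ i : ℤ, i ≠ 0 → (q : ℂ) ^ (2 * i) ≠ 1)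
    (hL : IsTwistedTrace q P (Complex.exp (2 * Real.pi * I * c)) (traceOf q P L)) :
    IsPositive q P c (traceOf q P L) ↔ (∀ R ≠ 0, 0 < L (R * starL R)) ∧
      ∀ R ≠ 0, 0 < Complex.exp (-(Real.pi * I * c)) *
        L (R * scale (q ^ 2)⁻¹ (starL R) * scale q⁻¹ P) := by
  have e0 : ∀ ρ, IsConjugation q P c ρ → ∀ R,
      traceOf q P L (mon q P 0 R * ρ (mon q P 0 R)) = L (R * starL R) := fun ρ hρ R => by
    rw [mon_apply, uv_zero, mul_one, hρ.map_laurentHom, ← map_mul, traceOf_laurentHom hP]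
  have e1 : ∀ ρ, IsConjugation q P c ρ → ∀ R,
      traceOf q P L (mon q P 1 R * ρ (mon q P 1 R)) = Complex.exp (-(Real.pi * I * c)) *
        L (R * scale (q ^ 2)⁻¹ (starL R) * scale q⁻¹ P) := fun ρ hρ R => by
    rw [mon_one_mul_conj hρ, map_smul, traceOf_laurentHom hP, smul_eq_mul]
  constructor
  · rintro ⟨ρ, hρ, hpos⟩
    exact ⟨fun R hR => e0 ρ hρ R ▸ hpos _ (mon_ne_zero hP 0 hR),
      fun R hR => e1 ρ hρ R ▸ hpos _ (mon_ne_zero hP 1 hR)⟩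
  · rintro ⟨h0, h1⟩
    obtain ⟨ρ, hρ⟩ := exists_isConjugation hq hPs c
    refine ⟨ρ, hρ, fun a ha => ?_⟩
    obtain ⟨g, hg, hT⟩ := id hL
    have hexp : ∀ x : ℝ, ‖Complex.exp (Real.pi * I * x)‖ = 1 := fun x => by
      rw [show (Real.pi * I * x : ℂ) = ((Real.pi * x : ℝ) : ℂ) * I by push_cast; ring]
      exact Complex.norm_exp_ofReal_mul_I _
    have hexp' : ‖Complex.exp (-(Real.pi * I * c))‖ = 1 := by
      have := hexp (-c); push_cast at this; rwa [mul_neg] at this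
    -- For i ≥ 0 every monomial of degree i+1 is u times one of degree i. The shift turns it, up to
    -- a unimodular scalar, into a nonzero monomial of degree i-1.
    have up : ∀ i : ℤ, 0 ≤ i →
        (∀ R ≠ 0, 0 < traceOf q P L (mon q P (i - 1) R * ρ (mon q P (i - 1) R))) →
        ∀ R ≠ 0, 0 < traceOf q P L (mon q P (i + 1) R * ρ (mon q P (i + 1) R)) := by
      intro i hi h R hR
      obtain ⟨R', rfl⟩ := scale_surjective (q ^ 2)⁻¹ R
      have hR' : R' ≠ 0 := fun h => hR (by rw [h, map_zero])
      have e : mon q P (i + 1) (scale (q ^ 2)⁻¹ R') = el q P .u * mon q P i R' := by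
        rw [u_mul_mon, if_pos hi, mul_one]
      obtain ⟨D, hD, -, eD⟩ := mon_mul_v (q := q) (P := P) i R'
      rw [e, trace_mul_conj_shift hT ρ (by rw [hρ.sq_u, hg.map_u]), hρ.map_u, mul_smul_comm,
        hρ.smul_mul _ hexp', eD]
      exact h _ (mul_ne_zero hR' (hD hP))
    have down : ∀ i : ℤ, i ≤ 0 →
        (∀ R ≠ 0, 0 < traceOf q P L (mon q P (i + 1) R * ρ (mon q P (i + 1) R))) →
        ∀ R ≠ 0, 0 < traceOf q P L (mon q P (i - 1) R * ρ (mon q P (i - 1) R)) := by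
      intro i hi h R hR
      obtain ⟨R', rfl⟩ := scale_surjective (q ^ 2) R
      have hR' : R' ≠ 0 := fun h => hR (by rw [h, map_zero])
      have e : mon q P (i - 1) (scale (q ^ 2) R') = el q P .v * mon q P i R' := by
        rw [v_mul_mon, if_pos hi, mul_one]
      obtain ⟨D, hD, -, eD⟩ := mon_mul_u (q := q) (P := P) i R'
      rw [e, trace_mul_conj_shift hT ρ (by rw [hρ.sq_v, hg.map_v]), hρ.map_v, mul_smul_comm,
        hρ.smul_mul _ (hexp c), eD]
      exact h _ (mul_ne_zero hR' (hD hP))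
    have p0 : ∀ R ≠ 0, 0 < traceOf q P L (mon q P 0 R * ρ (mon q P 0 R)) :=
      fun R hR => by rw [e0 ρ hρ]; exact h0 R hR
    have p1 : ∀ R ≠ 0, 0 < traceOf q P L (mon q P 1 R * ρ (mon q P 1 R)) :=
      fun R hR => by rw [e1 ρ hρ]; exact h1 R hR
    have hup : ∀ k : ℕ, (∀ R ≠ 0, 0 < traceOf q P L (mon q P k R * ρ (mon q P k R))) ∧
        ∀ R ≠ 0, 0 < traceOf q P L (mon q P (k + 1) R * ρ (mon q P (k + 1) R)) := by
      intro k
      induction k with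
      | zero => exact ⟨p0, by simpa using p1⟩
      | succ k ih =>
        refine ⟨by exact_mod_cast ih.2, up _ (by omega) ?_⟩
        simpa using ih.1
    have hdown : ∀ k : ℕ, (∀ R ≠ 0, 0 < traceOf q P L (mon q P (-k) R * ρ (mon q P (-k) R))) ∧
        ∀ R ≠ 0, 0 < traceOf q P L (mon q P (-k + 1) R * ρ (mon q P (-k + 1) R)) := by
      intro k
      induction k with
      | zero => exact ⟨by simpa using p0, by simpa using p1⟩
      | succ k ih =>
        have e : -((k + 1 : ℕ) : ℤ) = -k - 1 := by push_cast; ring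
        rw [e, sub_add_cancel]
        exact ⟨down _ (by omega) ih.2, ih.1⟩
    have hall : ∀ i : ℤ, ∀ R ≠ 0, 0 < traceOf q P L (mon q P i R * ρ (mon q P i R)) := fun i => by
      rcases int_cases i with ⟨k, rfl⟩ | ⟨k, rfl⟩
      · exact (hup k).1
      · exact (hdown (k + 1)).1
    obtain ⟨R, rfl⟩ := exists_eq_sum_mon a
    -- ρ reverses the degree, so the product of the j-th component with ρ of the i-th has degree j -
    -- i, and its trace vanishes unless j = i.
    have hdiag : traceOf q P L ((R.sum fun i r => mon q P i r) * ρ (R.sum fun i r => mon q P i r)) =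
        ∑ i ∈ R.support, traceOf q P L (mon q P i (R i) * ρ (mon q P i (R i))) := by
      simp only [Finsupp.sum, map_sum, Finset.sum_mul, Finset.mul_sum]
      refine Finset.sum_congr rfl fun i hi => ?_
      rw [Finset.sum_eq_single i]
      · intro j _ hji
        have hne : j + -i ≠ 0 := fun h => hji (by omega)
        exact hL.eq_zero (hq1 _ hne) ((isHom_mon j _).mul (hρ.isHom hq (isHom_mon i _)))
      · intro h; exact absurd hi h
    rw [hdiag]
    refine Finset.sum_pos (fun i hi => hall i _ (Finsupp.mem_support_iff.1 hi)) ?_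
    rw [Finset.nonempty_iff_ne_empty, Ne, Finsupp.support_eq_empty]
    rintro rfl
    simp at ha

end traces

/-! ### Factorization of a Laurent polynomial that is real on the circle -/

section factorization
variable {P : ℂ[T;T⁻¹]}

lemma exists_toLaurent_eq (P : ℂ[T;T⁻¹]) :
    ∃ f : Polynomial ℂ, Polynomial.toLaurent f = .T (P.coeff.support.sup Int.natAbs : ℕ) * P := by
  set M := P.coeff.support.sup Int.natAbs
  refine ⟨∑ k ∈ P.coeff.support, Polynomial.C (P.coeff k) * Polynomial.X ^ (M + k).toNat, ?_⟩
  conv_rhs => rw [← AddMonoidAlgebra.sum_coeff_single P]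
  rw [map_sum, Finsupp.sum, Finset.mul_sum]
  refine Finset.sum_congr rfl fun k hk => ?_
  have h : k.natAbs ≤ M := Finset.le_sup (f := Int.natAbs) hk
  rw [Polynomial.toLaurent_C_mul_X_pow, LaurentPolynomial.single_eq_C_mul_T, mul_left_comm,
    ← LaurentPolynomial.T_add, Int.toNat_of_nonneg (by omega)]

lemma prod_X_sub_C_ne_zero (S : Multiset ℂ) :
    (S.map fun a => Polynomial.X - Polynomial.C a).prod ≠ 0 :=
  (Polynomial.monic_multisetProd_X_sub_C S).ne_zero

lemma exists_evalAt_eq_prod (hP : P ≠ 0) : ∃ (p : ℂ) (N : ℤ), p ≠ 0 ∧ ∀ z, z ≠ 0 →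
    evalAt P z = p * z ^ N * ((nonzeroRoots P).map fun a => z - a).prod := by
  obtain ⟨f, hf⟩ := exists_toLaurent_eq P
  have hf0 : f ≠ 0 := by
    rintro rfl
    rw [map_zero] at hf
    refine hP ?_
    have := congrArg (.T (-(P.coeff.support.sup Int.natAbs : ℕ) : ℤ) * ·) hf
    simp only [mul_zero] at this
    rw [← mul_assoc, ← LaurentPolynomial.T_add, neg_add_cancel, LaurentPolynomial.T_zero,
      one_mul] at this
    exact this.symm
  have hr : nonzeroRoots P = f.roots.filter (· ≠ 0) := by
    rw [nonzeroRoots, ← hf, Polynomial.trunc_toLaurent]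
  have hs : f.roots = f.roots.filter (· ≠ 0) + Multiset.replicate (f.roots.count 0) 0 := by
    rw [← Multiset.filter_eq', add_comm]
    exact (Multiset.filter_add_not _ _).symm
  refine ⟨f.leadingCoeff, f.roots.count 0 - (P.coeff.support.sup Int.natAbs : ℕ),
    Polynomial.leadingCoeff_ne_zero.2 hf0, fun z hz => ?_⟩
  have e : f.eval z = f.leadingCoeff * (z ^ f.roots.count 0 *
      ((nonzeroRoots P).map fun a => z - a).prod) := by
    conv_lhs => rw [(IsAlgClosed.splits f).eq_prod_roots, hs]
    rw [Multiset.map_add, Multiset.prod_add, Multiset.map_replicate, Multiset.prod_replicate,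
      Polynomial.eval_mul, Polynomial.eval_mul, Polynomial.eval_multiset_prod, Multiset.map_map, hr]
    simp [mul_comm]
  rw [← evalAt_toLaurent hz, hf, evalAt_mul hz, evalAt_T hz, zpow_natCast] at e
  have hM : z ^ (P.coeff.support.sup Int.natAbs) ≠ 0 := pow_ne_zero _ hz
  rw [zpow_sub₀ hz, zpow_natCast, zpow_natCast]
  field_simp
  linear_combination e

/-- A power of z clears the negative exponents; the roots of the resulting polynomials, with 0 set
aside, are S and S', and counting them compares the exponents. -/
lemma eq_of_prod_eq {S S' : Multiset ℂ} (h0 : 0 ∉ S) (h0' : 0 ∉ S') {p p' : ℂ} (hp : p ≠ 0)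
    (hp' : p' ≠ 0) {a b : ℤ} (h : ∀ z, z ≠ 0 → p * z ^ a * (S.map fun x => z - x).prod =
      p' * z ^ b * (S'.map fun x => z - x).prod) : S = S' ∧ a = b := by
  set k := a.natAbs + b.natAbs with hk
  obtain ⟨a', ha'⟩ := Int.eq_ofNat_of_zero_le (show 0 ≤ a + k by omega)
  obtain ⟨b', hb'⟩ := Int.eq_ofNat_of_zero_le (show 0 ≤ b + k by omega)
  have hpoly : Polynomial.C p * (Polynomial.X ^ a' *
      (S.map fun x => Polynomial.X - Polynomial.C x).prod) = Polynomial.C p' * (Polynomial.X ^ b' *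
      (S'.map fun x => Polynomial.X - Polynomial.C x).prod) := by
    refine Polynomial.eq_of_infinite_eval_eq _ _ (Set.Infinite.mono (s := {0}ᶜ) (fun z hz => ?_)
      (Set.finite_singleton 0).infinite_compl)
    have hz : z ≠ 0 := hz
    have e := congrArg (z ^ (k : ℤ) * ·) (h z hz)
    have e1 : z ^ a' = z ^ (k : ℤ) * z ^ a := by
      rw [← zpow_natCast z a', ← zpow_add₀ hz]; congr 1; omega
    have e2 : z ^ b' = z ^ (k : ℤ) * z ^ b := by
      rw [← zpow_natCast z b', ← zpow_add₀ hz]; congr 1; omega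
    simp only [Set.mem_ofPred_eq, Polynomial.eval_mul, Polynomial.eval_C, Polynomial.eval_pow,
      Polynomial.eval_X, Polynomial.eval_multiset_prod, Multiset.map_map, Function.comp_apply,
      Polynomial.eval_sub, e1, e2]
    linear_combination e
  have hroots : ∀ (p : ℂ) (a : ℕ) (S : Multiset ℂ), p ≠ 0 → (Polynomial.C p * (Polynomial.X ^ a *
      (S.map fun x => Polynomial.X - Polynomial.C x).prod)).roots =
      Multiset.replicate a 0 + S := fun p a S hp => by
    rw [Polynomial.roots_C_mul _ hp, Polynomial.roots_mul, Polynomial.roots_X_pow,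
      Polynomial.roots_multiset_prod_X_sub_C, Multiset.nsmul_singleton]
    exact mul_ne_zero (pow_ne_zero _ Polynomial.X_ne_zero) (prod_X_sub_C_ne_zero S)
  have e := congrArg Polynomial.roots hpoly
  rw [hroots p a' S hp, hroots p' b' S' hp'] at e
  have hfil : ∀ (a : ℕ) (S : Multiset ℂ), 0 ∉ S →
      (Multiset.replicate a 0 + S).filter (· ≠ 0) = S := fun a S hS => by
    have h1 : ∀ x ∈ S, x ≠ 0 := fun x hx h => hS (h ▸ hx)
    rw [Multiset.filter_add, Multiset.filter_eq_self.2 h1, Multiset.filter_eq_nil.2 fun x hx => by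
      simp [Multiset.eq_of_mem_replicate hx], zero_add]
  have hS : S = S' := by rw [← hfil a' S h0, e, hfil b' S' h0']
  refine ⟨hS, ?_⟩
  have hc := congrArg Multiset.card e
  rw [hS] at hc
  simp only [Multiset.card_add, Multiset.card_replicate] at hc
  omega

lemma zero_notMem_nonzeroRoots (P : ℂ[T;T⁻¹]) : 0 ∉ nonzeroRoots P := by simp [nonzeroRoots]

/-- P equals its reflection z ↦ conj(P(1/conj z)). Uniqueness of the factorization makes the roots
invariant under a ↦ 1/ā, and comparing exponents of z shows that their number is even. -/
lemma exists_symmetric_factorization (hP : P ≠ 0) (hs : starL P = P) :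
    ∃ (p : ℂ) (N : ℤ), p ≠ 0 ∧ ((nonzeroRoots P).card : ℤ) = 2 * N ∧
      (nonzeroRoots P).map (fun a => ((starRingEnd ℂ) a)⁻¹) = nonzeroRoots P ∧
      ∀ z, z ≠ 0 → evalAt P z = p * z ^ (-N) * ((nonzeroRoots P).map fun a => z - a).prod := by
  obtain ⟨p, N, hp, h⟩ := exists_evalAt_eq_prod hP
  have h00 := zero_notMem_nonzeroRoots P
  set S := nonzeroRoots P with hS
  have h2 : ∀ z : ℂ, z ≠ 0 → p * z ^ N * (S.map fun x => z - x).prod =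
      ((starRingEnd ℂ) p * (S.map fun a => -(starRingEnd ℂ) a).prod) * z ^ (-N - (S.card : ℤ)) *
        ((S.map fun a => ((starRingEnd ℂ) a)⁻¹).map fun x => z - x).prod := fun z hz => by
    have hz' : ((starRingEnd ℂ) z)⁻¹ ≠ 0 := by simpa using hz
    rw [← h z hz]
    conv_lhs => rw [← hs]
    rw [evalAt_starL hz, h _ hz', map_mul, map_mul, map_zpow₀, map_inv₀, starRingEnd_self_apply,
      map_multiset_prod, Multiset.map_map, Multiset.map_map]
    have e : (S.map ((starRingEnd ℂ) ∘ fun a => ((starRingEnd ℂ) z)⁻¹ - a)).prod =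
        (S.map fun a => -(starRingEnd ℂ) a).prod * z ^ (-(S.card : ℤ)) *
          (S.map ((fun x => z - x) ∘ fun a => ((starRingEnd ℂ) a)⁻¹)).prod := by
      rw [zpow_neg, zpow_natCast, ← inv_pow, ← Multiset.prod_replicate, ← Multiset.map_const',
        ← Multiset.prod_map_mul, ← Multiset.prod_map_mul]
      refine congrArg _ (Multiset.map_congr rfl fun a ha => ?_)
      have ha0 : (starRingEnd ℂ) a ≠ 0 := fun h => h00 (by
        rwa [(map_eq_zero _).1 h] at ha)
      simp only [Function.comp_apply, map_sub, map_inv₀, starRingEnd_self_apply]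
      field_simp
      ring
    rw [e, inv_zpow', sub_eq_add_neg, zpow_add₀ hz]
    ring
  have hp' : (starRingEnd ℂ) p * (S.map fun a => -(starRingEnd ℂ) a).prod ≠ 0 := by
    refine mul_ne_zero (by simpa using hp) (Multiset.prod_ne_zero fun h => ?_)
    obtain ⟨a, ha, h⟩ := Multiset.mem_map.1 h
    have : a = 0 := by simpa using h
    exact h00 (this ▸ ha)
  obtain ⟨e1, e2⟩ := eq_of_prod_eq h00 (fun h => by
    obtain ⟨a, ha, h⟩ := Multiset.mem_map.1 h
    have : a = 0 := by simpa using h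
    exact h00 (this ▸ ha)) hp hp' h2
  exact ⟨p, -N, hp, by omega, e1.symm, by rwa [neg_neg]⟩

end factorization

/-! ### Products over conjugation-invariant families -/

/-- Nonreal members pair with their conjugates to give a square modulus, so only the real members
affect the sign. -/
lemma prod_pos_of_map_conj {S : Multiset ℂ} (hS : S.map (starRingEnd ℂ) = S) {φ : ℂ → ℂ}
    (hφ : ∀ b, φ ((starRingEnd ℂ) b) = (starRingEnd ℂ) (φ b))
    (hpos : ∀ b ∈ S, b.im = 0 → 0 < φ b) (h0 : ∀ b ∈ S, φ b ≠ 0) : 0 < (S.map φ).prod := by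
  classical
  have hlt : S.filter (fun b => b.im < 0) = (S.filter fun b => 0 < b.im).map (starRingEnd ℂ) := by
    conv_lhs => rw [← hS]
    rw [Multiset.filter_map]
    refine congrArg _ (Multiset.filter_congr fun x _ => ?_)
    simp
  have h1 : S = S.filter (fun b => b.im = 0) + (S.filter (fun b => 0 < b.im) +
      S.filter fun b => b.im < 0) := by
    conv_lhs => rw [← Multiset.filter_add_not (fun b : ℂ => b.im = 0) S]
    congr 1
    rw [← Multiset.filter_add_not (fun b : ℂ => 0 < b.im) (S.filter fun b => ¬b.im = 0),
      Multiset.filter_filter,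
      Multiset.filter_filter]
    congr 1 <;> refine Multiset.filter_congr fun x _ => ?_
    · exact ⟨fun h => h.1, fun h => ⟨h, h.ne'⟩⟩
    · exact ⟨fun h => lt_of_le_of_ne (not_lt.1 h.1) h.2, fun h => ⟨not_lt.2 h.le, h.ne⟩⟩
  rw [h1, Multiset.map_add, Multiset.prod_add, Multiset.map_add, Multiset.prod_add, hlt,
    Multiset.map_map]
  have h2 : φ ∘ (starRingEnd ℂ) = (starRingEnd ℂ) ∘ φ := funext hφ
  rw [h2, ← Multiset.map_map, ← map_multiset_prod, Complex.mul_conj]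
  refine mul_pos ?_ ?_
  · have : ∀ R : Multiset ℂ, (∀ b ∈ R, 0 < φ b) → 0 < (R.map φ).prod := fun R => by
      induction R using Multiset.induction_on with
      | empty => intro _; simp
      | cons a R ih =>
        intro h
        rw [Multiset.map_cons, Multiset.prod_cons]
        exact mul_pos (h a (Multiset.mem_cons_self a R))
          (ih fun b hb => h b (Multiset.mem_cons_of_mem hb))
    exact this _ fun b hb => hpos b (Multiset.mem_filter.1 hb).1 (Multiset.mem_filter.1 hb).2
  · have : 0 < Complex.normSq ((S.filter fun b => 0 < b.im).map φ).prod := by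
      rw [Complex.normSq_pos]
      refine Multiset.prod_ne_zero fun h => ?_
      obtain ⟨b, hb, h⟩ := Multiset.mem_map.1 h
      exact h0 b (Multiset.mem_filter.1 hb).1 h
    exact_mod_cast this

lemma E_injOn : Set.InjOn E {a | 0 ≤ a.re ∧ a.re < 1} := fun a ha b hb h => by
  obtain ⟨k, hk⟩ := E_eq_iff.1 h
  have hr := congrArg Complex.re hk
  simp only [Complex.add_re, Complex.intCast_re] at hr
  have a1 : (k : ℝ) < 1 := by linarith [ha.2, hb.1]
  have a2 : (-1 : ℝ) < k := by linarith [ha.1, hb.2]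
  have b1 : k < 1 := by exact_mod_cast a1
  have b2 : -1 < k := by exact_mod_cast a2
  have : k = 0 := by omega
  simpa [this] using hk

/-- Conjugation of the exponent corresponds to a ↦ 1/ā for the root and preserves 0 ≤ Re < 1, a
range on which the exponential is injective. -/
lemma map_conj_eq_of_map_E {S : Multiset ℂ} (hS : ∀ a ∈ S, 0 ≤ a.re ∧ a.re < 1)
    (h : (S.map E).map (fun a => ((starRingEnd ℂ) a)⁻¹) = S.map E) :
    S.map (starRingEnd ℂ) = S := by
  have hl : ∀ a : ℂ, 0 ≤ a.re ∧ a.re < 1 →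
      Function.invFunOn E {a | 0 ≤ a.re ∧ a.re < 1} (E a) = a := fun a ha =>
    E_injOn.leftInvOn_invFunOn ha
  have e := congrArg (Multiset.map (Function.invFunOn E {a | 0 ≤ a.re ∧ a.re < 1})) h
  rw [Multiset.map_map, Multiset.map_map, Multiset.map_map] at e
  have e1 : S.map (Function.invFunOn E {a | 0 ≤ a.re ∧ a.re < 1} ∘ E) = S := by
    exact (Multiset.map_congr rfl fun a ha => hl a (hS a ha)).trans (Multiset.map_id S)
  have e2 : S.map ((Function.invFunOn E {a | 0 ≤ a.re ∧ a.re < 1} ∘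
      fun a => ((starRingEnd ℂ) a)⁻¹) ∘ E) = S.map (starRingEnd ℂ) := by
    refine Multiset.map_congr rfl fun a ha => ?_
    simp only [Function.comp_apply]
    rw [conj_E, E_neg, inv_inv]
    exact hl _ (by simpa using hS a ha)
  exact e2.symm.trans (e.trans e1)

lemma one_add_E (u : ℂ) :
    1 + E u = 2 * Complex.cos (Real.pi * u) * Complex.exp (Real.pi * I * u) := by
  rw [Complex.cos, E, show 2 * Real.pi * I * u = Real.pi * I * u + Real.pi * I * u by ring,
    Complex.exp_add, show Real.pi * u * I = Real.pi * I * u by ring,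
    show -(Real.pi * u) * I = -(Real.pi * I * u) by ring]
  linear_combination -exp_mul_exp_neg (Real.pi * I * u)

lemma one_add_E_eq_zero {u : ℂ} (h : 1 + E u = 0) : u.im = 0 := by
  have h1 : E u = E (1 / 2) := by rw [E_half]; linear_combination h
  obtain ⟨k, rfl⟩ := E_eq_iff.1 h1
  simp

/-- The factorization of a Laurent polynomial that is real on the circle, in terms of the numbers
`βⱼ`. -/
structure IsFactorization (P : ℂ[T;T⁻¹]) {n : ℕ} (β : Fin n → ℂ) (s : ℝ) (m : ℕ) (p : ℂ) :
    Prop where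
  sum_eq : ∑ j, β j = s
  conj_eq : (Finset.univ.val.map β).map (starRingEnd ℂ) = Finset.univ.val.map β
  pos : 0 < p * Complex.exp (Real.pi * I * (s + m))
  evalAt_eq : ∀ y, evalAt P (E y) =
    p * Complex.exp (Real.pi * I * (n * y)) * ∏ j, (1 + E (β j - y))

lemma cos_conj_equivariant (x : ℝ) (b : ℂ) : Complex.cos (Real.pi * (x - (starRingEnd ℂ) b)) =
    (starRingEnd ℂ) (Complex.cos (Real.pi * (x - b))) := by
  rw [← Complex.cos_conj]; simp

lemma cos_ne_zero_of_im {x : ℝ} {b : ℂ} (hb : b.im ≠ 0) : Complex.cos (Real.pi * (x - b)) ≠ 0 := by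
  intro h
  have := one_add_E (x - b)
  rw [h, mul_zero, zero_mul] at this
  have := one_add_E_eq_zero this
  exact hb (by simpa using this)

open Classical in
lemma exists_prod_cos_eq {n : ℕ} {β : Fin n → ℂ}
    (hβ : (Finset.univ.val.map β).map (starRingEnd ℂ) = Finset.univ.val.map β) (x : ℝ) :
    ∃ r : ℝ, 0 < r ∧ ∏ j, Complex.cos (Real.pi * (x - β j)) = cosProd β x * r := by
  have h1 : 0 < (((Finset.univ.val.map β).filter fun b => b.im ≠ 0).map
      fun b => Complex.cos (Real.pi * (x - b))).prod := by
    refine prod_pos_of_map_conj ?_ (cos_conj_equivariant x) ?_ ?_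
    · conv_rhs => rw [← hβ]
      refine Eq.trans ?_ (Multiset.filter_map (f := starRingEnd ℂ) _ _).symm
      refine congrArg _ (Multiset.filter_congr fun b _ => ?_)
      simp
    · intro b hb h
      exact absurd h (Multiset.mem_filter.1 hb).2
    · intro b hb
      exact cos_ne_zero_of_im (Multiset.mem_filter.1 hb).2
  obtain ⟨r, hr, e⟩ : ∃ r : ℝ, 0 < r ∧ (((Finset.univ.val.map β).filter fun b => b.im ≠ 0).map
      fun b => Complex.cos (Real.pi * (x - b))).prod = r := by
    rw [Complex.lt_def] at h1
    refine ⟨_, h1.1, Complex.ext rfl ?_⟩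
    rw [← h1.2]; simp
  refine ⟨r, hr, ?_⟩
  rw [← e, Multiset.filter_map, Multiset.map_map, cosProd, Complex.ofReal_prod,
    ← Finset.prod_filter_mul_prod_filter_not Finset.univ (fun j => (β j).im = 0)]
  refine congrArg₂ _ (Finset.prod_congr rfl fun j hj => ?_) rfl
  rw [Complex.ofReal_cos]
  congr 1
  push_cast
  congr 2
  exact Complex.ext rfl (by simpa using (Finset.mem_filter.1 hj).2)

/-- The shift by 1/2 turns e^{2πiy} - e^{2πiα} into e^{2πiy}(1 + e^{2πi(β-y)}), the shape of the
vanishing factor in the triple product. The powers of e^{2πiy} combine to e^{πiny}. -/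
theorem exists_isFactorization {P : ℂ[T;T⁻¹]} (hreal : RealOnCircle P) {n : ℕ} (hn : 0 < n)
    {α β : Fin n → ℂ} (hα : ∀ j, 0 ≤ (α j).re ∧ (α j).re < 1)
    (hαP : (Finset.univ.val.map fun j => E (α j)) = nonzeroRoots P)
    (hβ : ∀ j, β j = α j + 1 / 2) :
    (∃ k, n = 2 * k) ∧ ∃ s p, IsFactorization P β s (signParam P β) p := by
  have hP : P ≠ 0 := by
    rintro rfl
    have := congrArg Multiset.card hαP
    simp [nonzeroRoots] at this
    omega
  obtain ⟨p, N, hp, hN, hinv, hev⟩ := exists_symmetric_factorization hP hreal.starL_eq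
  have hcard : (n : ℤ) = 2 * N := by
    rw [← hN, ← hαP]; simp
  have hmapE : (Finset.univ.val.map α).map E = nonzeroRoots P := by rw [Multiset.map_map]; exact hαP
  have hαc : (Finset.univ.val.map α).map (starRingEnd ℂ) = Finset.univ.val.map α := by
    refine map_conj_eq_of_map_E (fun a ha => ?_) (by rw [hmapE, hinv])
    obtain ⟨j, -, rfl⟩ := Multiset.mem_map.1 ha
    exact hα j
  have hβα : Finset.univ.val.map β = (Finset.univ.val.map α).map (· + 1 / 2) := by
    rw [Multiset.map_map]; exact Multiset.map_congr rfl fun j _ => hβ j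
  have hβc : (Finset.univ.val.map β).map (starRingEnd ℂ) = Finset.univ.val.map β := by
    rw [hβα]
    conv_rhs => rw [← hαc]
    simp only [Multiset.map_map]
    exact Multiset.map_congr rfl fun a _ => by simp [Complex.conj_ofNat]
  obtain ⟨s, hs⟩ : ∃ s : ℝ, ∑ j, β j = s := by
    refine ⟨(∑ j, β j).re, (Complex.conj_eq_iff_re.1 ?_).symm⟩
    have := congrArg Multiset.sum hβc
    rwa [← map_multiset_sum] at this
  have hev2 : ∀ y, evalAt P (E y) =
      p * Complex.exp (Real.pi * I * (n * y)) * ∏ j, (1 + E (β j - y)) := fun y => by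
    rw [hev _ (E_ne_zero y), ← hαP, Multiset.map_map]
    have e1 : (Finset.univ.val.map ((fun a => E y - a) ∘ fun j => E (α j))).prod =
        E y ^ n * ∏ j, (1 + E (β j - y)) := by
      change ∏ j, (E y - E (α j)) = _
      rw [← Fin.prod_const, ← Finset.prod_mul_distrib]
      refine Finset.prod_congr rfl fun j _ => ?_
      rw [hβ, add_sub_right_comm, E_add, E_sub, E_half]
      have := E_ne_zero y
      field_simp
      ring
    have e2 : E y ^ (-N) * E y ^ n = Complex.exp (Real.pi * I * (n * y)) := by
      rw [← zpow_natCast, ← zpow_add₀ (E_ne_zero y), E, ← Complex.exp_int_mul]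
      congr 1
      have : (n : ℂ) = 2 * N := by exact_mod_cast hcard
      rw [this]; push_cast; rw [this]; ring
    rw [e1, ← e2]; ring
  refine ⟨⟨N.toNat, by omega⟩, s, p, hs, hβc, ?_, hev2⟩
  -- From 1 + e^{2πiu} = 2cos(πu)e^{πiu}, the exponentials combine with e^{πinx} to e^{πis}. Cosines
  -- with nonreal β contribute only a positive factor.
  have hcos : ∀ x : ℝ, ∃ r : ℝ, 0 < r ∧
      evalAt P (E x) = p * Complex.exp (Real.pi * I * s) * (cosProd β x * r : ℝ) := fun x => by
    obtain ⟨r, hr, e⟩ := exists_prod_cos_eq hβc x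
    refine ⟨2 ^ n * r, by positivity, ?_⟩
    have e1 : ∏ j, (1 + E (β j - x)) = 2 ^ n * (∏ j, Complex.cos (Real.pi * (x - β j))) *
        Complex.exp (Real.pi * I * (s - n * x)) := by
      have e2 : Real.pi * I * (s - n * x) = ∑ j, Real.pi * I * (β j - x) := by
        rw [← Finset.mul_sum, Finset.sum_sub_distrib, hs]; simp
      rw [e2, Complex.exp_sum, ← Fin.prod_const, ← Finset.prod_mul_distrib, ← Finset.prod_mul_distrib]
      refine Finset.prod_congr rfl fun j _ => ?_
      rw [one_add_E, ← Complex.cos_neg (Real.pi * (x - β j))]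
      congr 3; ring
    rw [hev2, e1, e, mul_sub, Complex.exp_sub]
    have := Complex.exp_ne_zero (Real.pi * I * (n * x))
    push_cast
    field_simp
  obtain ⟨x₀, hx₀⟩ : ∃ x : ℝ, evalAt P (E x) ≠ 0 := by
    by_contra! h
    exact hP (eq_zero_of_evalAt infinite_range_E (by
      rintro _ ⟨x, rfl⟩
      exact ⟨E_ne_zero _, h x⟩))
  have hexp : Complex.exp (Real.pi * I * s) ≠ 0 := Complex.exp_ne_zero _
  -- The constant p e^{πis} is real because P is real and nonzero at x₀. Its sign is the sign of the
  -- quotient that defines m₀, so multiplying by e^{πim₀} makes it positive.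
  obtain ⟨κ, hκ⟩ : ∃ κ : ℝ, p * Complex.exp (Real.pi * I * s) = κ := by
    refine ⟨(p * Complex.exp (Real.pi * I * s)).re, Complex.ext rfl ?_⟩
    obtain ⟨r, hr, e⟩ := hcos x₀
    have him := hreal _ (norm_E_ofReal x₀)
    rw [e, Complex.im_mul_ofReal] at him
    rcases mul_eq_zero.1 him with h | h
    · simpa using h
    · rw [h] at e; exact absurd e (by simpa using hx₀)
  have hκ0 : κ ≠ 0 := by
    rintro rfl
    exact mul_ne_zero hp hexp (by simpa using hκ)
  have hre : ∀ x : ℝ, ∃ r : ℝ, 0 < r ∧ evalAt P (E x) = (κ * (cosProd β x * r) : ℝ) := fun x => by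
    obtain ⟨r, hr, e⟩ := hcos x
    exact ⟨r, hr, by rw [e, hκ]; push_cast; ring⟩
  have hdiv : ∀ x : ℝ, evalAt P (E x) ≠ 0 → ∃ r : ℝ, 0 < r ∧
      (evalAt P (E x)).re / cosProd β x = κ * r := fun x hx => by
    obtain ⟨r, hr, e⟩ := hre x
    refine ⟨r, hr, ?_⟩
    have : cosProd β x ≠ 0 := fun h => hx (by rw [e, h]; simp)
    rw [e, Complex.ofReal_re]
    field_simp
  rw [mul_add, Complex.exp_add, ← mul_assoc, hκ]
  rcases lt_or_gt_of_ne hκ0 with h | h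
  · have hm : signParam P β = 1 := by
      rw [signParam, if_neg]
      intro hall
      have := hall x₀ hx₀
      obtain ⟨r, hr, e⟩ := hdiv x₀ hx₀
      change 0 < (evalAt P (E x₀)).re / _ at this
      rw [e] at this
      nlinarith
    rw [hm, Nat.cast_one, mul_one, Complex.exp_pi_mul_I]
    have : (0 : ℝ) < κ * -1 := by linarith
    exact_mod_cast this
  · have hm : signParam P β = 0 := by
      rw [signParam, if_pos]
      intro x hx
      obtain ⟨r, hr, e⟩ := hdiv x hx
      change 0 < (evalAt P (E x)).re / _
      rw [e]
      positivity
    rw [hm, Nat.cast_zero, mul_zero, Complex.exp_zero, mul_one]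
    exact_mod_cast h

lemma abs_im_lt_of_rootsInAnnulus {P : ℂ[T;T⁻¹]} {τ : ℂ} (hP : RootsInAnnulus (Real.exp (-(Real.pi * τ.im))) P)
    {n : ℕ} {α β : Fin n → ℂ} (hαP : (Finset.univ.val.map fun j => E (α j)) = nonzeroRoots P)
    (hβ : ∀ j, β j = α j + 1 / 2) (j : Fin n) : |(β j).im| < τ.im / 2 := by
  have h : E (α j) ∈ nonzeroRoots P := hαP ▸ Multiset.mem_map_of_mem _ (Finset.mem_univ j)
  obtain ⟨h1, h2⟩ := hP _ h
  rw [norm_E, Real.exp_lt_exp] at h1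
  rw [norm_E, ← Real.exp_neg, Real.exp_lt_exp] at h2
  have e : (β j).im = (α j).im := by rw [hβ]; simp
  have := Real.pi_pos
  rw [e, abs_lt]
  constructor <;> nlinarith

/-! ### Integrals over a period -/

/-- Cauchy's theorem on a rectangle of width one; the vertical sides cancel by periodicity. -/
lemma integral_add_mul_I {g : ℂ → ℂ} {h : ℝ} (hd : DifferentiableOn ℂ g {z | |z.im| ≤ |h|})
    (hp : ∀ z, g (z + 1) = g z) :
    ∫ x in (0 : ℝ)..1, g (x + h * I) = ∫ x in (0 : ℝ)..1, g x := by
  have H := Complex.integral_boundary_rect_eq_zero_of_differentiableOn g 0 (1 + h * I)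
    (hd.mono fun z hz => by
      have := hz.2
      simp only [Complex.zero_im, Complex.add_im, Complex.one_im, Complex.mul_im, Complex.ofReal_re,
        Complex.I_im, mul_one, Complex.ofReal_im, Complex.I_re, mul_zero, add_zero, zero_add] at this
      have := Set.abs_sub_left_of_mem_uIcc this
      simpa using this)
  simp only [Complex.zero_re, Complex.zero_im, Complex.add_re, Complex.add_im, Complex.one_re,
    Complex.one_im, Complex.mul_re, Complex.mul_im, Complex.ofReal_re, Complex.ofReal_im,
    Complex.I_re, Complex.I_im, mul_zero, mul_one, sub_zero, add_zero, zero_add, zero_mul,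
    Complex.ofReal_zero, Complex.ofReal_one] at H
  have e : ∀ y : ℝ, g (1 + y * I) = g (y * I) := fun y => by rw [add_comm, hp]
  simp only [e, add_sub_cancel_right] at H
  exact (sub_eq_zero.1 H).symm

lemma periodic_fract {A : Type*} {u : ℝ → A} (hp : ∀ x, u (x + 1) = u x) (x : ℝ) :
    u (Int.fract x) = u x := by
  have : Function.Periodic u 1 := hp
  have := this.sub_int_mul_eq (x := x) ⌊x⌋
  rwa [mul_one] at this

lemma integral_pos_of_periodic {u : ℝ → ℝ} (hc : Continuous u) (hp : ∀ x, u (x + 1) = u x)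
    (h0 : ∀ x, 0 ≤ u x) {x₀ : ℝ} (hx : 0 < u x₀) : 0 < ∫ x in (0 : ℝ)..1, u x :=
  intervalIntegral.integral_pos zero_lt_one hc.continuousOn (fun x _ => h0 x)
    ⟨Int.fract x₀, ⟨Int.fract_nonneg _, (Int.fract_lt_one _).le⟩, by rwa [periodic_fract hp]⟩

lemma exists_laurent_approx {h : ℝ → ℂ} (hc : Continuous h) (hp : ∀ x, h (x + 1) = h x) {ε : ℝ}
    (hε : 0 < ε) : ∃ R : ℂ[T;T⁻¹], ∀ x : ℝ, ‖evalAt R (E x) - h x‖ < ε := by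
  have : Fact ((0 : ℝ) < 1) := ⟨zero_lt_one⟩
  have hper : Function.Periodic h 1 := hp
  let H : C(AddCircle (1 : ℝ), ℂ) := ⟨hper.lift, continuous_quot_lift _ hc⟩
  have hH : H ∈ (Submodule.span ℂ (Set.range (@fourier (1 : ℝ)))).topologicalClosure := by
    rw [span_fourier_closure_eq_top]; trivial
  obtain ⟨g, hg, hd⟩ := Metric.mem_closure_iff.1 hH ε hε
  have hg' : ∃ R : ℂ[T;T⁻¹], ∀ x : ℝ, g x = evalAt R (E x) := by
    clear hd
    induction hg using Submodule.span_induction with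
    | mem g hg =>
      obtain ⟨k, rfl⟩ := hg
      refine ⟨.T k, fun x => ?_⟩
      rw [evalAt_T (E_ne_zero _), fourier_coe_apply, E, ← Complex.exp_int_mul]
      congr 1; push_cast; ring
    | zero => exact ⟨0, fun x => by rw [evalAt_eq (E_ne_zero _), map_zero]; rfl⟩
    | add g1 g2 _ _ h1 h2 =>
      obtain ⟨R1, h1⟩ := h1
      obtain ⟨R2, h2⟩ := h2
      exact ⟨R1 + R2, fun x => by rw [evalAt_add (E_ne_zero _), ← h1, ← h2]; rfl⟩
    | smul a g _ h =>
      obtain ⟨R, h⟩ := h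
      exact ⟨a • R, fun x => by rw [evalAt_smul (E_ne_zero _), ← h]; rfl⟩
  obtain ⟨R, hR⟩ := hg'
  refine ⟨R, fun x => ?_⟩
  have h1 : ‖(g - H) x‖ ≤ ‖g - H‖ := ContinuousMap.norm_coe_le_norm _ _
  rw [← hR, ← dist_eq_norm]
  rw [dist_comm, dist_eq_norm] at hd
  rw [dist_eq_norm]
  exact lt_of_le_of_lt h1 hd

@[fun_prop] lemma continuous_evalAt_E (R : ℂ[T;T⁻¹]) : Continuous fun x : ℝ => evalAt R (E x) :=
  (differentiable_evalAt_E R).continuous.comp continuous_ofReal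

lemma evalAt_E_add_one (R : ℂ[T;T⁻¹]) (x : ℝ) : evalAt R (E ((x + 1 : ℝ) : ℂ)) = evalAt R (E x) := by
  rw [Complex.ofReal_add, Complex.ofReal_one, E_add_one]

section positivity
variable {φ : ℝ → ℂ} (hc : Continuous φ) (hp : ∀ x, φ (x + 1) = φ x)
include hc

/-- Laurent polynomials that approximate √g uniformly on the circle have squared moduli that
approximate g. -/
lemma integral_mul_nonneg
    (h : ∀ R : ℂ[T;T⁻¹], 0 ≤ ∫ x in (0 : ℝ)..1, (Complex.normSq (evalAt R (E x)) : ℂ) * φ x)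
    {g : ℝ → ℝ} (gc : Continuous g) (gp : ∀ x, g (x + 1) = g x) (g0 : ∀ x, 0 ≤ g x) :
    0 ≤ ∫ x in (0 : ℝ)..1, (g x : ℂ) * φ x := by
  have hs : Continuous fun x => ((Real.sqrt (g x) : ℝ) : ℂ) := by fun_prop
  choose R hR using fun k : ℕ => exists_laurent_approx hs (fun x => by rw [gp])
    (Nat.one_div_pos_of_nat (n := k) (α := ℝ))
  have hlim : Tendsto (fun k => ∫ x in (0 : ℝ)..1, (Complex.normSq (evalAt (R k) (E x)) : ℂ) * φ x)
      atTop (𝓝 (∫ x in (0 : ℝ)..1, (g x : ℂ) * φ x)) := by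
    refine intervalIntegral.tendsto_integral_filter_of_dominated_convergence
      (fun x => (Real.sqrt (g x) + 1) ^ 2 * ‖φ x‖) (Eventually.of_forall fun k => ?_)
      (Eventually.of_forall fun k => ?_) ?_ ?_
    · refine Continuous.aestronglyMeasurable ?_
      exact (continuous_ofReal.comp (Complex.continuous_normSq.comp (continuous_evalAt_E _))).mul hc
    · refine Eventually.of_forall fun x _ => ?_
      rw [norm_mul, Complex.norm_real, Real.norm_of_nonneg (Complex.normSq_nonneg _),
        Complex.normSq_eq_norm_sq]
      refine mul_le_mul_of_nonneg_right ?_ (norm_nonneg _)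
      refine pow_le_pow_left₀ (norm_nonneg _) ?_ 2
      have h1 := (hR k x).le
      have h2 : (1 : ℝ) / (k + 1) ≤ 1 := by
        rw [div_le_one (by positivity)]; linarith [(Nat.cast_nonneg k : (0 : ℝ) ≤ k)]
      have h3 := norm_add_le (evalAt (R k) (E x) - (Real.sqrt (g x) : ℝ)) (Real.sqrt (g x) : ℝ)
      rw [sub_add_cancel, Complex.norm_real, Real.norm_of_nonneg (Real.sqrt_nonneg _)] at h3
      linarith
    · refine Continuous.intervalIntegrable ?_ _ _
      fun_prop
    · refine Eventually.of_forall fun x _ => Tendsto.mul_const _ ?_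
      have h1 : Tendsto (fun k => evalAt (R k) (E x)) atTop (𝓝 ((Real.sqrt (g x) : ℝ) : ℂ)) := by
        rw [tendsto_iff_norm_sub_tendsto_zero]
        exact squeeze_zero (fun _ => norm_nonneg _) (fun k => (hR k x).le)
          tendsto_one_div_add_atTop_nhds_zero_nat
      have h2 := (continuous_ofReal.tendsto _).comp ((Complex.continuous_normSq.tendsto _).comp h1)
      rw [Complex.normSq_ofReal, Real.mul_self_sqrt (g0 x)] at h2
      exact h2
  exact ge_of_tendsto' hlim fun k => h (R k)

include hp

/-- If a real functional A, nonpositive on nonnegative numbers, had Aφ > 0 somewhere, the weight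
max(Aφ, 0) would give an integral on which A is positive. The choices Im, -Im and -Re force φ to be
real and nonnegative. -/
lemma nonneg_of_integral_nonneg
    (h : ∀ R : ℂ[T;T⁻¹], 0 ≤ ∫ x in (0 : ℝ)..1, (Complex.normSq (evalAt R (E x)) : ℂ) * φ x)
    (x : ℝ) : 0 ≤ φ x := by
  have hint : ∀ g : ℝ → ℝ, Continuous g → IntervalIntegrable (fun x => (g x : ℂ) * φ x)
      MeasureTheory.volume 0 1 := fun g gc =>
    Continuous.intervalIntegrable ((continuous_ofReal.comp gc).mul hc) _ _
  have key : ∀ (A : ℂ →L[ℝ] ℝ), (∀ z : ℂ, 0 ≤ z → A z ≤ 0) → ∀ x, A (φ x) ≤ 0 := by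
    intro A hA
    by_contra! hx
    obtain ⟨x₀, hx₀⟩ := hx
    have gc : Continuous fun x => max (A (φ x)) 0 := by fun_prop
    have h1 := integral_mul_nonneg hc h gc (fun x => by simp only [hp]) (fun x => le_max_right _ _)
    have h2 := hA _ h1
    rw [← A.intervalIntegral_comp_comm (hint _ gc)] at h2
    refine absurd h2 (not_le.2 ?_)
    have e : ∀ x, A ((max (A (φ x)) 0 : ℝ) * φ x) = max (A (φ x)) 0 * A (φ x) := fun x => by
      rw [← Complex.real_smul, map_smul, smul_eq_mul]
    simp only [e]
    refine integral_pos_of_periodic (by fun_prop) (fun x => by simp only [hp]) (fun x => ?_)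
      (x₀ := x₀) (by rw [max_eq_left hx₀.le]; positivity)
    rcases le_total (A (φ x)) 0 with h | h
    · rw [max_eq_right h, zero_mul]
    · rw [max_eq_left h]; positivity
  have k1 := key Complex.imCLM (fun z hz => by rw [Complex.imCLM_apply, ← (Complex.le_def.1 hz).2]; rfl) x
  have k2 := key (-Complex.imCLM) (fun z hz => by
    rw [neg_apply, Complex.imCLM_apply, ← (Complex.le_def.1 hz).2]; simp) x
  have k3 := key (-Complex.reCLM) (fun z hz => by
    have := (Complex.le_def.1 hz).1
    rw [neg_apply, Complex.reCLM_apply]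
    simpa using this) x
  rw [neg_apply, Complex.imCLM_apply] at k2
  rw [neg_apply, Complex.reCLM_apply] at k3
  rw [Complex.imCLM_apply] at k1
  rw [Complex.le_def]
  constructor
  · simpa using k3
  · rw [Complex.zero_im]; linarith

lemma integral_pos_of_nonneg (h0 : ∀ x, 0 ≤ φ x) {x₀ : ℝ} (hx : φ x₀ ≠ 0) {R : ℂ[T;T⁻¹]}
    (hR : R ≠ 0) : 0 < ∫ x in (0 : ℝ)..1, (Complex.normSq (evalAt R (E x)) : ℂ) * φ x := by
  have hre : ∀ x, φ x = ((φ x).re : ℂ) := fun x =>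
    Complex.ext rfl (by rw [Complex.ofReal_im]; exact (Complex.le_def.1 (h0 x)).2.symm)
  have h0' : ∀ x, 0 ≤ (φ x).re := fun x => (Complex.le_def.1 (h0 x)).1
  have e : ∀ x : ℝ, (Complex.normSq (evalAt R (E x)) : ℂ) * φ x =
      ((Complex.normSq (evalAt R (E x)) * (φ x).re : ℝ) : ℂ) := fun x => by
    rw [hre x]; push_cast; simp
  simp only [e]
  rw [intervalIntegral.integral_ofReal]
  have hev : ∀ᶠ x in 𝓝 x₀, φ x ≠ 0 := hc.continuousAt.eventually_ne hx
  obtain ⟨δ, hδ, hball⟩ := Metric.eventually_nhds_iff_ball.1 hev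
  rw [Real.ball_eq_Ioo] at hball
  obtain ⟨x₁, hx₁, hR₁⟩ : ∃ x ∈ Set.Ioo (x₀ - δ) (x₀ + δ), evalAt R (E x) ≠ 0 := by
    by_contra! h
    refine hR (eq_zero_of_evalAt (infinite_image_E (a := x₀ - δ) (b := x₀ + δ) (by linarith)) ?_)
    rintro _ ⟨x, hx, rfl⟩
    exact ⟨E_ne_zero _, h x hx⟩
  have : 0 < ∫ x in (0 : ℝ)..1, Complex.normSq (evalAt R (E x)) * (φ x).re := by
    refine integral_pos_of_periodic (x₀ := x₁) ?_ (fun x => ?_) (fun x => ?_) ?_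
    · exact (Complex.continuous_normSq.comp (continuous_evalAt_E R)).mul (by fun_prop)
    · simp only [evalAt_E_add_one, hp]
    · exact mul_nonneg (Complex.normSq_nonneg _) (h0' x)
    · refine mul_pos (Complex.normSq_pos.2 hR₁) (lt_of_le_of_ne (h0' x₁) fun h => ?_)
      refine hball x₁ hx₁ ?_
      rw [hre, ← h]; simp
  exact_mod_cast this

lemma forall_integral_pos_iff :
    (∀ R : ℂ[T;T⁻¹], R ≠ 0 → 0 < ∫ x in (0 : ℝ)..1, (Complex.normSq (evalAt R (E x)) : ℂ) * φ x) ↔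
      (∀ x, 0 ≤ φ x) ∧ ∃ x, φ x ≠ 0 := by
  constructor
  · intro h
    refine ⟨nonneg_of_integral_nonneg hc hp fun R => ?_, ?_⟩
    · by_cases hR : R = 0
      · subst hR
        have : ∀ x : ℝ, evalAt (0 : ℂ[T;T⁻¹]) (E x) = 0 := fun x => by
          rw [evalAt_eq (E_ne_zero _), map_zero]
        simp [this]
      · exact (h R hR).le
    · by_contra! h0
      have := h 1 one_ne_zero
      simp [h0] at this
  · rintro ⟨h0, x₀, hx⟩ R hR
    exact integral_pos_of_nonneg hc hp h0 hx hR

/-- All integrals of |R|²φ vanish, so both φ and -φ are nonnegative. -/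
lemma eq_zero_of_moments (h : ∀ R : ℂ[T;T⁻¹], ∫ x in (0 : ℝ)..1, evalAt R (E x) * φ x = 0) (x : ℝ) :
    φ x = 0 := by
  have h1 : ∀ R : ℂ[T;T⁻¹], ∫ x in (0 : ℝ)..1, (Complex.normSq (evalAt R (E x)) : ℂ) * φ x = 0 :=
    fun R => by
      rw [← h (R * starL R)]
      refine intervalIntegral.integral_congr fun x _ => ?_
      rw [evalAt_mul (E_ne_zero _), evalAt_starL (E_ne_zero _), conj_inv_E, Complex.mul_conj]
  have p1 := nonneg_of_integral_nonneg hc hp (fun R => (h1 R).ge) x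
  have p2 := nonneg_of_integral_nonneg (φ := fun x => -φ x) hc.neg (fun x => by rw [hp])
    (fun R => by simp only [mul_neg, intervalIntegral.integral_neg, h1, neg_zero]; exact le_rfl) x
  exact le_antisymm (neg_nonneg.1 p2) p1

end positivity

/-! ### The functional given by a quasi-periodic function -/

/-- The functional `R ↦ ∫₀¹ R(e^{2πix}) w(x) dx`. -/
def intFun (w : ℝ → ℂ) (hw : Continuous w) : ℂ[T;T⁻¹] →ₗ[ℂ] ℂ where
  toFun R := ∫ x in (0 : ℝ)..1, evalAt R (E x) * w x
  map_add' R S := by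
    refine Eq.trans (intervalIntegral.integral_congr fun x _ => ?_) (intervalIntegral.integral_add
      (((continuous_evalAt_E R).mul hw).intervalIntegrable _ _)
      (((continuous_evalAt_E S).mul hw).intervalIntegrable _ _))
    exact (congrArg (· * w x) (evalAt_add (E_ne_zero _) R S)).trans (add_mul _ _ _)
  map_smul' a R := by
    rw [RingHom.id_apply, smul_eq_mul, ← intervalIntegral.integral_const_mul]
    exact intervalIntegral.integral_congr fun x _ => by
      rw [evalAt_smul (E_ne_zero _), mul_assoc]

lemma intFun_apply (w : ℝ → ℂ) (hw : Continuous w) (R : ℂ[T;T⁻¹]) :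
    intFun w hw R = ∫ x in (0 : ℝ)..1, evalAt R (E x) * w x := rfl

lemma thetaK_add_one (τ y : ℂ) : thetaK τ (y + 1) = thetaK τ y := by
  rw [thetaK, thetaK, E_add_one, neg_add, ← sub_eq_add_neg, E_sub, E_one, div_one]

lemma half_tau_eq {τ : ℂ} (hτ : τ.re = 0) : τ / 2 = ((τ.im / 2 : ℝ) : ℂ) * I := by
  apply Complex.ext <;> simp [hτ]

section weight
variable {τ : ℂ} (hτ : τ.re = 0) (hi : 0 < τ.im) {n : ℕ} {β : Fin n → ℂ}
  (hbd : ∀ j, |(β j).im| < τ.im / 2)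
  {P : ℂ[T;T⁻¹]} {s c : ℝ} {m : ℕ} {p : ℂ} {f : ℂ → ℂ}

section
include hi

/-- Numerator and denominator have characteristics s+c+m and s, so the quotient is multiplied by
e^{2πi(c+m)}; the integer m drops out. -/
lemma weight_add_tau (hF : IsFactorization P β s m p) (hf : IsTheta τ n (s + c + m) f) (x : ℂ) :
    f (x + τ) / thetaProd τ β (x + τ) =
      Complex.exp (2 * Real.pi * I * c) * (f x / thetaProd τ β x) := by
  have h1 := (isTheta_prod (τ := τ) hi β (s := s) ⟨0, by rw [hF.sum_eq]; simp⟩ 1).add_tau x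
  simp only [one_mul] at h1
  rw [h1, hf.add_tau]
  have h2 : Complex.exp (-(Real.pi * I * (2 * n * x + n * τ - 2 * (s + c + m : ℝ)))) =
      Complex.exp (2 * Real.pi * I * c) *
        Complex.exp (-(Real.pi * I * (2 * n * x + n * τ - 2 * s))) := by
    have h3 := Complex.exp_int_mul_two_pi_mul_I m
    rw [← mul_one (Complex.exp (2 * Real.pi * I * c) * _), ← h3, ← Complex.exp_add,
      ← Complex.exp_add]
    congr 1; push_cast; ring
  have := Complex.exp_ne_zero (-(Real.pi * I * (2 * n * x + n * τ - 2 * s)))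
  rw [h2, mul_assoc, mul_div_assoc, mul_div_mul_left _ _ this]

variable {q : ℂˣ} (hq : (q : ℂ) = E (τ / 2))
include hτ hq

/-- At y = x - τ/2 the integrand is M(e^{2πiy})V(y); the contour then moves from the lower edge of
the strip to ℝ. -/
lemma integral_shift_down {V : ℂ → ℂ} (hV : DifferentiableOn ℂ V {z | |z.im| ≤ τ.im / 2})
    (hV1 : ∀ z, V (z + 1) = V z) (hV2 : ∀ y, |y.im| = τ.im / 2 →
        V y = evalAt P (E y) * (f (y + τ / 2) / thetaProd τ β (y + τ / 2))) (M : ℂ[T;T⁻¹]) :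
    ∫ x in (0 : ℝ)..1, evalAt (scale q⁻¹ (P * M)) (E x) * (f x / thetaProd τ β x) =
      ∫ x in (0 : ℝ)..1, evalAt M (E x) * V x := by
  have hg := integral_add_mul_I (g := fun z => evalAt M (E z) * V z) (h := -(τ.im / 2))
    ((differentiable_evalAt_E M).differentiableOn.mul
      (hV.mono fun z hz => by
        rw [Set.mem_ofPred_eq, abs_neg, abs_of_pos (half_pos hi)] at hz
        exact hz))
    (fun z => by simp only [E_add_one, hV1])
  rw [← hg]
  refine intervalIntegral.integral_congr fun x _ => ?_
  have e : (x : ℂ) + ((-(τ.im / 2) : ℝ) : ℂ) * I = x - τ / 2 := by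
    rw [half_tau_eq hτ]; push_cast; ring
  rw [e, hV2 _ (by
    rw [half_tau_eq hτ, Complex.sub_im, Complex.mul_I_im, Complex.ofReal_re,
      Complex.ofReal_im, zero_sub, abs_neg, abs_of_pos (half_pos hi)]), sub_add_cancel,
    evalAt_scale (E_ne_zero _), evalAt_mul (by simp)]
  have e2 : ((q⁻¹ : ℂˣ) : ℂ) * E x = E (x - τ / 2) := by
    rw [Units.val_inv_eq_inv_val, hq, E_sub, div_eq_inv_mul (E x)]
  rw [e2]
  ring

/-- At y = x + τ/2 the value V(y) involves w(x+τ) = t w(x), which is the source of the twist; the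
contour moves from the upper edge to the same line ℝ. -/
lemma integral_shift_up (hF : IsFactorization P β s m p) (hf : IsTheta τ n (s + c + m) f)
    {V : ℂ → ℂ} (hV : DifferentiableOn ℂ V {z | |z.im| ≤ τ.im / 2})
    (hV1 : ∀ z, V (z + 1) = V z) (hV2 : ∀ y, |y.im| = τ.im / 2 →
        V y = evalAt P (E y) * (f (y + τ / 2) / thetaProd τ β (y + τ / 2))) (M : ℂ[T;T⁻¹]) :
    Complex.exp (2 * Real.pi * I * c) *
      ∫ x in (0 : ℝ)..1, evalAt (scale q (P * M)) (E x) * (f x / thetaProd τ β x) =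
      ∫ x in (0 : ℝ)..1, evalAt M (E x) * V x := by
  have hg := integral_add_mul_I (g := fun z => evalAt M (E z) * V z) (h := τ.im / 2)
    ((differentiable_evalAt_E M).differentiableOn.mul
      (hV.mono fun z hz => by
        rw [Set.mem_ofPred_eq, abs_of_pos (half_pos hi)] at hz
        exact hz))
    (fun z => by simp only [E_add_one, hV1])
  rw [← hg, ← intervalIntegral.integral_const_mul]
  refine intervalIntegral.integral_congr fun x _ => ?_
  rw [← half_tau_eq hτ, hV2 _ (by
    rw [half_tau_eq hτ, Complex.add_im, Complex.mul_I_im, Complex.ofReal_re,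
      Complex.ofReal_im, zero_add, abs_of_pos (half_pos hi)]),
    show (x : ℂ) + τ / 2 + τ / 2 = x + τ by ring, weight_add_tau hi hF hf,
    evalAt_scale (E_ne_zero _), evalAt_mul (by simp)]
  have e2 : (q : ℂ) * E x = E (x + τ / 2) := by
    rw [hq, E_add, mul_comm]
  rw [e2]
  ring

end

section
include hi hbd

lemma thetaK_prod_pos
    (hconj : (Finset.univ.val.map β).map (starRingEnd ℂ) = Finset.univ.val.map β) (x : ℝ) :
    0 < ∏ j, thetaK τ (x - β j) := by
  have := prod_pos_of_map_conj hconj (φ := fun b => thetaK τ (x - b))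
    (fun b => by rw [← thetaK_conj]; simp)
    (fun b _ hb => by
      have := thetaK_pos hi (x - b.re)
      have e : (x - b : ℂ) = ((x - b.re : ℝ) : ℂ) := Complex.ext (by simp) (by simp [hb])
      rwa [e])
    (fun b hb => by
      obtain ⟨j, -, rfl⟩ := Multiset.mem_map.1 hb
      refine thetaK_ne_zero hi ?_
      have := hbd j
      simp only [Complex.sub_im, Complex.ofReal_im, zero_sub, abs_neg]
      linarith)
  rwa [Multiset.map_map] at this

end

include hτ hi

lemma theta_ne_zero_of_im {z : ℂ} (hz : |z.im| < τ.im / 2) : jacobiTheta₂ z τ ≠ 0 := by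
  intro h
  obtain ⟨k, l, rfl⟩ := theta_eq_zero hτ hi h
  have e : (1 / 2 + τ / 2 + k + l * τ : ℂ).im = (l + 1 / 2) * τ.im := by
    simp; ring
  rw [e, abs_lt] at hz
  have h1 : (l : ℝ) < 0 := by nlinarith [hz.2]
  have h2 : (-1 : ℝ) < l := by nlinarith [hz.1]
  have h1' : l < 0 := by exact_mod_cast h1
  have h2' : -1 < l := by exact_mod_cast h2
  omega

include hbd

lemma thetaProd_ne_zero_of_real (x : ℝ) : thetaProd τ β x ≠ 0 :=
  Finset.prod_ne_zero_iff.2 fun j _ => theta_ne_zero_of_im hτ hi (by simpa using hbd j)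

lemma thetaProd_pos (hconj : (Finset.univ.val.map β).map (starRingEnd ℂ) = Finset.univ.val.map β)
    (x : ℝ) : 0 < thetaProd τ β x := by
  have := prod_pos_of_map_conj hconj (φ := fun b => jacobiTheta₂ (x - b) τ)
    (fun b => by rw [← theta_conj hτ]; simp)
    (fun b _ hb => by
      have := theta_pos hτ hi (x - b.re)
      have e : (x - b : ℂ) = ((x - b.re : ℝ) : ℂ) := Complex.ext (by simp) (by simp [hb])
      rwa [e])
    (fun b hb => by
      obtain ⟨j, -, rfl⟩ := Multiset.mem_map.1 hb
      exact theta_ne_zero_of_im hτ hi (by simpa using hbd j))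
  rwa [Multiset.map_map] at this

lemma continuous_weight {f : ℂ → ℂ} (hf : Differentiable ℂ f) :
    Continuous fun x : ℝ => f x / thetaProd τ β x := by
  refine (hf.continuous.comp continuous_ofReal).div ?_ (thetaProd_ne_zero_of_real hτ hi hbd)
  have hd := differentiable_theta hi
  have : Differentiable ℂ (thetaProd τ β) := by
    unfold thetaProd
    fun_prop
  exact this.continuous.comp continuous_ofReal

/-- The function `P(e^{2πiy}) w(y + τ/2)`, with its singularities removed. -/
theorem exists_shifted_weight (hev : ∃ k, n = 2 * k) (hF : IsFactorization P β s m p)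
    (hf : IsTheta τ n (s + c + m) f) : ∃ V : ℂ → ℂ,
      DifferentiableOn ℂ V {z | |z.im| ≤ τ.im / 2} ∧ (∀ z, V (z + 1) = V z) ∧
      (∀ y, |y.im| = τ.im / 2 →
        V y = evalAt P (E y) * (f (y + τ / 2) / thetaProd τ β (y + τ / 2))) ∧
      ∃ r : ℝ → ℝ, (∀ x, 0 < r x) ∧ ∀ x : ℝ, Complex.exp (-(Real.pi * I * c)) * V x =
        r x * (Complex.exp (Real.pi * I * (n * x - (s + c + m : ℝ))) * f (x + τ / 2)) := by
  obtain ⟨C, hC, hθ, -⟩ := theta_product hτ hi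
  have hC' : (C : ℂ) ≠ 0 := by exact_mod_cast hC.ne'
  have hprod : ∀ y, thetaProd τ β (y + τ / 2) =
      (C ^ n * ∏ j, thetaK τ (y - β j)) * ∏ j, (1 + E (β j - y)) := fun y => by
    rw [thetaProd, ← Fin.prod_const, ← Finset.prod_mul_distrib, ← Finset.prod_mul_distrib]
    refine Finset.prod_congr rfl fun j _ => ?_
    rw [add_sub_right_comm, hθ, neg_sub]
    ring
  -- The strict bound |Im β_j| < Im τ/2, that is, the annulus condition on the roots, keeps y - β_j
  -- inside the zero-free strip even on the edges.
  have hK : ∀ y : ℂ, |y.im| ≤ τ.im / 2 → ∏ j, thetaK τ (y - β j) ≠ 0 := fun y hy =>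
    Finset.prod_ne_zero_iff.2 fun j _ => thetaK_ne_zero hi (by
      rw [Complex.sub_im]
      linarith [abs_sub y.im (β j).im, hbd j])
  have dK := differentiable_thetaK (τ := τ) hi
  have df := hf.diff
  have dprod : Differentiable ℂ fun y => ∏ j, thetaK τ (y - β j) := by fun_prop
  -- This is P(e^{2πiy})w(y+τ/2) after cancelling ∏(1 + e^{2πi(β_j-y)}). The cancelled factor may
  -- vanish inside the strip but not on its edges, where the two expressions are compared.
  refine ⟨fun y => p * Complex.exp (Real.pi * I * (n * y)) * f (y + τ / 2) /
    (C ^ n * ∏ j, thetaK τ (y - β j)), ?_, fun z => ?_, fun y hy => ?_, ?_⟩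
  · refine DifferentiableOn.div (by fun_prop) (by fun_prop) fun y hy => ?_
    exact mul_ne_zero (pow_ne_zero _ hC') (hK y hy)
  · obtain ⟨k, rfl⟩ := hev
    have e1 : Complex.exp (Real.pi * I * ((2 * k : ℕ) * (z + 1))) =
        Complex.exp (Real.pi * I * ((2 * k : ℕ) * z)) := by
      rw [mul_add, mul_add, Complex.exp_add]
      have := exp_int_even k
      push_cast at this ⊢
      rw [mul_one, this, mul_one]
    have e2 : f (z + 1 + τ / 2) = f (z + τ / 2) := by
      rw [add_right_comm, hf.add_one]
    have e3 : ∀ j, thetaK τ (z + 1 - β j) = thetaK τ (z - β j) := fun j => by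
      rw [add_sub_right_comm, thetaK_add_one]
    simp only [e1, e2, e3]
  · have h1 : ∏ j, (1 + E (β j - y)) ≠ 0 := Finset.prod_ne_zero_iff.2 fun j _ h => by
      have := one_add_E_eq_zero h
      rw [Complex.sub_im, sub_eq_zero] at this
      exact absurd (this ▸ hbd j) (by rw [hy]; exact lt_irrefl _)
    have h2 := hK y hy.le
    have h3 := pow_ne_zero n hC'
    rw [hprod, hF.evalAt_eq]
    field_simp
  · have hκ := hF.pos
    have hD := thetaK_prod_pos hi hbd hF.conj_eq
    have hre : ∀ x : ℝ, ∃ r : ℝ, 0 < r ∧ p * Complex.exp (Real.pi * I * (s + m)) /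
        (C ^ n * ∏ j, thetaK τ (x - β j)) = r := fun x => by
      have h1 : (0 : ℂ) < C ^ n := by
        have : 0 < C ^ n := by positivity
        exact_mod_cast this
      have h2 := mul_pos hκ (inv_pos.2 (mul_pos h1 (hD x)))
      rw [← div_eq_mul_inv] at h2
      obtain ⟨a, b⟩ := Complex.lt_def.1 h2
      exact ⟨_, a, Complex.ext rfl (by rw [← b]; simp)⟩
    choose r hr0 hr using hre
    refine ⟨r, hr0, fun x => ?_⟩
    have h3 : Complex.exp (Real.pi * I * (s + m)) * (Complex.exp (Real.pi * I * (n * x - (s + c + m : ℝ))))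
        = Complex.exp (-(Real.pi * I * c)) * Complex.exp (Real.pi * I * (n * x)) := by
      rw [← Complex.exp_add, ← Complex.exp_add]
      congr 1; push_cast; ring
    rw [← hr]
    linear_combination (-(p * f (x + τ / 2) / (C ^ n * ∏ j, thetaK τ (x - β j)))) * h3

variable {q : ℂˣ} (hq : (q : ℂ) = E (τ / 2))
include hq

theorem isTwFun_intFun (hev : ∃ k, n = 2 * k) (hF : IsFactorization P β s m p)
    (hf : IsTheta τ n (s + c + m) f) :
    IsTwFun q P (Complex.exp (2 * Real.pi * I * c))
      (intFun _ (continuous_weight hτ hi hbd hf.diff)) := fun M => by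
  obtain ⟨V, h1, h2, h3, -⟩ := exists_shifted_weight hτ hi hbd hev hF hf
  rw [intFun_apply, intFun_apply, integral_shift_down hτ hi hq h1 h2 h3,
    integral_shift_up hτ hi hq hF hf h1 h2 h3]

/-- On the circle the two forms are ∫|R|²w and e^{-πic}∫|R(qz)|²V, and R(qz) is again an arbitrary
Laurent polynomial. Up to positive functions, w and e^{-πic}V are f(x) and the normalized f(x+τ/2).
Neither vanishes identically on ℝ unless f = 0. -/
theorem intFun_positive_iff (hev : ∃ k, n = 2 * k) (hF : IsFactorization P β s m p)
    (hf : IsTheta τ n (s + c + m) f) :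
    ((∀ R ≠ 0, 0 < intFun _ (continuous_weight hτ hi hbd hf.diff) (R * starL R)) ∧
      ∀ R ≠ 0, 0 < Complex.exp (-(Real.pi * I * c)) *
        intFun _ (continuous_weight hτ hi hbd hf.diff)
          (R * scale (q ^ 2)⁻¹ (starL R) * scale q⁻¹ P)) ↔ f ∈ posTheta τ n (s + c + m) := by
  obtain ⟨V, hV, hV1, hV2, r, hr, hVr⟩ := exists_shifted_weight hτ hi hbd hev hF hf
  have hqc : (starRingEnd ℂ) (q : ℂ) = q := by
    rw [hq, conj_E, map_div₀, conj_tau hτ, Complex.conj_ofNat]; congr 1; ring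
  have hpos := thetaProd_pos hτ hi hbd hF.conj_eq
  have hVc : Continuous fun x : ℝ => V x := by
    refine hV.continuousOn.comp_continuous continuous_ofReal fun x => ?_
    rw [Set.mem_ofPred_eq, Complex.ofReal_im, abs_zero]
    exact (half_pos hi).le
  have e0 : ∀ R, intFun _ (continuous_weight hτ hi hbd hf.diff) (R * starL R) =
      ∫ x in (0 : ℝ)..1, (Complex.normSq (evalAt R (E x)) : ℂ) * (f x / thetaProd τ β x) := fun R => by
    rw [intFun_apply]
    refine intervalIntegral.integral_congr fun x _ => ?_
    rw [evalAt_mul (E_ne_zero _), evalAt_starL (E_ne_zero _), conj_inv_E, Complex.mul_conj]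
  have e1 : ∀ R, Complex.exp (-(Real.pi * I * c)) *
        intFun _ (continuous_weight hτ hi hbd hf.diff)
          (R * scale (q ^ 2)⁻¹ (starL R) * scale q⁻¹ P) =
      ∫ x in (0 : ℝ)..1, (Complex.normSq (evalAt (scale q R) (E x)) : ℂ) *
        (Complex.exp (-(Real.pi * I * c)) * V x) := fun R => by
    -- Written as a rescaling of a multiple of P, the argument fits the contour shift; the remaining
    -- factor is |R(qz)|² on the circle.
    have h : R * scale (q ^ 2)⁻¹ (starL R) * scale q⁻¹ P =
        scale q⁻¹ (P * (scale q R * scale q⁻¹ (starL R))) := by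
      rw [map_mul (scale q⁻¹), map_mul (scale q⁻¹), scale_scale, scale_scale, inv_mul_cancel, scale_one, sq, mul_inv]
      ring
    rw [h, intFun_apply, integral_shift_down hτ hi hq hV hV1 hV2,
      ← intervalIntegral.integral_const_mul]
    refine intervalIntegral.integral_congr fun x _ => ?_
    have hx : ((q⁻¹ : ℂˣ) : ℂ) * E x ≠ 0 := by simp
    have h2 : ((starRingEnd ℂ) (((q⁻¹ : ℂˣ) : ℂ) * E x))⁻¹ = q * E x := by
      rw [Units.val_inv_eq_inv_val, map_mul, map_inv₀, hqc, mul_inv, inv_inv, conj_inv_E]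
    rw [evalAt_mul (E_ne_zero _), evalAt_scale (E_ne_zero _), evalAt_scale (E_ne_zero _),
      evalAt_starL hx, h2, Complex.mul_conj]
    ring
  have hE1 : ∀ x : ℝ, thetaProd τ β ((x + 1 : ℝ) : ℂ) = thetaProd τ β x := fun x => by
    have := (isTheta_prod (τ := τ) hi β (s := s) ⟨0, by rw [hF.sum_eq]; simp⟩ 1).add_one x
    simpa using this
  have i0 := forall_integral_pos_iff (continuous_weight hτ hi hbd hf.diff) (fun x => by
    rw [hE1, Complex.ofReal_add, Complex.ofReal_one, hf.add_one])
  have i1 := forall_integral_pos_iff (φ := fun x : ℝ => Complex.exp (-(Real.pi * I * c)) * V x)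
    (continuous_const.mul hVc) (fun x => by
      rw [Complex.ofReal_add, Complex.ofReal_one, hV1])
  have hscale : ∀ p : ℂ[T;T⁻¹] → Prop, (∀ R ≠ 0, p (scale q R)) ↔ ∀ R ≠ 0, p R := fun p =>
    ⟨fun h R hR => by
      obtain ⟨S, rfl⟩ := scale_surjective q R
      exact h S fun h0 => hR (by rw [h0, map_zero]), fun h R hR => h _ (scale_ne_zero q hR)⟩
  simp only [e0, e1]
  rw [hscale (fun R => 0 < ∫ x in (0 : ℝ)..1, (Complex.normSq (evalAt R (E x)) : ℂ) *
        (Complex.exp (-(Real.pi * I * c)) * V x)), i0, i1]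
  have c0 : ∀ x : ℝ, 0 ≤ f x / thetaProd τ β x ↔ 0 ≤ f x := fun x => by
    constructor
    · intro h
      have := mul_nonneg h (hpos x).le
      rwa [div_mul_cancel₀ _ (hpos x).ne'] at this
    · intro h
      rw [div_eq_mul_inv]
      exact mul_nonneg h (inv_pos.2 (hpos x)).le
  have c1 : ∀ x : ℝ, 0 ≤ Complex.exp (-(Real.pi * I * c)) * V x ↔
      0 ≤ Complex.exp (Real.pi * I * (n * x - (s + c + m : ℝ))) * f (x + τ / 2) := fun x => by
    have h1 : (0 : ℂ) < r x := by exact_mod_cast hr x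
    rw [hVr]
    constructor
    · intro h
      have := mul_nonneg (inv_pos.2 h1).le h
      rwa [inv_mul_cancel_left₀ h1.ne'] at this
    · exact mul_nonneg h1.le
  simp only [c0, c1]
  constructor
  · rintro ⟨⟨h1, x, hx⟩, h2, -⟩
    exact ⟨fun h0 => hx (by rw [h0]; simp), hf, fun x => ⟨h1 x, h2 x⟩⟩
  · rintro ⟨h0, -, h⟩
    refine ⟨⟨fun x => (h x).1, ?_⟩, fun x => (h x).2, ?_⟩
    · by_contra! h3
      refine h0 (eq_of_eq_ofReal hf.diff (differentiable_const 0) fun x => ?_)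
      have := h3 x
      rwa [div_eq_zero_iff, or_iff_left (hpos x).ne'] at this
    · by_contra! h3
      refine h0 (funext fun z => ?_)
      have hd : Differentiable ℂ fun z => f (z + τ / 2) := by
        have := hf.diff; fun_prop
      have := congrFun (eq_of_eq_ofReal hd (differentiable_const 0) fun x => by
        have := h3 x
        rw [hVr, mul_eq_zero, mul_eq_zero] at this
        have hrx : (r x : ℂ) ≠ 0 := by exact_mod_cast (hr x).ne'
        rcases this with h | h | h
        · exact absurd h hrx
        · exact absurd h (Complex.exp_ne_zero _)
        · exact h) (z - τ / 2)
      simpa using this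

end weight

/-! ### A twisted trace is determined by finitely many moments -/

section moments
variable {g : Polynomial ℂ} {X : ℂ[T;T⁻¹] →ₗ[ℂ] ℂ}

lemma apply_toLaurent_eq_zero (hg : g ≠ 0) (h : ∀ M, X (Polynomial.toLaurent g * M) = 0)
    (h0 : ∀ k : ℕ, k < g.natDegree → X (.T k) = 0) (Q : Polynomial ℂ) :
    X (Polynomial.toLaurent Q) = 0 := by
  rw [← EuclideanDomain.div_add_mod Q g, map_add, map_mul, map_add, h, zero_add]
  have hd := Polynomial.degree_mod_lt Q hg
  by_cases hz : Q % g = 0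
  · rw [hz, map_zero, map_zero]
  · have hd' := Polynomial.natDegree_lt_natDegree hz hd
    rw [(Q % g).as_sum_range_C_mul_X_pow, map_sum, map_sum]
    refine Finset.sum_eq_zero fun k hk => ?_
    rw [Polynomial.toLaurent_C_mul_X_pow, ← LaurentPolynomial.smul_eq_C_mul, map_smul,
      h0 k (by have := Finset.mem_range.1 hk; omega), smul_zero]

/-- Division with remainder by g handles polynomials. Because g has a nonzero constant term, the
vanishing window of moments can also be moved to negative exponents one step at a time. -/
theorem eq_zero_of_lowMoments (hg : g.coeff 0 ≠ 0) (h : ∀ M, X (Polynomial.toLaurent g * M) = 0)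
    (h0 : ∀ k : ℕ, k < g.natDegree → X (.T k) = 0) : X = 0 := by
  have hg0 : g ≠ 0 := by rintro rfl; simp at hg
  have step : ∀ Y : ℂ[T;T⁻¹] →ₗ[ℂ] ℂ, (∀ M, Y (Polynomial.toLaurent g * M) = 0) →
      (∀ k : ℕ, k < g.natDegree → Y (.T k) = 0) → ∀ k : ℕ, k < g.natDegree → Y (.T (k - 1)) = 0 := by
    intro Y hY hY0 k hk
    rcases Nat.eq_zero_or_pos k with rfl | hk0
    · have h1 := hY (.T (-1))
      conv at h1 => rw [← g.divX_mul_X_add]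
      rw [map_add, map_mul Polynomial.toLaurent, Polynomial.toLaurent_X, Polynomial.toLaurent_C, add_mul, mul_assoc,
        ← LaurentPolynomial.T_add, add_neg_cancel, LaurentPolynomial.T_zero, mul_one, map_add,
        apply_toLaurent_eq_zero hg0 hY hY0, zero_add, ← LaurentPolynomial.smul_eq_C_mul, map_smul,
        smul_eq_mul] at h1
      simpa using (mul_eq_zero.1 h1).resolve_left hg
    · have := hY0 (k - 1) (by omega)
      rwa [Nat.cast_sub hk0, Nat.cast_one] at this
  have all : ∀ r : ℕ, ∀ k : ℕ, k < g.natDegree → X (.T (-r) * .T k) = 0 := by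
    intro r
    induction r with
    | zero => intro k hk; simpa using h0 k hk
    | succ r ih =>
      intro k hk
      have := step (X ∘ₗ LinearMap.mulLeft ℂ (.T (-r))) (fun M => by
        rw [LinearMap.comp_apply, LinearMap.mulLeft_apply, mul_left_comm]; exact h _) ih k hk
      rw [LinearMap.comp_apply, LinearMap.mulLeft_apply, ← LaurentPolynomial.T_add] at this
      rw [← LaurentPolynomial.T_add]
      rw [← this]; congr 2; push_cast; ring
  refine LinearMap.ext fun R => ?_
  obtain ⟨r, Q, hQ⟩ := LaurentPolynomial.exists_T_pow R
  have := apply_toLaurent_eq_zero (X := X ∘ₗ LinearMap.mulLeft ℂ (.T (-r))) hg0 (fun M => by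
    rw [LinearMap.comp_apply, LinearMap.mulLeft_apply, mul_left_comm]; exact h _) (all r) Q
  rw [LinearMap.comp_apply, LinearMap.mulLeft_apply, hQ, mul_left_comm, ← LaurentPolynomial.T_add,
    neg_add_cancel, LaurentPolynomial.T_zero, mul_one] at this
  exact this

lemma IsFactorization.exists_polynomial {P : ℂ[T;T⁻¹]} {n : ℕ} {β : Fin n → ℂ} {s : ℝ} {m : ℕ}
    {p : ℂ} (hF : IsFactorization P β s m p) {k : ℕ} (hk : n = 2 * k) :
    ∃ g : Polynomial ℂ, g.coeff 0 ≠ 0 ∧ g.natDegree = n ∧ Polynomial.toLaurent g = P * .T k := by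
  have hp : p ≠ 0 := by
    rintro rfl
    have := hF.pos
    simp at this
  refine ⟨Polynomial.C p * ∏ j, (Polynomial.X + Polynomial.C (E (β j))), ?_, ?_, ?_⟩
  · rw [Polynomial.coeff_zero_eq_eval_zero, Polynomial.eval_mul, Polynomial.eval_prod]
    simp [hp, Finset.prod_ne_zero_iff]
  · rw [Polynomial.natDegree_C_mul hp,
      Polynomial.natDegree_prod_of_monic _ _ fun j _ => Polynomial.monic_X_add_C _]
    simp
  · refine eq_of_evalAt_E fun x => ?_
    rw [evalAt_toLaurent (E_ne_zero _), evalAt_mul (E_ne_zero _), evalAt_T (E_ne_zero _),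
      hF.evalAt_eq, Polynomial.eval_mul, Polynomial.eval_prod, Polynomial.eval_C]
    have e1 : ∏ j, Polynomial.eval (E x) (Polynomial.X + Polynomial.C (E (β j))) =
        E x ^ n * ∏ j, (1 + E (β j - x)) := by
      rw [← Fin.prod_const, ← Finset.prod_mul_distrib]
      refine Finset.prod_congr rfl fun j _ => ?_
      have := E_ne_zero x
      rw [Polynomial.eval_add, Polynomial.eval_X, Polynomial.eval_C, E_sub]
      field_simp
    have e2 : Complex.exp (Real.pi * I * (n * x)) = E x ^ k := by
      rw [E, ← Complex.exp_nat_mul, hk]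
      congr 1; push_cast; ring
    rw [e1, e2, zpow_natCast]
    subst hk
    ring

/-- The functional X(R) = L(R(q⁻¹z)) - tL(R(qz)) kills the multiples of P and has moments X(z^l) =
(q^{-l} - tq^l)L(z^l). Its first n moments vanish, so X = 0. For l ≠ 0 the factor is nonzero since
|q| < 1 = |t|, and L(1) = 0 is assumed. -/
theorem IsTwFun.eq_zero {P : ℂ[T;T⁻¹]} {n : ℕ} (hn : 0 < n) {β : Fin n → ℂ} {s : ℝ} {m : ℕ}
    {p : ℂ} (hF : IsFactorization P β s m p) (hev : ∃ k, n = 2 * k) {q : ℂˣ} (hq : ‖(q : ℂ)‖ < 1)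
    {t : ℂ} (ht : ‖t‖ = 1) {L : ℂ[T;T⁻¹] →ₗ[ℂ] ℂ} (hL : IsTwFun q P t L)
    (h0 : ∀ k : ℕ, k < n → L (.T k) = 0) : L = 0 := by
  obtain ⟨k, hk⟩ := hev
  obtain ⟨g, hg0, hgd, hg⟩ := hF.exists_polynomial hk
  have hX := eq_zero_of_lowMoments (X := L ∘ₗ (scale q⁻¹).toLinearMap -
    t • (L ∘ₗ (scale q).toLinearMap)) hg0 (fun M => by
      rw [hg, mul_assoc]; exact sub_eq_zero.2 (hL _))
    (fun k hk => by
      change L (scale q⁻¹ (.T k)) - t * L (scale q (.T k)) = 0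
      rw [scale_T, scale_T, map_smul, map_smul, h0 k (hgd ▸ hk)]
      simp)
  refine LinearMap.ext fun R => ?_
  induction R using laurent_induction with
  | add R S hR hS => rw [map_add, hR, hS, map_add]
  | smul_T a l =>
    rw [map_smul]
    by_cases hl : l = 0
    · subst hl
      have := h0 0 hn
      rw [Nat.cast_zero] at this
      rw [this, smul_zero]; rfl
    · have h1 : L (scale q⁻¹ (.T l)) - t * L (scale q (.T l)) = 0 := congrArg (fun F => F (.T l)) hX
      rw [scale_T, scale_T, map_smul, map_smul, smul_eq_mul, smul_eq_mul, ← mul_assoc, ← sub_mul] at h1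
      rw [(mul_eq_zero.1 h1).resolve_left, smul_zero]
      · rfl
      · intro h
        have h2 := congrArg norm (sub_eq_zero.1 h)
        rw [norm_mul, ht, one_mul, inv_zpow, Units.val_inv_eq_inv_val, norm_inv,
          Units.val_zpow_eq_zpow_val, norm_zpow] at h2
        have hq0 : 0 < ‖(q : ℂ)‖ := norm_pos_iff.2 q.ne_zero
        have h3 : ‖(q : ℂ)‖ ^ (l + l) = 1 := by
          rw [zpow_add₀ hq0.ne']
          nth_rewrite 1 [← h2]
          exact inv_mul_cancel₀ (zpow_ne_zero _ hq0.ne')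
        rw [zpow_eq_one_iff_right₀ hq0.le hq.ne] at h3
        omega

end moments

/-! ### Every twisted trace is given by a quasi-periodic function -/

/-- The space of quasi-periodic functions. -/
def thetaSpace (τ : ℂ) (n : ℕ) (s : ℝ) : Submodule ℂ (ℂ → ℂ) where
  carrier := {f | IsTheta τ n s f}
  add_mem' hf hg := hf.add hg
  zero_mem' := ⟨differentiable_const 0, by simp, by simp⟩
  smul_mem' c _ hf := hf.smul c

lemma norm_lt_one_of_eq_E {τ : ℂ} (hi : 0 < τ.im) {q : ℂˣ} (hq : (q : ℂ) = E (τ / 2)) :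
    ‖(q : ℂ)‖ < 1 := by
  rw [hq, norm_E, Real.exp_lt_one_iff, Complex.div_ofNat_im]
  have := Real.pi_pos
  have := mul_pos this hi
  linarith

lemma norm_exp_two_pi (c : ℝ) : ‖Complex.exp (2 * Real.pi * I * c)‖ = 1 := norm_E_ofReal c

section surjectivity
variable {τ : ℂ} (hτ : τ.re = 0) (hi : 0 < τ.im) {n : ℕ} {β : Fin n → ℂ}
  (hbd : ∀ j, |(β j).im| < τ.im / 2)

/-- The functional given by `f / (θ(z-β₁) ⋯ θ(z-βₙ))`. -/
def thetaFun (s : ℝ) : thetaSpace τ n s →ₗ[ℂ] (ℂ[T;T⁻¹] →ₗ[ℂ] ℂ) where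
  toFun f := intFun _ (continuous_weight hτ hi hbd f.2.diff)
  map_add' f g := LinearMap.ext fun R => by
    have h1 := (continuous_evalAt_E R).mul (continuous_weight hτ hi hbd f.2.diff)
    have h2 := (continuous_evalAt_E R).mul (continuous_weight hτ hi hbd g.2.diff)
    refine Eq.trans (intervalIntegral.integral_congr fun x _ => ?_)
      (intervalIntegral.integral_add (h1.intervalIntegrable _ _) (h2.intervalIntegrable _ _))
    simp [add_div, mul_add]
  map_smul' c f := LinearMap.ext fun R => by
    refine Eq.trans (intervalIntegral.integral_congr fun x _ => ?_)
      (intervalIntegral.integral_const_mul c _)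
    simp only [Submodule.coe_smul, Pi.smul_apply, smul_eq_mul]
    ring

/-- The first `n` moments of `f / (θ(z-β₁) ⋯ θ(z-βₙ))`. -/
def momentMap (s : ℝ) : thetaSpace τ n s →ₗ[ℂ] (Fin n → ℂ) :=
  LinearMap.pi fun k => LinearMap.applyₗ (.T (k : ℕ)) ∘ₗ thetaFun hτ hi hbd s

lemma eq_zero_of_intFun_eq_zero {s₀ s : ℝ} (hs : ∑ j, β j = s₀) {f : ℂ → ℂ} (hf : IsTheta τ n s f)
    (h : intFun _ (continuous_weight hτ hi hbd hf.diff) = 0) : f = 0 := by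
  have hθ := (isTheta_prod (τ := τ) hi β (s := s₀) ⟨0, by rw [hs]; simp⟩ 1).add_one
  simp only [one_mul] at hθ
  have h0 := eq_zero_of_moments (continuous_weight hτ hi hbd hf.diff)
    (fun x => by rw [Complex.ofReal_add, Complex.ofReal_one, hf.add_one, hθ])
    (fun R => congrArg (fun F => F R) h)
  refine eq_of_eq_ofReal hf.diff (differentiable_const 0) fun x => ?_
  have := h0 x
  rwa [div_eq_zero_iff, or_iff_left (thetaProd_ne_zero_of_real hτ hi hbd x)] at this

variable {P : ℂ[T;T⁻¹]} {s c : ℝ} {m : ℕ} {p : ℂ} {q : ℂˣ} (hq : (q : ℂ) = E (τ / 2))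
variable (hn : 0 < n) (hev : ∃ k, n = 2 * k) (hF : IsFactorization P β s m p)
include hτ hi hbd hq hn hev hF

lemma momentMap_injective : Function.Injective (momentMap hτ hi hbd (s + c + m)) := by
  rw [injective_iff_map_eq_zero]
  intro f hf
  refine Subtype.ext (eq_zero_of_intFun_eq_zero hτ hi hbd hF.sum_eq f.2 ?_)
  exact (isTwFun_intFun hτ hi hbd hq hev hF f.2).eq_zero hn hF hev (norm_lt_one_of_eq_E hi hq)
    (norm_exp_two_pi c) fun k hk => congrFun hf ⟨k, hk⟩

/-- The upper bound comes from injectivity of the first n moments, the lower bound from the explicit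
independent family; no count of zeros is needed. -/
lemma finrank_thetaSpace : Module.Finite ℂ (thetaSpace τ n (s + c + m)) ∧
    Module.finrank ℂ (thetaSpace τ n (s + c + m)) = n := by
  have hinj := momentMap_injective hτ hi hbd hq hn hev hF (c := c)
  have hfin := Module.Finite.of_injective _ hinj
  refine ⟨hfin, le_antisymm ?_ ?_⟩
  · simpa using LinearMap.finrank_le_finrank_of_injective hinj
  · have : LinearIndependent ℂ fun j : Fin n =>
        (⟨thetaBasis τ n (s + c + m) j, isTheta_thetaBasis hi j⟩ : thetaSpace τ n (s + c + m)) :=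
      LinearIndependent.of_comp (thetaSpace τ n (s + c + m)).subtype
        (linearIndependent_thetaBasis hτ hi)
    simpa using this.fintype_card_le_finrank

theorem mem_span_thetaBasis {f : ℂ → ℂ} (hf : IsTheta τ n (s + c + m) f) :
    f ∈ Submodule.span ℂ (Set.range (thetaBasis τ n (s + c + m))) := by
  obtain ⟨hfin, hrank⟩ := finrank_thetaSpace hτ hi hbd hq hn hev hF (c := c)
  have hli : LinearIndependent ℂ fun j : Fin n =>
      (⟨thetaBasis τ n (s + c + m) j, isTheta_thetaBasis hi j⟩ : thetaSpace τ n (s + c + m)) :=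
    LinearIndependent.of_comp (thetaSpace τ n (s + c + m)).subtype
      (linearIndependent_thetaBasis hτ hi)
  have hspan := hli.span_eq_top_of_card_eq_finrank' (by simp [hrank])
  have h1 : (⟨f, hf⟩ : thetaSpace τ n (s + c + m)) ∈ Submodule.span ℂ (Set.range fun j : Fin n =>
      (⟨thetaBasis τ n (s + c + m) j, isTheta_thetaBasis hi j⟩ : thetaSpace τ n (s + c + m))) := by
    rw [hspan]; trivial
  have h2 := Submodule.mem_map_of_mem (f := (thetaSpace τ n (s + c + m)).subtype) h1
  rw [Submodule.map_span, ← Set.range_comp] at h2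
  exact h2

/-- The injective map to the first n moments is onto by dimension, so some f has the moments of L.
The difference of the two functionals satisfies the trace condition with vanishing moments, hence is
zero. -/
theorem exists_eq_intFun {L : ℂ[T;T⁻¹] →ₗ[ℂ] ℂ}
    (hL : IsTwFun q P (Complex.exp (2 * Real.pi * I * c)) L) :
    ∃ (f : ℂ → ℂ) (hf : IsTheta τ n (s + c + m) f),
      L = intFun _ (continuous_weight hτ hi hbd hf.diff) := by
  obtain ⟨hfin, hrank⟩ := finrank_thetaSpace hτ hi hbd hq hn hev hF (c := c)
  have hinj := momentMap_injective hτ hi hbd hq hn hev hF (c := c)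
  obtain ⟨f, hf⟩ := (LinearMap.injective_iff_surjective_of_finrank_eq_finrank (by simp [hrank])).1
    hinj fun k => L (.T (k : ℕ))
  refine ⟨f, f.2, sub_eq_zero.1 ?_⟩
  have hf' := isTwFun_intFun hτ hi hbd hq hev hF f.2
  refine IsTwFun.eq_zero hn hF hev (norm_lt_one_of_eq_E hi hq) (norm_exp_two_pi c)
    (fun M => ?_) fun k hk => ?_
  · rw [LinearMap.sub_apply, LinearMap.sub_apply, hL, hf']; ring
  · rw [LinearMap.sub_apply, sub_eq_zero]
    exact (congrFun hf ⟨k, hk⟩).symm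

end surjectivity

/-! ### The isomorphism of cones -/

lemma IsFactorization.ne_zero {P : ℂ[T;T⁻¹]} {n : ℕ} {β : Fin n → ℂ} {s : ℝ} {m : ℕ} {p : ℂ}
    (hF : IsFactorization P β s m p) (hev : ∃ k, n = 2 * k) : P ≠ 0 := by
  rintro rfl
  obtain ⟨k, hk⟩ := hev
  obtain ⟨g, hg0, -, hg⟩ := hF.exists_polynomial hk
  rw [zero_mul, Polynomial.toLaurent_eq_zero] at hg
  rw [hg] at hg0
  simp at hg0

lemma zpow_two_mul_ne_one {τ : ℂ} (hi : 0 < τ.im) {q : ℂˣ} (hq : (q : ℂ) = E (τ / 2)) (i : ℤ)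
    (h : i ≠ 0) : (q : ℂ) ^ (2 * i) ≠ 1 := fun h1 => by
  have h2 := congrArg norm h1
  have hq0 : 0 < ‖(q : ℂ)‖ := norm_pos_iff.2 q.ne_zero
  rw [norm_zpow, norm_one, zpow_eq_one_iff_right₀ hq0.le (norm_lt_one_of_eq_E hi hq).ne] at h2
  omega

lemma isTheta_of_mem {τ : ℂ} {n : ℕ} {s : ℝ} {f : ℂ → ℂ} (hf : f ∈ posTheta τ n s) :
    IsTheta τ n s f := hf.2.1

section cones
variable {τ : ℂ} (hτ : τ.re = 0) (hi : 0 < τ.im) {n : ℕ} {β : Fin n → ℂ}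
  (hbd : ∀ j, |(β j).im| < τ.im / 2) {P : ℂ[T;T⁻¹]} {s c : ℝ} {m : ℕ} {p : ℂ} {q : ℂˣ}
  (hq : (q : ℂ) = E (τ / 2)) (hn : 0 < n) (hev : ∃ k, n = 2 * k) (hF : IsFactorization P β s m p)
  (hP : starL P = P)

/-- The trace given by `f / (θ(z-β₁) ⋯ θ(z-βₙ))`. -/
def thetaTrace (q : ℂˣ) (P : ℂ[T;T⁻¹]) (s : ℝ) : thetaSpace τ n s →ₗ[ℂ] (Alg q P →ₗ[ℂ] ℂ) :=
  LinearMap.lcomp ℂ ℂ (comp0 q P) ∘ₗ thetaFun hτ hi hbd s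

lemma thetaTrace_apply (s : ℝ) (f : thetaSpace τ n s) :
    thetaTrace hτ hi hbd q P s f =
      traceOf q P (intFun _ (continuous_weight hτ hi hbd f.2.diff)) := rfl

include hF in
lemma thetaTrace_injective (hev : ∃ k, n = 2 * k) (s : ℝ) :
    Function.Injective (thetaTrace hτ hi hbd q P s) := by
  rw [injective_iff_map_eq_zero]
  intro f hf
  refine Subtype.ext (eq_zero_of_intFun_eq_zero hτ hi hbd hF.sum_eq f.2 (LinearMap.ext fun R => ?_))
  rw [← traceOf_laurentHom (q := q) (hF.ne_zero hev), ← thetaTrace_apply hτ hi hbd, hf]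
  rfl

include hτ hq in
lemma conj_eq_of_eq_E : (starRingEnd ℂ) (q : ℂ) = q := by
  rw [hq, conj_E, map_div₀, conj_tau hτ, Complex.conj_ofNat]
  congr 1
  ring

include hF hev in
lemma isConeIso_of_eq_thetaTrace {e : positiveTraces q P c ≃ posTheta τ n (s + c + m)}
    (he : ∀ T : positiveTraces q P c, (T : Alg q P →ₗ[ℂ] ℂ) = thetaTrace hτ hi hbd q P _ ⟨e T, isTheta_of_mem (e T).2⟩) :
    IsConeIso e ∧ IsConeIso e.symm := by
  have hinj := thetaTrace_injective hτ hi hbd hF hev (q := q) (s + c + m)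
  have hsmul : ∀ (r : ℝ) (f : thetaSpace τ n (s + c + m)), thetaTrace hτ hi hbd q P _ (r • f) =
      r • thetaTrace hτ hi hbd q P _ f := fun r f => map_smul _ (r : ℂ) f
  have he' : ∀ f : posTheta τ n (s + c + m), (e.symm f : Alg q P →ₗ[ℂ] ℂ) = thetaTrace hτ hi hbd q P _ ⟨f, isTheta_of_mem f.2⟩ := fun f => by
    have := he (e.symm f)
    rw [this]
    exact congrArg _ (Subtype.ext (congrArg
      (fun g : posTheta τ n (s + c + m) => (g : ℂ → ℂ)) (e.apply_symm_apply f)))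
  refine ⟨⟨fun x y z h => ?_, fun r hr x y h => ?_⟩, ⟨fun x y z h => ?_, fun r hr x y h => ?_⟩⟩
  · rw [he x, he y, he z, ← map_add] at h
    exact congrArg Subtype.val (hinj h)
  · rw [he x, he y, ← hsmul] at h
    exact congrArg Subtype.val (hinj h)
  · rw [he' x, he' y, he' z, ← map_add]
    exact congrArg _ (Subtype.ext h)
  · rw [he' x, he' y, ← hsmul]
    exact congrArg _ (Subtype.ext h)

include hq hev hF

lemma isGivenBy_thetaTrace (f : thetaSpace τ n (s + c + m)) :
    IsGivenBy (thetaTrace hτ hi hbd q P _ f) fun z => (f : ℂ → ℂ) z / thetaProd τ β z := by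
  have h0 := hF.ne_zero hev
  refine ⟨fun i hi' a ha => ?_, fun R => ?_⟩
  · exact (isTwistedTrace_traceOf h0 (Complex.exp_ne_zero _)
      (isTwFun_intFun hτ hi hbd hq hev hF f.2)).eq_zero (zpow_two_mul_ne_one hi hq i hi') ha
  · rw [ofLaurent_eq, thetaTrace_apply, traceOf_laurentHom h0]
    rfl

include hn in
lemma exists_eq_thetaTrace {T : Alg q P →ₗ[ℂ] ℂ} (hT : T ∈ positiveTraces q P c) :
    ∃ f : thetaSpace τ n (s + c + m), T = thetaTrace hτ hi hbd q P _ f := by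
  have h0 := hF.ne_zero hev
  obtain ⟨f, hf, h⟩ := exists_eq_intFun hτ hi hbd hq hn hev hF hT.1.isTwFun
  exact ⟨⟨f, hf⟩, (hT.1.eq_traceOf h0 (zpow_two_mul_ne_one hi hq)).trans (congrArg _ h)⟩

include hP

lemma thetaTrace_mem_positiveTraces_iff (f : thetaSpace τ n (s + c + m)) :
    thetaTrace hτ hi hbd q P _ f ∈ positiveTraces q P c ↔
      (f : ℂ → ℂ) ∈ posTheta τ n (s + c + m) := by
  have h0 := hF.ne_zero hev
  have hT := isTwistedTrace_traceOf h0 (Complex.exp_ne_zero _)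
    (isTwFun_intFun hτ hi hbd hq hev hF f.2)
  rw [← intFun_positive_iff hτ hi hbd hq hev hF f.2, ← isPositive_traceOf_iff h0 hP
    (conj_eq_of_eq_E hτ hq) (zpow_two_mul_ne_one hi hq) hT]
  exact and_iff_right hT

include hτ hi hbd hn

theorem exists_coneEquiv : ∃ e : positiveTraces q P c ≃ posTheta τ n (s + c + m),
    ∀ T : positiveTraces q P c, (T : Alg q P →ₗ[ℂ] ℂ) = thetaTrace hτ hi hbd q P _ ⟨e T, isTheta_of_mem (e T).2⟩ := by
  let g : posTheta τ n (s + c + m) → positiveTraces q P c := fun f =>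
    ⟨thetaTrace hτ hi hbd q P _ ⟨f, isTheta_of_mem f.2⟩,
      (thetaTrace_mem_positiveTraces_iff hτ hi hbd hq hev hF hP _).2 f.2⟩
  have hg : Function.Bijective g := by
    refine ⟨fun f₁ f₂ h => ?_, fun T => ?_⟩
    · have := thetaTrace_injective hτ hi hbd hF hev _ (congrArg Subtype.val h)
      exact Subtype.ext (congrArg (fun f : thetaSpace τ n (s + c + m) => (f : ℂ → ℂ)) this)
    · obtain ⟨f, hf⟩ := exists_eq_thetaTrace hτ hi hbd hq hn hev hF T.2
      have := (thetaTrace_mem_positiveTraces_iff hτ hi hbd hq hev hF hP f).1 (hf ▸ T.2)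
      exact ⟨⟨f, this⟩, Subtype.ext hf.symm⟩
  refine ⟨(Equiv.ofBijective g hg).symm, fun T => ?_⟩
  exact (congrArg Subtype.val ((Equiv.ofBijective g hg).apply_symm_apply T)).symm

/-- The injective linear map from theta functions to traces carries the cone of f onto the positive
traces, so the spans correspond. -/
theorem rank_span_positiveTraces :
    Module.rank ℝ (Submodule.span ℝ (positiveTraces q P c)) = n := by
  obtain ⟨k, rfl⟩ := id hev
  let ι : realTheta τ (2 * k) (s + c + m) →ₗ[ℝ] thetaSpace τ (2 * k) (s + c + m) :=
    { toFun := fun f => ⟨f, f.2.1⟩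
      map_add' := fun _ _ => rfl
      map_smul' := fun _ _ => rfl }
  let G : realTheta τ (2 * k) (s + c + m) →ₗ[ℝ] (Alg q P →ₗ[ℂ] ℂ) :=
    (thetaTrace hτ hi hbd q P _).restrictScalars ℝ ∘ₗ ι
  have hG : Function.Injective G := fun f₁ f₂ h =>
    Subtype.ext (congrArg (fun f : thetaSpace τ (2 * k) (s + c + m) => (f : ℂ → ℂ))
      (thetaTrace_injective hτ hi hbd hF hev _ h))
  have hpos : ∀ f : realTheta τ (2 * k) (s + c + m), (f : ℂ → ℂ) ∈ posTheta τ (2 * k) (s + c + m) →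
      G f ∈ positiveTraces q P c := fun f hf =>
    (thetaTrace_mem_positiveTraces_iff hτ hi hbd hq hev hF hP (ι f)).2 hf
  have hspan : Submodule.span ℝ (positiveTraces q P c) = LinearMap.range G := by
    apply le_antisymm
    · refine Submodule.span_le.2 fun T hT => ?_
      obtain ⟨f, rfl⟩ := exists_eq_thetaTrace hτ hi hbd hq hn hev hF hT
      have := (thetaTrace_mem_positiveTraces_iff hτ hi hbd hq hev hF hP f).1 hT
      exact ⟨⟨f, posTheta_subset_realTheta this⟩, rfl⟩
    · rintro _ ⟨⟨f, hf⟩, rfl⟩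
      have hf' := hf
      rw [← span_posTheta hτ hi (by omega)] at hf'
      suffices h : ∃ hf : f ∈ realTheta τ (2 * k) (s + c + m),
          G ⟨f, hf⟩ ∈ Submodule.span ℝ (positiveTraces q P c) from h.2
      clear hf
      induction hf' using Submodule.span_induction with
      | mem f hf => exact ⟨posTheta_subset_realTheta hf, Submodule.subset_span (hpos _ hf)⟩
      | zero => exact ⟨Submodule.zero_mem _, by convert Submodule.zero_mem _; exact G.map_zero⟩
      | add f₁ f₂ _ _ h₁ h₂ =>
        obtain ⟨h₁, g₁⟩ := h₁
        obtain ⟨h₂, g₂⟩ := h₂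
        exact ⟨Submodule.add_mem _ h₁ h₂, by
          convert Submodule.add_mem _ g₁ g₂
          exact G.map_add ⟨f₁, h₁⟩ ⟨f₂, h₂⟩⟩
      | smul r f _ h =>
        obtain ⟨h, g⟩ := h
        exact ⟨Submodule.smul_mem _ r h, by
          convert Submodule.smul_mem _ r g
          exact G.map_smul r ⟨f, h⟩⟩
  rw [hspan, rank_range_of_injective G hG, rank_realTheta hτ hi fun f hf =>
    mem_span_thetaBasis hτ hi hbd hq hn hev hF hf]

end cones

/-! ### The two descriptions of the cone of quasi-periodic functions -/

/-- The parameters s, c and m enter only through their sum: in the multiplier under τ, m contributes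
e^{2πim} = 1, so only the sign condition on ℝ+τ/2 detects its parity. -/
lemma thetaCone_eq (τ : ℂ) (n : ℕ) (s c : ℝ) (m : ℕ) :
    thetaCone τ n s c m = posTheta τ n (s + c + m) := by
  have h1 : ∀ x : ℂ, Complex.exp (-(Real.pi * I * (2 * n * x + n * τ - 2 * s - 2 * c))) =
      Complex.exp (-(Real.pi * I * (2 * n * x + n * τ - 2 * (s + c + m : ℝ)))) := fun x => by
    rw [← mul_one (Complex.exp (-(Real.pi * I * (2 * n * x + n * τ - 2 * s - 2 * c)))),
      ← Complex.exp_int_mul_two_pi_mul_I m, ← Complex.exp_add]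
    congr 1; push_cast; ring
  have h2 : ∀ x : ℝ, (n * x - s - m - c : ℂ) = n * x - (s + c + m : ℝ) := fun x => by
    push_cast; ring
  ext f
  simp only [thetaCone, posTheta, Set.mem_ofPred_eq, h1, h2]
  exact ⟨fun ⟨a, b, c, d, e⟩ => ⟨a, ⟨b, c, d⟩, e⟩, fun ⟨a, ⟨b, c, d⟩, e⟩ => ⟨a, b, c, d, e⟩⟩

theorem range_div_thetaProd {τ : ℂ} (hτ : τ.re = 0) (hi : 0 < τ.im) {k : ℕ} {β : Fin (2 * k) → ℂ}
    {s c : ℝ} {m : ℕ} (hs : ∑ j, β j = s) :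
    (fun f : ℂ → ℂ => fun z => f z / thetaProd τ β z) '' posTheta τ (2 * k) (s + c + m) =
      thetaQuotients τ β c m := by
  ext w
  constructor
  · rintro ⟨f, hf, rfl⟩
    obtain ⟨r, b, hr, ⟨l, hl⟩, h⟩ := exists_theta_factorization hτ hi k _ f hf
    obtain ⟨a, σ, hσ, hsum, hprod⟩ := exists_pairing b
    refine ⟨r, a, σ, hr, ⟨l, ?_⟩, hσ, funext fun z => ?_⟩
    · rw [hsum, hs]
      have : ((∑ i, 2 * (b i).re - (s + c + m) : ℝ) : ℂ) = ((2 * l : ℝ) : ℂ) := by rw [hl]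
      push_cast at this ⊢
      linear_combination this
    · have : thetaProd τ a z = _ := hprod fun x => jacobiTheta₂ (z - x) τ
      rw [this, ← mul_div_assoc, ← h]
  · rintro ⟨r, a, σ, hr, ⟨l, hl⟩, hσ, rfl⟩
    refine ⟨_, theta_prod_mem_posTheta hτ hi a σ hσ (s := s + c + m) ⟨l, ?_⟩ hr, funext fun z => ?_⟩
    · rw [← hl, hs]; push_cast; ring
    · exact mul_div_assoc _ _ _

/-- Translation by (s-s')/n carries characteristic s to s', and the opposite translation is its
inverse. -/
lemma exists_translation_equiv (τ : ℂ) {n : ℕ} (hn : 0 < n) (s s' : ℝ) :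
    ∃ e : posTheta τ n s ≃ posTheta τ n s', IsConeIso e := by
  have hn' : (n : ℝ) ≠ 0 := by exact_mod_cast hn.ne'
  have h1 : s - n * ((s - s') / n) = s' := by field_simp; ring
  have h2 : s' - n * ((s' - s) / n) = s := by field_simp; ring
  have h3 : (((s - s') / n : ℝ) : ℂ) + ((s' - s) / n : ℝ) = 0 := by
    rw [← Complex.ofReal_add, ← add_div]; simp
  refine ⟨⟨fun f => ⟨_, h1 ▸ translate_mem_posTheta f.2 ((s - s') / n)⟩,
    fun f => ⟨_, h2 ▸ translate_mem_posTheta f.2 ((s' - s) / n)⟩, fun f => ?_, fun f => ?_⟩,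
    fun x y z h => ?_, fun r _ x y h => ?_⟩
  · refine Subtype.ext (funext fun z => ?_)
    change (f : ℂ → ℂ) (z + _ + _) = _
    rw [add_assoc, add_comm (((s' - s) / n : ℝ) : ℂ), h3, add_zero]
  · refine Subtype.ext (funext fun z => ?_)
    change (f : ℂ → ℂ) (z + _ + _) = _
    rw [add_assoc, h3, add_zero]
  · exact funext fun w => congrFun h _
  · exact funext fun w => congrFun h _

lemma IsConeIso.trans {U V W : Type*} [AddCommGroup U] [Module ℝ U] [AddCommGroup V] [Module ℝ V]
    [AddCommGroup W] [Module ℝ W] {B : Set U} {C : Set V} {D : Set W} {e : B ≃ C} {e' : C ≃ D}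
    (h : IsConeIso e) (h' : IsConeIso e') : IsConeIso (e.trans e') :=
  ⟨fun x y z hz => h'.1 _ _ _ (h.1 x y z hz), fun r hr x y hy => h'.2 r hr _ _ (h.2 r hr x y hy)⟩

lemma exists_fin_map_eq {S : Multiset ℂ} {n : ℕ} (hn : S.card = n) :
    ∃ a : Fin n → ℂ, Finset.univ.val.map a = S := by
  obtain ⟨l, rfl⟩ : ∃ l : List ℂ, (l : Multiset ℂ) = S := ⟨S.toList, S.coe_toList⟩
  rw [Multiset.coe_card] at hn
  subst hn
  exact ⟨l.get, by rw [Fin.univ_val_map]; simp⟩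

lemma exists_E_eq {z : ℂ} (hz : z ≠ 0) : ∃ a : ℂ, (0 ≤ a.re ∧ a.re < 1) ∧ E a = z := by
  obtain ⟨a, rfl⟩ : ∃ a, E a = z := by
    refine ⟨Complex.log z / (2 * Real.pi * I), ?_⟩
    rw [E, mul_div_cancel₀ _ Complex.two_pi_I_ne_zero, Complex.exp_log hz]
  refine ⟨a - ⌊a.re⌋, ⟨?_, ?_⟩, ?_⟩
  · simp
  · simpa using Int.fract_lt_one a.re
  · rw [E_sub, E_int, div_one]

lemma exists_exponents (P : ℂ[T;T⁻¹]) {n : ℕ} (hn : (nonzeroRoots P).card = n) :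
    ∃ α : Fin n → ℂ, (∀ j, 0 ≤ (α j).re ∧ (α j).re < 1) ∧
      (Finset.univ.val.map fun j => E (α j)) = nonzeroRoots P := by
  obtain ⟨a, ha⟩ := exists_fin_map_eq hn
  have h0 : ∀ j, a j ≠ 0 := fun j h => zero_notMem_nonzeroRoots P (by
    rw [← ha, ← h]; exact Multiset.mem_map_of_mem _ (Finset.mem_univ j))
  choose α h1 h2 using fun j => exists_E_eq (h0 j)
  exact ⟨α, h1, by simp only [h2, ha]⟩

/-- The exponents are chosen here rather than given, so that the result applies to a second Laurent
polynomial of which only the roots are known. -/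
theorem exists_coneEquiv_posTheta {τ : ℂ} (hτ : τ.re = 0) (hi : 0 < τ.im) {q : ℂˣ}
    (hq : (q : ℂ) = E (τ / 2)) {P : ℂ[T;T⁻¹]} (hreal : RealOnCircle P)
    (hroots : RootsInAnnulus (Real.exp (-(Real.pi * τ.im))) P) {n : ℕ} (hn : 0 < n)
    (hcard : (nonzeroRoots P).card = n) (c : ℝ) :
    ∃ (s : ℝ) (e : positiveTraces q P c ≃ posTheta τ n s), IsConeIso e ∧ IsConeIso e.symm := by
  obtain ⟨α, hα, hαP⟩ := exists_exponents P hcard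
  obtain ⟨hev, s, p, hF⟩ := exists_isFactorization hreal hn hα hαP (β := fun j => α j + 1 / 2)
    fun _ => rfl
  have hbd := abs_im_lt_of_rootsInAnnulus hroots hαP (β := fun j => α j + 1 / 2) fun _ => rfl
  obtain ⟨e, he⟩ := exists_coneEquiv hτ hi hbd (c := c) hq hn hev hF hreal.starL_eq
  exact ⟨_, e, isConeIso_of_eq_thetaTrace hτ hi hbd hev hF he⟩

end QWeyl
end

/-! ### Assembly of the theorem. -/

theorem mainTheorem1 (q : ℝ) (hq0 : 0 < q) (hq1 : q < 1)
    (τ : ℂ) (hτ : τ.re = 0) (hqτ : (q : ℂ) = Complex.exp (Real.pi * Complex.I * τ))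
    (P : LaurentPolynomial ℂ) (hreal : QWeyl.RealOnCircle P) (hroots : QWeyl.RootsInAnnulus q P)
    (n : ℕ) (hn : 0 < n) (c : ℝ)
    (α β : Fin n → ℂ) (hα : ∀ j, 0 ≤ (α j).re ∧ (α j).re < 1)
    (hαP : (Finset.univ.val.map fun j => Complex.exp (2 * Real.pi * Complex.I * α j)) =
      QWeyl.nonzeroRoots P)
    (hβ : ∀ j, β j = α j + 1 / 2) :
    Module.rank ℝ (Submodule.span ℝ (QWeyl.positiveTraces q P c)) = n ∧
    (∃ e : QWeyl.positiveTraces q P c ≃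
        QWeyl.thetaCone τ n (∑ j, β j) c (QWeyl.signParam P β),
      QWeyl.IsConeIso e ∧
      (∀ T : QWeyl.positiveTraces q P c, QWeyl.IsGivenBy (T : QWeyl.Alg q P →ₗ[ℂ] ℂ)
        (fun z => (e T : ℂ → ℂ) z / QWeyl.thetaProd τ β z)) ∧
      (Set.range fun T : QWeyl.positiveTraces q P c =>
          fun z => (e T : ℂ → ℂ) z / QWeyl.thetaProd τ β z) =
        QWeyl.thetaQuotients τ β c (QWeyl.signParam P β)) ∧
    ∀ (Q : LaurentPolynomial ℂ) (d : ℝ), QWeyl.RealOnCircle Q → QWeyl.RootsInAnnulus q Q →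
      (QWeyl.nonzeroRoots Q).card = n →
      ∃ e : QWeyl.positiveTraces q P c ≃ QWeyl.positiveTraces q Q d, QWeyl.IsConeIso e := by
  have hqr : q = Real.exp (-(Real.pi * τ.im)) := by
    have e : Complex.exp (Real.pi * Complex.I * τ) = (Real.exp (-(Real.pi * τ.im)) : ℝ) := by
      rw [Complex.ofReal_exp]
      congr 1
      apply Complex.ext <;> simp [hτ]
    rw [e] at hqτ
    exact_mod_cast hqτ
  have hi : 0 < τ.im := by
    rw [hqr, Real.exp_lt_one_iff] at hq1
    have := Real.pi_pos
    by_contra h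
    nlinarith [not_lt.1 h]
  -- As a unit, q can rescale the variable of Laurent polynomials; q = e^{2πi(τ/2)} means that this
  -- rescaling is a shift by τ/2.
  let u : ℂˣ := Units.mk0 (q : ℂ) (by exact_mod_cast hq0.ne')
  have hu : (u : ℂ) = QWeyl.E (τ / 2) := by
    change (q : ℂ) = _
    rw [hqτ, QWeyl.E]
    congr 1
    ring
  rw [hqr] at hroots
  obtain ⟨hev, s, p, hF⟩ := QWeyl.exists_isFactorization hreal hn hα hαP hβ
  have hbd := QWeyl.abs_im_lt_of_rootsInAnnulus hroots hαP hβ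
  have hP := hreal.starL_eq
  have hcard : (QWeyl.nonzeroRoots P).card = n := by rw [← hαP]; simp
  refine ⟨QWeyl.rank_span_positiveTraces hτ hi hbd hu hn hev hF hP, ?_, fun Q d hQ hQr hQc => ?_⟩
  · obtain ⟨e, he⟩ := QWeyl.exists_coneEquiv hτ hi hbd (c := c) hu hn hev hF hP
    rw [hF.sum_eq, QWeyl.thetaCone_eq]
    refine ⟨e, (QWeyl.isConeIso_of_eq_thetaTrace hτ hi hbd hev hF he).1, fun T => ?_, ?_⟩
    · rw [he T]
      exact QWeyl.isGivenBy_thetaTrace hτ hi hbd hu hev hF _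
    · obtain ⟨k, rfl⟩ := hev
      rw [← QWeyl.range_div_thetaProd hτ hi hF.sum_eq]
      ext w
      constructor
      · rintro ⟨T, rfl⟩
        exact ⟨e T, (e T).2, rfl⟩
      · rintro ⟨f, hf, rfl⟩
        refine ⟨e.symm ⟨f, hf⟩, ?_⟩
        have h : (e (e.symm ⟨f, hf⟩) : ℂ → ℂ) = f := congrArg Subtype.val (e.apply_symm_apply _)
        exact congrArg (fun f : ℂ → ℂ => fun z => f z / QWeyl.thetaProd τ β z) h
  · rw [hqr] at hQr
    -- Both trace cones are theta cones of the same degree n for the same τ, with possibly different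
    -- characteristics, which a translation matches.
    obtain ⟨s₁, e₁, h₁, -⟩ := QWeyl.exists_coneEquiv_posTheta hτ hi hu hreal hroots hn hcard c
    obtain ⟨s₂, e₂, -, h₂⟩ := QWeyl.exists_coneEquiv_posTheta hτ hi hu hQ hQr hn hQc d
    obtain ⟨e, h⟩ := QWeyl.exists_translation_equiv τ hn s₁ s₂
    exact ⟨(e₁.trans e).trans e₂.symm, (h₁.trans h).trans h₂⟩
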